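/- **Conventions.** Surfaces, curves and diagrams are taken in the piecewise linear category: a surface $F$ is a triangulated surface (compact or not, with or without boundary), curves are edge paths, and a link diagram $D$ with $n$ crossings is a finite graph in the $1$-skeleton which is a $1$-manifold without boundary away from the crossings, and in which each crossing is a vertex whose closed star is a square that $D$ meets exactly in its two diagonals (one of them marked as the overpass); these squares are pairwise disjoint. (Every surface and every link diagram in it can be put into this form.) A simple closed curve is *trivial* if it bounds a disk in $F$, and *unbounding* if it bounds neither a disk nor a Möbius band in $F$; $\mathcal C(F)$ is the set of unoriented unbounding simple closed curves up to free homotopy. A compact connected triangulated surface is a projective plane if it has no boundary and Euler characteristic $1$; a simple closed curve bounds a disk (a Möbius band) if it is the whole boundary of a compact connected subsurface of Euler characteristic $1$ (respectively $0$). Let $F$ be a connected surface and $D$ an unoriented link diagram in $F$ with ordered crossings. An *enhanced state* $S$ of $D$ assigns a marker $\pm1$ to each crossing and a sign $\pm1$ to each circle obtained by smoothing all crossings according to their markers. Put $I(S)=\#\{\text{positive markers}\}-\#\{\text{negative markers}\}$, $\tau(S)=\#\{\text{positive trivial circles}\}-\#\{\text{negative trivial circles}\}$, $J(S)=I(S)+2\tau(S)$,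 and $\Psi(S)=\sum_k\varepsilon_k\gamma_k\in\mathbb Z\mathcal C(F)$, the sum over the unbounding circles $\gamma_k$ of $S$ with their signs $\varepsilon_k$. Let $C(D)$ be the free abelian group on all enhanced states, and $C_{ijs}(D)$ the subgroup spanned by those with $I(S)=i$, $J(S)=j$, $\Psi(S)=s$. For a crossing $v$ let $[S:S']_v=1$ if - (a) $v$ has the marker $+$ in $S$ and $-$ in $S'$; - (b) $S$ and $S'$ have the same markers at all other crossings; - (c) the circles common to $S$ and $S'$ have the same signs in both; - (d) $J(S)=J(S')$ and $\Psi(S)=\Psi(S')$; - (e) if $S$ and $S'$ have different numbers of circles, then $\mu(S)=\mu(S')$, where $\mu$ is the sum of the signs of the non-trivial circles that bound a Möbius band; and $[S:S']_v=0$ otherwise. Let $t(S,v)$ be the number of crossings bigger than $v$ with a negative marker in $S$, and let $$d(S)=\sum_v(-1)^{t(S,v)}\sum_{S'}[S:S']_v\,S' .$$ Then $d$ maps $C_{ijs}(D)$ to $C_{i-2,j,s}(D)$; write $d_{ijs}$ for this restriction. **Theorem 5.1.** (1) If $F$ is not a projective plane, then $d^2=0$. Hence $(C_{*js}(D),d_{*js})$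 is a chain complex, that is $d_{i-2,j,s}\circ d_{ijs}=0$, for all $i,j\in\mathbb Z$ and $s\in\mathbb Z\mathcal C(F)$. (2) For any connected surface $F$, the projective plane included, $d^2=0$ mod $2$, that is $d^2(C(D))\subseteq 2\,C(D)$. Hence $(C_{*js}(D)\otimes\mathbb Z/2,\,d_{*js}\otimes\mathbb Z/2)$ is a chain complex for all $j\in\mathbb Z$ and $s\in\mathbb Z\mathcal C(F)$. -/

import Mathlib

/-! Surfaces, curves and link diagrams are taken in the piecewise linear category: a surface is a
triangulated surface (finite or infinite, with or without boundary), a curve is a closed edge path,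
and a link diagram is a finite subgraph of the `1`-skeleton in which each crossing is a vertex
whose closed star is a square met by the diagram exactly in its two diagonals. -/

namespace PreAbstractSimplicialComplex

variable {V : Type*} [DecidableEq V]

/-- The graph formed by the vertices and edges of a complex. -/
def oneSkeleton (K : PreAbstractSimplicialComplex V) : SimpleGraph V where
  Adj x y := x ≠ y ∧ ({x, y} : Finset V) ∈ K.faces
  symm := ⟨fun x y h => ⟨h.1.symm, by rw [Finset.pair_comm]; exact h.2⟩⟩
  loopless := ⟨fun _ h => h.1 rfl⟩

/-- The link of the vertex `v`, as a graph (for a complex of dimension at most two). -/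
def linkGraph (K : PreAbstractSimplicialComplex V) (v : V) : SimpleGraph V where
  Adj x y := x ≠ y ∧ x ≠ v ∧ y ≠ v ∧ ({v, x, y} : Finset V) ∈ K.faces
  symm := ⟨fun x y h => ⟨h.1.symm, h.2.2.1, h.2.1, by rw [Finset.pair_comm]; exact h.2.2.2⟩⟩
  loopless := ⟨fun _ h => h.1 rfl⟩

/-- `K` is a triangulated surface, possibly with boundary, possibly non-compact: every simplex lies
in a triangle and there are no simplices of higher dimension, every vertex lies in finitely many
simplices, and the link of every vertex is a circle or an arc, that is, a finite connected graph in
which every vertex has degree one or two. -/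
structure IsSurface (K : PreAbstractSimplicialComplex V) : Prop where
  pure : ∀ s ∈ K.faces, ∃ t ∈ K.faces, s ⊆ t ∧ t.card = 3
  dim_le : ∀ s ∈ K.faces, s.card ≤ 3
  star_finite : ∀ v, {s | s ∈ K.faces ∧ v ∈ s}.Finite
  link_connected : ∀ v x y, K.oneSkeleton.Adj v x → K.oneSkeleton.Adj v y →
    (K.linkGraph v).Reachable x y
  link_degree : ∀ v x, ((K.linkGraph v).neighborSet x).encard ≤ 2

/-- A complex is connected if it is non-empty and any two vertices are joined by an edge path. -/
def IsConnected (K : PreAbstractSimplicialComplex V) : Prop :=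
  K.faces.Nonempty ∧
    ∀ x y, ({x} : Finset V) ∈ K.faces → ({y} : Finset V) ∈ K.faces → K.oneSkeleton.Reachable x y

/-- The edges of the boundary: those that lie in exactly one triangle. -/
def boundaryEdges (K : PreAbstractSimplicialComplex V) : Set (Sym2 V) :=
  {e | e ∈ K.oneSkeleton.edgeSet ∧
    ∃! t : Finset V, t ∈ K.faces ∧ t.card = 3 ∧ ∀ x ∈ e, x ∈ t}

/-- The Euler characteristic of a finite complex of dimension at most two. -/
noncomputable def eulerChar (K : PreAbstractSimplicialComplex V) : ℤ :=
  ({s | s ∈ K.faces ∧ s.card = 1}.ncard : ℤ) - ({s | s ∈ K.faces ∧ s.card = 2}.ncard : ℤ) +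
    ({s | s ∈ K.faces ∧ s.card = 3}.ncard : ℤ)

/-- The surface `K` is a projective plane: it is compact, connected, without boundary, and its
Euler characteristic is one. -/
def IsProjectivePlane (K : PreAbstractSimplicialComplex V) : Prop :=
  K.IsSurface ∧ K.faces.Finite ∧ K.IsConnected ∧ K.boundaryEdges = ∅ ∧ K.eulerChar = 1

/-- A closed walk without repetitions in the `1`-skeleton which has `γ` as its set of edges and
visits, in this order, the vertices in the list `l`. -/
def Traces (K : PreAbstractSimplicialComplex V) (l : List V) (γ : Set (Sym2 V)) : Prop :=
  ∃ (a : V) (w : K.oneSkeleton.Walk a a), w.IsCycle ∧ w.support.tail = l ∧ {e | e ∈ w.edges} = γ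

/-- `γ` is (the set of edges of) a simple closed curve in `K`. -/
def IsSimpleClosedCurve (K : PreAbstractSimplicialComplex V) (γ : Set (Sym2 V)) : Prop :=
  ∃ l, K.Traces l γ

/-- The simple closed curve `γ` bounds a disk in `K`: it is the whole boundary of a compact
connected surface in `K` of Euler characteristic one. -/
def BoundsDisk (K : PreAbstractSimplicialComplex V) (γ : Set (Sym2 V)) : Prop :=
  K.IsSimpleClosedCurve γ ∧ ∃ L : PreAbstractSimplicialComplex V, L ≤ K ∧ L.IsSurface ∧
    L.faces.Finite ∧ L.IsConnected ∧ L.boundaryEdges = γ ∧ L.eulerChar = 1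

/-- The simple closed curve `γ` bounds a Möbius band in `K`: it is the whole boundary of a compact
connected surface in `K` of Euler characteristic zero. -/
def BoundsMobiusBand (K : PreAbstractSimplicialComplex V) (γ : Set (Sym2 V)) : Prop :=
  K.IsSimpleClosedCurve γ ∧ ∃ L : PreAbstractSimplicialComplex V, L ≤ K ∧ L.IsSurface ∧
    L.faces.Finite ∧ L.IsConnected ∧ L.boundaryEdges = γ ∧ L.eulerChar = 0

/-- The elementary free homotopies of unoriented closed edge paths. A closed edge path is the
cyclic sequence of vertices in a list; consecutive vertices span a (possibly degenerate) edge. The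
moves change the starting point, reverse the direction, or replace two sides of a (possibly
degenerate) triangle by the third. -/
inductive HomotopyMove (K : PreAbstractSimplicialComplex V) : List V → List V → Prop
  | rotate (a : V) (l : List V) : HomotopyMove K (a :: l) (l ++ [a])
  | reverse (l : List V) : HomotopyMove K l l.reverse
  | contract (a b c : V) (l : List V) (h : ({a, b, c} : Finset V) ∈ K.faces) :
      HomotopyMove K (a :: b :: c :: l) (a :: c :: l)

/-- Free homotopy of unoriented closed edge paths. -/
def Homotopic (K : PreAbstractSimplicialComplex V) : List V → List V → Prop :=
  Relation.EqvGen K.HomotopyMove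

/-- The simple closed curves that bound neither a disk nor a Möbius band. -/
def UnboundingCurve (K : PreAbstractSimplicialComplex V) : Type _ :=
  {γ : Set (Sym2 V) // K.IsSimpleClosedCurve γ ∧ ¬ K.BoundsDisk γ ∧ ¬ K.BoundsMobiusBand γ}

/-- The set of unoriented, unbounding simple closed curves up to homotopy. -/
def CurveClass (K : PreAbstractSimplicialComplex V) : Type _ :=
  Quot fun γ δ : K.UnboundingCurve =>
    ∃ l m, K.Traces l γ.1 ∧ K.Traces m δ.1 ∧ K.Homotopic l m

end PreAbstractSimplicialComplex

/-- An unoriented link diagram with `n` crossings, which are ordered by their indices in `Fin n`,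
in a triangulated surface `F`.

The diagram is a finite graph in the `1`-skeleton. The vertices `corner i 0`, …, `corner i 3` are
the neighbors of the crossing `center i` in the diagram, and they are in this cyclic order the
link of `center i` in the surface. The strand from `corner i 0` to `corner i 2` passes over the
strand from `corner i 1` to `corner i 3`, as seen when the cyclic order of the corners is
counterclockwise. -/
structure LinkDiagram {V : Type*} [DecidableEq V] (F : PreAbstractSimplicialComplex V) (n : ℕ) where
  graph : SimpleGraph V
  graph_le : graph ≤ F.oneSkeleton
  finite : graph.edgeSet.Finite
  center : Fin n → V
  corner : Fin n → Fin 4 → V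
  adj_center : ∀ i y, graph.Adj (center i) y ↔ ∃ k, y = corner i k
  star : ∀ i k, ({center i, corner i k, corner i (k + 1)} : Finset V) ∈ F.faces
  /-- away from the crossings the diagram is a `1`-manifold without boundary -/
  degree : ∀ x, x ∉ Set.range center →
    graph.neighborSet x = ∅ ∨ (graph.neighborSet x).encard = 2
  /-- the squares around the crossings are disjoint, and the diagram meets them only in their
  diagonals -/
  corner_injective : Function.Injective fun p : Fin n × Fin 4 => corner p.1 p.2
  corner_ne_center : ∀ i k j, corner i k ≠ center j
  not_adj_corner : ∀ i k, ¬ graph.Adj (corner i k) (corner i (k + 1))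

namespace LinkDiagram

open scoped Classical in
/-- The two edges that replace the crossing `i` when it is smoothed according to the marker `ε`.
The positive marker joins the two regions which the overpass sweeps when it is rotated
counterclockwise up to the underpass. -/
def smoothingArcs {V : Type*} [DecidableEq V] {F : PreAbstractSimplicialComplex V} {n : ℕ}
    (D : LinkDiagram F n) (i : Fin n) (ε : ℤˣ) : Set (Sym2 V) :=
  if ε = 1 then {s(D.corner i 1, D.corner i 2), s(D.corner i 3, D.corner i 0)}
  else {s(D.corner i 0, D.corner i 1), s(D.corner i 2, D.corner i 3)}

variable {V : Type*} [DecidableEq V] {F : PreAbstractSimplicialComplex V} {n : ℕ}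
  (D : LinkDiagram F n)

/-- The result of smoothing all the crossings of `D` according to the markers `m`. -/
def smoothing (m : Fin n → ℤˣ) : SimpleGraph V :=
  SimpleGraph.fromEdgeSet
    ({e | e ∈ D.graph.edgeSet ∧ ∀ i, D.center i ∉ e} ∪ ⋃ i, D.smoothingArcs i (m i))

/-- The circles, that is the closed loops (as sets of edges) which are obtained by smoothing the
crossings according to `m`. -/
def circles (m : Fin n → ℤˣ) : Set (Set (Sym2 V)) :=
  {γ | ∃ (a : V) (w : (D.smoothing m).Walk a a), w.IsCycle ∧ γ = {e | e ∈ w.edges}}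

theorem finite_circles (m : Fin n → ℤˣ) : (D.circles m).Finite := by
  have h : (D.smoothing m).edgeSet.Finite := by
    rw [smoothing, SimpleGraph.edgeSet_fromEdgeSet]
    refine Set.Finite.sdiff (Set.Finite.union (D.finite.subset fun e he => he.1) ?_)
    refine Set.finite_iUnion fun i => ?_
    unfold smoothingArcs
    split_ifs <;> exact Set.toFinite _
  refine h.finite_subsets.subset ?_
  rintro γ ⟨a, w, -, rfl⟩ e he
  exact w.edges_subset_edgeSet he

instance (m : Fin n → ℤˣ) : Finite (D.circles m) := (D.finite_circles m).to_subtype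

noncomputable instance (m : Fin n → ℤˣ) : Fintype (D.circles m) := Fintype.ofFinite _

/-- The enhanced states of `D`: a marker for each crossing and a sign for each circle. -/
def EnhancedState : Type _ := Σ m : Fin n → ℤˣ, D.circles m → ℤˣ

instance : Finite D.EnhancedState :=
  inferInstanceAs (Finite (Σ m : Fin n → ℤˣ, D.circles m → ℤˣ))

noncomputable instance : Fintype D.EnhancedState := Fintype.ofFinite _

namespace EnhancedState

variable {D}

/-- The marker of `S` at the crossing `v`. -/
def marker (S : D.EnhancedState) (v : Fin n) : ℤˣ := S.1 v

/-- The type of the circles of `S`. -/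
abbrev Circle (S : D.EnhancedState) : Type _ := D.circles S.marker

/-- The sign of a circle of `S`. -/
def sign (S : D.EnhancedState) (γ : S.Circle) : ℤˣ := S.2 γ

/-- The number of positive markers minus the number of negative markers. -/
def I (S : D.EnhancedState) : ℤ := ∑ v, (S.marker v : ℤ)

open scoped Classical in
/-- The number of positive trivial circles minus the number of negative trivial circles. -/
noncomputable def τ (S : D.EnhancedState) : ℤ :=
  ∑ γ : S.Circle, if F.BoundsDisk γ.1 then (S.sign γ : ℤ) else 0

/-- The second grading. -/
noncomputable def J (S : D.EnhancedState) : ℤ := S.I + 2 * S.τ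

open scoped Classical in
/-- The sum of the homotopy classes of the unbounding circles, weighted by their signs. -/
noncomputable def Ψ (S : D.EnhancedState) : F.CurveClass →₀ ℤ :=
  ∑ γ : S.Circle,
    if h : F.IsSimpleClosedCurve γ.1 ∧ ¬ F.BoundsDisk γ.1 ∧ ¬ F.BoundsMobiusBand γ.1 then
      Finsupp.single (Quot.mk _ ⟨γ.1, h⟩) (S.sign γ : ℤ) else 0

open scoped Classical in
/-- The sum of the signs of the non-trivial circles that bound Möbius bands. -/
noncomputable def μ (S : D.EnhancedState) : ℤ :=
  ∑ γ : S.Circle, if F.BoundsMobiusBand γ.1 ∧ ¬ F.BoundsDisk γ.1 then (S.sign γ : ℤ) else 0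

/-- The states `S` and `S'` are incident at `v`. The last condition says that if `v` merges two
circles into one or splits one into two, then the circles that bound Möbius bands obey the same
rule as the unbounding ones: `ε0, - ⟹ ε0` and `+0, -0 ⟹ +`, respectively `- ⟹ +0, -0` and
`ε0 ⟹ ε0, +`. It is void if the surface contains no Möbius band. -/
structure Incident (v : Fin n) (S S' : D.EnhancedState) : Prop where
  marker_pos : S.marker v = 1
  marker_neg : S'.marker v = -1
  marker_eq : ∀ w, w ≠ v → S.marker w = S'.marker w
  sign_eq : ∀ (γ : Set (Sym2 V)) (h : γ ∈ D.circles S.marker) (h' : γ ∈ D.circles S'.marker),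
    S.sign ⟨γ, h⟩ = S'.sign ⟨γ, h'⟩
  J_eq : S.J = S'.J
  Ψ_eq : S.Ψ = S'.Ψ
  μ_eq : Nat.card S.Circle ≠ Nat.card S'.Circle → S.μ = S'.μ

open scoped Classical in
/-- The incidence number `[S : S']_v`. -/
noncomputable def incidence (v : Fin n) (S S' : D.EnhancedState) : ℤ :=
  if Incident v S S' then 1 else 0

open scoped Classical in
/-- The number of negative markers assigned in `S` to crossings bigger than `v`. -/
noncomputable def t (S : D.EnhancedState) (v : Fin n) : ℕ :=
  (Finset.univ.filter fun w : Fin n => v < w ∧ S.marker w = -1).card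

end EnhancedState

/-- The free abelian group spanned by all enhanced states. -/
abbrev Chain : Type _ := D.EnhancedState →₀ ℤ

/-- The partial derivative `d_v(S)` in the direction of the crossing `v`. -/
noncomputable def partialDerivative (v : Fin n) (S : D.EnhancedState) : D.Chain :=
  ∑ S' : D.EnhancedState, Finsupp.single S' (EnhancedState.incidence v S S')

/-- The differential on the group spanned by all enhanced states. -/
noncomputable def d : D.Chain →ₗ[ℤ] D.Chain :=
  Finsupp.linearCombination ℤ fun S : D.EnhancedState =>
    ∑ v : Fin n, (-1 : ℤ) ^ S.t v • D.partialDerivative v S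

/-- The group `C_{ijs}(D)` spanned by the enhanced states `S` with `I(S) = i`, `J(S) = j` and
`Ψ(S) = s`. -/
noncomputable def gradedChain (i j : ℤ) (s : F.CurveClass →₀ ℤ) : Submodule ℤ D.Chain :=
  Finsupp.supported ℤ ℤ {S : D.EnhancedState | S.I = i ∧ S.J = j ∧ S.Ψ = s}

theorem EnhancedState.Incident.I_eq {D : LinkDiagram F n} {v : Fin n} {S S' : D.EnhancedState}
    (h : EnhancedState.Incident v S S') : S'.I = S.I - 2 := by
  unfold EnhancedState.I
  rw [← Finset.add_sum_erase _ _ (Finset.mem_univ v),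
    ← Finset.add_sum_erase Finset.univ (fun w => (S.marker w : ℤ)) (Finset.mem_univ v),
    h.marker_pos, h.marker_neg,
    Finset.sum_congr rfl fun w hw =>
      congrArg Units.val (h.marker_eq w (Finset.ne_of_mem_erase hw)).symm]
  push_cast
  ring

theorem d_mem {i j : ℤ} {s : F.CurveClass →₀ ℤ} (x : D.Chain) (hx : x ∈ D.gradedChain i j s) :
    D.d x ∈ D.gradedChain (i - 2) j s := by
  rw [d, Finsupp.linearCombination_apply]
  refine Submodule.sum_mem _ fun S hS => Submodule.smul_mem _ _ ?_
  obtain ⟨h1, h2, h3⟩ := (Finsupp.mem_supported ℤ x).1 hx hS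
  refine Submodule.sum_mem _ fun v _ => Submodule.smul_mem _ _ ?_
  refine Submodule.sum_mem _ fun S' _ => ?_
  unfold EnhancedState.incidence
  split_ifs with h
  · exact Finsupp.single_mem_supported ℤ _ ⟨by rw [h.I_eq, h1], h.J_eq ▸ h2, h.Ψ_eq ▸ h3⟩
  · rw [Finsupp.single_zero]
    exact Submodule.zero_mem _

/-- The differential `d_{ijs} : C_{ijs}(D) → C_{i-2,j,s}(D)`. -/
noncomputable def gradedD (i j : ℤ) (s : F.CurveClass →₀ ℤ) :
    D.gradedChain i j s →ₗ[ℤ] D.gradedChain (i - 2) j s :=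
  D.d.restrict D.d_mem

end LinkDiagram

/-!
The proof reduces `d ∘ d` to a count of enhanced states. Sort the circles of a state by *color*:
those that bound a disk, those that bound a Möbius band but no disk, and the unbounding ones, by
homotopy class. In terms of the sums of signs over each color, `S` and `S'` are incident at a
crossing if and only if the signs of the common circles agree, the sum over the trivial circles
grows by one, and the other sums are unchanged, except that the sum over the Möbius color is free
when both states have equally many circles (`EnhancedState.incident_iff`).

*Topology.* Changing one marker merges two circles `a`, `b` into a circle `c`, splits a circle, or
turns one circle into another one (`SimpleGraph.IsTangle.trichotomy`). In the first two cases, if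
one of the three circles bounds a disk, then the other two have the same color
(`CircleColor.Triple`). In the last case, if one of the circles bounds a disk, then the other one
bounds a Möbius band, and it bounds a disk as well only in a projective plane. The subsurfaces
bounded by a curve `γ` are encoded as finite sets `T` of triangles with boundary `γ` modulo two
(`IsSurface.boundsDisk_iff`, `IsSurface.boundsMobiusBand_iff`): a set of triangles is determined by
its boundary up to complement, since the surface is connected, so gluing in or cutting out the
square around the crossing, which changes the Euler characteristic by one, translates between the
fillings of `a`, `b` and `c`. The Euler characteristic of a patch with boundary is at most one, and
at most zero when it contains a closed curve that bounds nothing in it; both follow by collapsing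
the patch to a graph along free edges (`exists_collapse`). If the characteristic is one, then the
graph is a tree, so paths in a disk are homotopic to each other, and this gives the homotopies
between the unbounding circles (`IsArcPair.homotopic_of_left`, `IsArcPair.homotopic_of_total`).

*Counting.* For the four states that differ at two crossings `v`, `w`, the intermediate states on
the two sides of the square are counted by case distinction on how many circles meet both crossings
(`ColoredCircles.Square.card_between`). After the circles that are not affected are removed, each
case is a finite check with the local rules for colors and signs. Both counts agree, except possibly
in a projective plane, where both are even instead; hence the signs `(-1) ^ t(S, v)`, which make
every square anticommute, cancel the coefficients of `d ∘ d` in pairs, and in every case they are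
even.
-/

set_option linter.unusedSectionVars false

/-! ### Colors of circles and the rules for their signs -/

/-- The three kinds of circles that the differential distinguishes: circles that bound a disk,
circles that bound a Möbius band but no disk, and unbounding circles, which are sorted by their
homotopy class in `C`. -/
inductive CircleColor (C : Type*)
  | disk
  | mobius
  | essential (c : C)

namespace CircleColor

variable {C : Type*}

/-- Two circles with colors `k₁`, `k₂` and signs `s₁`, `s₂` may merge into a circle with color `k`
and sign `s`. -/
def MergeRule (k₁ : CircleColor C) (s₁ : ℤˣ) (k₂ : CircleColor C) (s₂ : ℤˣ)
    (k : CircleColor C) (s : ℤˣ) : Prop :=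
  (k₁ = disk ∧ s₁ = -1 ∧ k₂ = k ∧ s₂ = s) ∨ (k₂ = disk ∧ s₂ = -1 ∧ k₁ = k ∧ s₁ = s) ∨
    (k = disk ∧ s = 1 ∧ k₁ = k₂ ∧ s₁ = -s₂)

/-- A circle with color `k` and sign `s` may split into two circles with colors `k₁`, `k₂` and
signs `s₁`, `s₂`. This is the merge rule read backwards, with all the signs reversed. -/
def SplitRule (k : CircleColor C) (s : ℤˣ) (k₁ : CircleColor C) (s₁ : ℤˣ)
    (k₂ : CircleColor C) (s₂ : ℤˣ) : Prop :=
  MergeRule k₁ (-s₁) k₂ (-s₂) k (-s)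

/-- A circle with color `k` and sign `s` may turn into one with color `k'` and sign `s'`. -/
def FlipRule (k : CircleColor C) (s : ℤˣ) (k' : CircleColor C) (s' : ℤˣ) : Prop :=
  (k = disk ∧ s = -1 ∧ k' = mobius) ∨ (k = mobius ∧ k' = disk ∧ s' = 1)

/-- The constraint on the colors of three circles that cobound a pair of pants (possibly a
non-orientable one): if one of them bounds a disk, then the other two have the same color. -/
structure Triple (k₁ k₂ k : CircleColor C) : Prop where
  left : k₁ = disk → k₂ = k
  right : k₂ = disk → k₁ = k
  total : k = disk → k₁ = k₂

theorem Triple.comm {k₁ k₂ k : CircleColor C} (h : Triple k₁ k₂ k) : Triple k₂ k₁ k :=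
  ⟨h.right, h.left, fun e => (h.total e).symm⟩

theorem units_one_ne : (1 : ℤˣ) ≠ -1 := by decide

open Classical in
theorem mergeRule_iff (k₁ k₂ k : CircleColor C) (s₁ s₂ s : ℤˣ) :
    MergeRule k₁ s₁ k₂ s₂ k s ↔
      Finsupp.single k₁ (s₁ : ℤ) + Finsupp.single k₂ (s₂ : ℤ) + Finsupp.single disk 1 =
        Finsupp.single k (s : ℤ) := by
  constructor
  · rintro (⟨rfl, rfl, rfl, rfl⟩ | ⟨rfl, rfl, rfl, rfl⟩ | ⟨rfl, rfl, rfl, rfl⟩)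
    · rw [add_right_comm, ← Finsupp.single_add]; simp
    · rw [add_assoc, ← Finsupp.single_add]; simp
    · rw [← Finsupp.single_add]; simp
  · intro h
    have e := fun x => DFunLike.congr_fun h x
    simp only [Finsupp.add_apply, Finsupp.single_apply] at e
    have e1 := e k₁
    have e2 := e k₂
    have e3 := e k
    have e4 := e disk
    have := units_one_ne
    have := units_one_ne.symm
    unfold MergeRule
    rcases Int.units_eq_one_or s₁ with rfl | rfl <;>
    rcases Int.units_eq_one_or s₂ with rfl | rfl <;>
    rcases Int.units_eq_one_or s with rfl | rfl <;>
    simp only [Units.val_one, Units.val_neg, neg_neg, units_one_ne, units_one_ne.symm, false_and,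
      and_false, or_false, false_or, true_and, and_true] at * <;> grind

open Classical in
theorem splitRule_iff (k₁ k₂ k : CircleColor C) (s₁ s₂ s : ℤˣ) :
    SplitRule k s k₁ s₁ k₂ s₂ ↔
      Finsupp.single k (s : ℤ) + Finsupp.single disk 1 =
        Finsupp.single k₁ (s₁ : ℤ) + Finsupp.single k₂ (s₂ : ℤ) := by
  rw [SplitRule, mergeRule_iff]
  simp only [Units.val_neg, Finsupp.single_neg]
  constructor <;> intro h
  · rw [← sub_eq_zero] at h ⊢
    rw [← h]; abel
  · rw [← sub_eq_zero] at h ⊢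
    rw [← h]; abel

open Classical in
theorem flipRule_iff (k k' : CircleColor C) (s s' : ℤˣ) :
    FlipRule k s k' s' ↔ ∀ x ≠ mobius,
      (Finsupp.single k (s : ℤ) + Finsupp.single disk 1 : CircleColor C →₀ ℤ) x =
        Finsupp.single k' (s' : ℤ) x := by
  constructor
  · rintro (⟨rfl, rfl, rfl⟩ | ⟨rfl, rfl, rfl⟩) x hx
    · rw [← Finsupp.single_add]; simp [hx]
    · simp [hx, Finsupp.single_apply]
  · intro e
    simp only [Finsupp.add_apply, Finsupp.single_apply] at e
    have e1 := e k
    have e3 := e k'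
    have e4 := e disk
    have := units_one_ne
    have := units_one_ne.symm
    unfold FlipRule
    rcases Int.units_eq_one_or s with rfl | rfl <;>
    rcases Int.units_eq_one_or s' with rfl | rfl <;>
    simp only [Units.val_one, Units.val_neg, units_one_ne, units_one_ne.symm, false_and,
      and_false, or_false, false_or, true_and, and_true] at * <;> grind

end CircleColor

/-! ### Counting the signs of the intermediate circles -/

namespace CircleColor

variable {C : Type*}

open Classical in
theorem card_units (P : ℤˣ → Prop) :
    Nat.card {s // P s} = (if P 1 then 1 else 0) + (if P (-1) then 1 else 0) := by
  rw [Nat.card_eq_fintype_card, Fintype.card_subtype]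
  have : (Finset.univ : Finset ℤˣ) = {1, -1} := by decide
  rw [this, Finset.filter_insert, Finset.filter_singleton]
  split_ifs <;> simp_all

open Classical in
theorem card_units_prod (P : ℤˣ → ℤˣ → Prop) :
    Nat.card {s : ℤˣ × ℤˣ // P s.1 s.2} = (if P 1 1 then 1 else 0) + (if P 1 (-1) then 1 else 0) +
      (if P (-1) 1 then 1 else 0) + (if P (-1) (-1) then 1 else 0) := by
  rw [Nat.card_eq_fintype_card, Fintype.card_subtype]
  have : (Finset.univ : Finset (ℤˣ × ℤˣ)) = {(1, 1), (1, -1), (-1, 1), (-1, -1)} := by decide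
  rw [this]
  simp only [Finset.filter_insert, Finset.filter_singleton]
  split_ifs <;> simp_all

section

set_option linter.unusedSimpArgs false

variable {a a₁ a₂ b b' c c₁ c₂ u w : CircleColor C} (s s₁ s₂ t t₁ t₂ r : ℤˣ)

theorem card_merge_flip (h0 : Triple a u b) (h1 : Triple b' u c) :
    Nat.card {x // MergeRule a s u r b x ∧ FlipRule b x c t} =
      Nat.card {x // FlipRule a s b' x ∧ MergeRule b' x u r c t} := by
  obtain ⟨h0, h0', h0''⟩ := h0
  obtain ⟨h1, h1', h1''⟩ := h1
  rw [card_units, card_units]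
  have := units_one_ne
  have := units_one_ne.symm
  have := neg_neg (1 : ℤˣ)
  rcases Int.units_eq_one_or s with rfl | rfl <;>
  rcases Int.units_eq_one_or r with rfl | rfl <;>
  rcases Int.units_eq_one_or t with rfl | rfl <;>
  simp only [MergeRule, SplitRule, FlipRule, neg_neg, eq_self, units_one_ne, units_one_ne.symm,
    false_and, and_false, or_false, false_or, true_and, and_true, if_false] <;> grind

theorem card_split_flip (h0 : Triple b u a) (h1 : Triple c u b') :
    Nat.card {x // SplitRule a s b x u r ∧ FlipRule b x c t} =
      Nat.card {x // FlipRule a s b' x ∧ SplitRule b' x c t u r} := by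
  obtain ⟨h0, h0', h0''⟩ := h0
  obtain ⟨h1, h1', h1''⟩ := h1
  rw [card_units, card_units]
  have := units_one_ne
  have := units_one_ne.symm
  have := neg_neg (1 : ℤˣ)
  rcases Int.units_eq_one_or s with rfl | rfl <;>
  rcases Int.units_eq_one_or r with rfl | rfl <;>
  rcases Int.units_eq_one_or t with rfl | rfl <;>
  simp only [MergeRule, SplitRule, FlipRule, neg_neg, eq_self, units_one_ne, units_one_ne.symm,
    false_and, and_false, or_false, false_or, true_and, and_true, if_false] <;> grind

theorem card_merge_merge (h0 : Triple a u b) (h1 : Triple b w c) (h2 : Triple a w b')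
    (h3 : Triple b' u c) :
    Nat.card {x // MergeRule a s u s₁ b x ∧ MergeRule b x w s₂ c t} =
      Nat.card {x // MergeRule a s w s₂ b' x ∧ MergeRule b' x u s₁ c t} := by
  obtain ⟨h0, h0', h0''⟩ := h0
  obtain ⟨h1, h1', h1''⟩ := h1
  obtain ⟨h2, h2', h2''⟩ := h2
  obtain ⟨h3, h3', h3''⟩ := h3
  rw [card_units, card_units]
  have := units_one_ne
  have := units_one_ne.symm
  have := neg_neg (1 : ℤˣ)
  rcases Int.units_eq_one_or s with rfl | rfl <;>
  rcases Int.units_eq_one_or s₁ with rfl | rfl <;>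
  rcases Int.units_eq_one_or s₂ with rfl | rfl <;>
  rcases Int.units_eq_one_or t with rfl | rfl <;>
  simp only [MergeRule, SplitRule, FlipRule, neg_neg, eq_self, units_one_ne, units_one_ne.symm,
    false_and, and_false, or_false, false_or, true_and, and_true, if_false] <;> grind

theorem card_merge_split (h0 : Triple a u b) (h1 : Triple c w b) (h2 : Triple b' w a)
    (h3 : Triple b' u c) :
    Nat.card {x // MergeRule a s u s₁ b x ∧ SplitRule b x c t w s₂} =
      Nat.card {x // SplitRule a s b' x w s₂ ∧ MergeRule b' x u s₁ c t} := by
  obtain ⟨h0, h0', h0''⟩ := h0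
  obtain ⟨h1, h1', h1''⟩ := h1
  obtain ⟨h2, h2', h2''⟩ := h2
  obtain ⟨h3, h3', h3''⟩ := h3
  rw [card_units, card_units]
  have := units_one_ne
  have := units_one_ne.symm
  have := neg_neg (1 : ℤˣ)
  rcases Int.units_eq_one_or s with rfl | rfl <;>
  rcases Int.units_eq_one_or s₁ with rfl | rfl <;>
  rcases Int.units_eq_one_or s₂ with rfl | rfl <;>
  rcases Int.units_eq_one_or t with rfl | rfl <;>
  simp only [MergeRule, SplitRule, FlipRule, neg_neg, eq_self, units_one_ne, units_one_ne.symm,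
    false_and, and_false, or_false, false_or, true_and, and_true, if_false] <;> grind

theorem card_split_split (h0 : Triple b u a) (h1 : Triple c w b) (h2 : Triple b' w a)
    (h3 : Triple c u b') :
    Nat.card {x // SplitRule a s b x u s₁ ∧ SplitRule b x c t w s₂} =
      Nat.card {x // SplitRule a s b' x w s₂ ∧ SplitRule b' x c t u s₁} := by
  obtain ⟨h0, h0', h0''⟩ := h0
  obtain ⟨h1, h1', h1''⟩ := h1
  obtain ⟨h2, h2', h2''⟩ := h2
  obtain ⟨h3, h3', h3''⟩ := h3
  rw [card_units, card_units]
  have := units_one_ne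
  have := units_one_ne.symm
  have := neg_neg (1 : ℤˣ)
  rcases Int.units_eq_one_or s with rfl | rfl <;>
  rcases Int.units_eq_one_or s₁ with rfl | rfl <;>
  rcases Int.units_eq_one_or s₂ with rfl | rfl <;>
  rcases Int.units_eq_one_or t with rfl | rfl <;>
  simp only [MergeRule, SplitRule, FlipRule, neg_neg, eq_self, units_one_ne, units_one_ne.symm,
    false_and, and_false, or_false, false_or, true_and, and_true, if_false] <;> grind

theorem card_mergeBoth_splitBoth (h0 : Triple a₁ a₂ b) (h1 : Triple c₁ c₂ b)
    (h2 : Triple a₁ a₂ b') (h3 : Triple c₁ c₂ b') :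
    Nat.card {x // MergeRule a₁ s₁ a₂ s₂ b x ∧ SplitRule b x c₁ t₁ c₂ t₂} =
      Nat.card {x // MergeRule a₁ s₁ a₂ s₂ b' x ∧ SplitRule b' x c₁ t₁ c₂ t₂} := by
  obtain ⟨h0, h0', h0''⟩ := h0
  obtain ⟨h1, h1', h1''⟩ := h1
  obtain ⟨h2, h2', h2''⟩ := h2
  obtain ⟨h3, h3', h3''⟩ := h3
  rw [card_units, card_units]
  have := units_one_ne
  have := units_one_ne.symm
  have := neg_neg (1 : ℤˣ)
  rcases Int.units_eq_one_or s₁ with rfl | rfl <;>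
  rcases Int.units_eq_one_or s₂ with rfl | rfl <;>
  rcases Int.units_eq_one_or t₁ with rfl | rfl <;>
  rcases Int.units_eq_one_or t₂ with rfl | rfl <;>
  simp only [MergeRule, SplitRule, FlipRule, neg_neg, eq_self, units_one_ne, units_one_ne.symm,
    false_and, and_false, or_false, false_or, true_and, and_true, if_false] <;> grind

theorem card_mergeBoth_flip (h0 : Triple a₁ a₂ b) (h1 : Triple a₁ a₂ b') :
    Nat.card {x // MergeRule a₁ s₁ a₂ s₂ b x ∧ FlipRule b x c t} =
      Nat.card {x // MergeRule a₁ s₁ a₂ s₂ b' x ∧ FlipRule b' x c t} := by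
  obtain ⟨h0, h0', h0''⟩ := h0
  obtain ⟨h1, h1', h1''⟩ := h1
  rw [card_units, card_units]
  have := units_one_ne
  have := units_one_ne.symm
  have := neg_neg (1 : ℤˣ)
  rcases Int.units_eq_one_or s₁ with rfl | rfl <;>
  rcases Int.units_eq_one_or s₂ with rfl | rfl <;>
  rcases Int.units_eq_one_or t with rfl | rfl <;>
  simp only [MergeRule, SplitRule, FlipRule, neg_neg, eq_self, units_one_ne, units_one_ne.symm,
    false_and, and_false, or_false, false_or, true_and, and_true, if_false] <;> grind

theorem card_flip_splitBoth (h0 : Triple c₁ c₂ b) (h1 : Triple c₁ c₂ b') :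
    Nat.card {x // FlipRule a s b x ∧ SplitRule b x c₁ t₁ c₂ t₂} =
      Nat.card {x // FlipRule a s b' x ∧ SplitRule b' x c₁ t₁ c₂ t₂} := by
  obtain ⟨h0, h0', h0''⟩ := h0
  obtain ⟨h1, h1', h1''⟩ := h1
  rw [card_units, card_units]
  have := units_one_ne
  have := units_one_ne.symm
  have := neg_neg (1 : ℤˣ)
  rcases Int.units_eq_one_or s with rfl | rfl <;>
  rcases Int.units_eq_one_or t₁ with rfl | rfl <;>
  rcases Int.units_eq_one_or t₂ with rfl | rfl <;>
  simp only [MergeRule, SplitRule, FlipRule, neg_neg, eq_self, units_one_ne, units_one_ne.symm,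
    false_and, and_false, or_false, false_or, true_and, and_true, if_false] <;> grind

open Classical in
theorem card_flip_flip : Nat.card {x // FlipRule a s b x ∧ FlipRule b x c t} =
    if (a = disk ∧ s = -1 ∧ c = disk ∧ t = 1) ∧ b = mobius then 2 else 0 := by
  rw [card_units]
  have := units_one_ne
  have := units_one_ne.symm
  have := neg_neg (1 : ℤˣ)
  rcases Int.units_eq_one_or s with rfl | rfl <;>
  rcases Int.units_eq_one_or t with rfl | rfl <;>
  simp only [FlipRule, eq_self, units_one_ne, units_one_ne.symm, false_and, and_false, or_false,
    false_or, true_and, and_true, if_false] <;> grind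

open Classical in
theorem card_split_merge {b₁ b₂ : CircleColor C} (h : Triple b₁ b₂ a) (h' : Triple b₁ b₂ c) :
    Nat.card {x : ℤˣ × ℤˣ // SplitRule a s b₁ x.1 b₂ x.2 ∧ MergeRule b₁ x.1 b₂ x.2 c t} =
      if a = disk ∧ s = -1 ∧ c = disk ∧ t = 1 then 2 else 0 := by
  obtain ⟨h1, h2, h3⟩ := h
  obtain ⟨h1', h2', h3'⟩ := h'
  rw [card_units_prod fun x y => SplitRule a s b₁ x b₂ y ∧ MergeRule b₁ x b₂ y c t]
  have := units_one_ne
  have := units_one_ne.symm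
  have := neg_neg (1 : ℤˣ)
  rcases Int.units_eq_one_or s with rfl | rfl <;>
  rcases Int.units_eq_one_or t with rfl | rfl <;>
  simp only [MergeRule, SplitRule, neg_neg, eq_self, units_one_ne, units_one_ne.symm, false_and,
    and_false, or_false, false_or, true_and, and_true, if_false] <;> grind

end

end CircleColor

/-! ### Sets of colored circles -/

namespace ColoredCircles

open CircleColor

variable {Γ C : Type*} (κ : Γ → CircleColor C)

/-- The signs `f` of the circles in `P`, sorted by color, as an element of the free abelian group
on the colors. -/
noncomputable def weight (P : Finset Γ) (f : Γ → ℤˣ) : CircleColor C →₀ ℤ :=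
  ∑ x ∈ P, Finsupp.single (κ x) (f x : ℤ)

/-- The balance of weights when the circles in `P` with signs `f` are replaced by those in `Q` with
signs `g`: the weight of the trivial circles grows by one and the other weights are unchanged,
except that the weight of the circles that bound Möbius bands is free if `P` and `Q` have equally
many circles. -/
def Balanced (P Q : Finset Γ) (f g : Γ → ℤˣ) : Prop :=
  (∀ k ≠ mobius, (weight κ P f + Finsupp.single disk 1 : CircleColor C →₀ ℤ) k = weight κ Q g k) ∧
    (P.card ≠ Q.card → (weight κ P f + Finsupp.single disk 1 : CircleColor C →₀ ℤ) mobius =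
      weight κ Q g mobius)

/-- The incidence of the states with circles `A` and signs `f`, and with circles `B` and
signs `g`. -/
def Incident (A B : Finset Γ) (f g : Γ → ℤˣ) : Prop :=
  (∀ x ∈ A, x ∈ B → f x = g x) ∧ Balanced κ A B f g

variable {κ}

theorem weight_congr {P : Finset Γ} {f g : Γ → ℤˣ} (h : ∀ x ∈ P, f x = g x) :
    weight κ P f = weight κ P g :=
  Finset.sum_congr rfl fun x hx => by rw [h x hx]

theorem balanced_flip_iff {x y : Γ} (f g : Γ → ℤˣ) :
    Balanced κ {x} {y} f g ↔ FlipRule (κ x) (f x) (κ y) (g y) := by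
  rw [flipRule_iff]
  unfold Balanced weight
  simp

variable [DecidableEq Γ]

variable (κ) in
/-- The change of the set of circles when a crossing is smoothed in the other way: two circles
merge, a circle splits, or a circle turns into another circle, and the colors obey the constraints
that the topology of the surface imposes. The proposition `p` says that the surface is a
projective plane. -/
inductive Transition (p : Prop) (A B : Finset Γ) : Prop
  | merge (x₁ x₂ y : Γ) (hne : x₁ ≠ x₂) (hA : A \ B = {x₁, x₂}) (hB : B \ A = {y})
      (h : Triple (κ x₁) (κ x₂) (κ y))
  | split (x y₁ y₂ : Γ) (hne : y₁ ≠ y₂) (hA : A \ B = {x}) (hB : B \ A = {y₁, y₂})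
      (h : Triple (κ y₁) (κ y₂) (κ x))
  | flip (x y : Γ) (hA : A \ B = {x}) (hB : B \ A = {y})
      (h : κ x = disk → κ y = mobius ∨ (κ y = disk ∧ p))

theorem weight_inter_add_sdiff (A B : Finset Γ) (f : Γ → ℤˣ) :
    weight κ (A ∩ B) f + weight κ (A \ B) f = weight κ A f := by
  unfold weight
  rw [← Finset.sum_union (Finset.disjoint_left.2 fun x h1 h2 =>
    (Finset.mem_sdiff.1 h2).2 (Finset.mem_inter.1 h1).2)]
  congr 1
  ext x; simp only [Finset.mem_union, Finset.mem_inter, Finset.mem_sdiff]; tauto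

theorem balanced_sdiff_iff {A B : Finset Γ} {f g : Γ → ℤˣ} (h : ∀ x ∈ A, x ∈ B → f x = g x) :
    Balanced κ A B f g ↔ Balanced κ (A \ B) (B \ A) f g := by
  have hc : A.card ≠ B.card ↔ (A \ B).card ≠ (B \ A).card := by
    have h1 := Finset.card_sdiff_add_card_inter A B
    have h2 := Finset.card_sdiff_add_card_inter B A
    rw [Finset.inter_comm B A] at h2
    omega
  have hw : weight κ (A ∩ B) f = weight κ (B ∩ A) g := by
    rw [Finset.inter_comm B A]
    exact weight_congr fun x hx => h x (Finset.mem_inter.1 hx).1 (Finset.mem_inter.1 hx).2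
  unfold Balanced
  rw [hc, ← weight_inter_add_sdiff A B f, ← weight_inter_add_sdiff B A g, hw]
  simp only [Finsupp.add_apply, add_assoc, add_right_inj]

theorem balanced_merge_iff {x₁ x₂ y : Γ} (hne : x₁ ≠ x₂) (f g : Γ → ℤˣ) :
    Balanced κ {x₁, x₂} {y} f g ↔ MergeRule (κ x₁) (f x₁) (κ x₂) (f x₂) (κ y) (g y) := by
  rw [mergeRule_iff, DFunLike.ext_iff]
  unfold Balanced weight
  rw [Finset.sum_pair hne, Finset.sum_singleton, Finset.card_pair hne, Finset.card_singleton]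
  constructor
  · rintro ⟨h1, h2⟩ k
    by_cases hk : k = mobius
    · rw [hk]; exact h2 (by decide)
    · exact h1 k hk
  · exact fun h => ⟨fun k _ => h k, fun _ => h _⟩

theorem balanced_split_iff {x y₁ y₂ : Γ} (hne : y₁ ≠ y₂) (f g : Γ → ℤˣ) :
    Balanced κ {x} {y₁, y₂} f g ↔ SplitRule (κ x) (f x) (κ y₁) (g y₁) (κ y₂) (g y₂) := by
  rw [splitRule_iff, DFunLike.ext_iff]
  unfold Balanced weight
  rw [Finset.sum_pair hne, Finset.sum_singleton, Finset.card_pair hne, Finset.card_singleton]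
  constructor
  · rintro ⟨h1, h2⟩ k
    by_cases hk : k = mobius
    · rw [hk]; exact h2 (by decide)
    · exact h1 k hk
  · exact fun h => ⟨fun k _ => h k, fun _ => h _⟩

theorem pair_eq_cases {x₁ x₂ y u : Γ} (h : ({x₁, x₂} : Finset Γ) = {y, u}) :
    (x₁ = y ∧ x₂ = u) ∨ (x₁ = u ∧ x₂ = y) := by
  have h1 : x₁ ∈ ({y, u} : Finset Γ) := h ▸ by simp
  have h2 : x₂ ∈ ({y, u} : Finset Γ) := h ▸ by simp
  have h3 : y ∈ ({x₁, x₂} : Finset Γ) := h ▸ by simp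
  have h4 : u ∈ ({x₁, x₂} : Finset Γ) := h ▸ by simp
  simp only [Finset.mem_insert, Finset.mem_singleton] at h1 h2 h3 h4
  grind

namespace Transition

variable {p : Prop} {A B : Finset Γ}

theorem card_le (h : Transition κ p A B) : ((A \ B).card = 2 ∧ (B \ A).card = 1) ∨
    ((A \ B).card = 1 ∧ (B \ A).card = 2) ∨ ((A \ B).card = 1 ∧ (B \ A).card = 1) := by
  rcases h with ⟨x₁, x₂, y, hne, hA, hB, h⟩ | ⟨x, y₁, y₂, hne, hA, hB, h⟩ | ⟨x, y, hA, hB, h⟩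
  · exact Or.inl ⟨by rw [hA, Finset.card_pair hne], by rw [hB, Finset.card_singleton]⟩
  · exact Or.inr (Or.inl ⟨by rw [hA, Finset.card_singleton], by rw [hB, Finset.card_pair hne]⟩)
  · exact Or.inr (Or.inr ⟨by rw [hA, Finset.card_singleton], by rw [hB, Finset.card_singleton]⟩)

theorem triple_of_merge (h : Transition κ p A B) {x₁ x₂ y : Γ} (hne : x₁ ≠ x₂)
    (hA : A \ B = {x₁, x₂}) (hB : B \ A = {y}) : Triple (κ x₁) (κ x₂) (κ y) := by
  rcases h with ⟨z₁, z₂, w, hne', hA', hB', h⟩ | ⟨z, w₁, w₂, hne', hA', hB', h⟩ |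
    ⟨z, w, hA', hB', h⟩
  · rw [hB, Finset.singleton_inj] at hB'
    subst hB'
    rw [hA] at hA'
    obtain ⟨rfl, rfl⟩ | ⟨rfl, rfl⟩ := pair_eq_cases hA'
    · exact h
    · exact h.comm
  · rw [hA] at hA'
    simpa [hne] using congrArg Finset.card hA'
  · rw [hA] at hA'
    simpa [hne] using congrArg Finset.card hA'

theorem triple_of_split (h : Transition κ p A B) {x y₁ y₂ : Γ} (hne : y₁ ≠ y₂)
    (hA : A \ B = {x}) (hB : B \ A = {y₁, y₂}) : Triple (κ y₁) (κ y₂) (κ x) := by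
  rcases h with ⟨z₁, z₂, w, hne', hA', hB', h⟩ | ⟨z, w₁, w₂, hne', hA', hB', h⟩ |
    ⟨z, w, hA', hB', h⟩
  · rw [hB] at hB'
    simpa [hne] using congrArg Finset.card hB'
  · rw [hA, Finset.singleton_inj] at hA'
    subst hA'
    rw [hB] at hB'
    obtain ⟨rfl, rfl⟩ | ⟨rfl, rfl⟩ := pair_eq_cases hB'
    · exact h
    · exact h.comm
  · rw [hB] at hB'
    simpa [hne] using congrArg Finset.card hB'

theorem color_of_flip (h : Transition κ p A B) {x y : Γ} (hA : A \ B = {x}) (hB : B \ A = {y}) :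
    κ x = disk → κ y = mobius ∨ (κ y = disk ∧ p) := by
  rcases h with ⟨z₁, z₂, w, hne', hA', hB', h⟩ | ⟨z, w₁, w₂, hne', hA', hB', h⟩ |
    ⟨z, w, hA', hB', h⟩
  · rw [hA] at hA'
    simpa [hne'] using congrArg Finset.card hA'
  · rw [hB] at hB'
    simpa [hne'] using congrArg Finset.card hB'
  · rw [hA, Finset.singleton_inj] at hA'
    rw [hB, Finset.singleton_inj] at hB'
    rw [hA', hB']
    exact h

end Transition

/-- The possible signs of the circles in `B` between the states with circles `A` and signs `f`, and
with circles `C` and signs `h`. They are normalized to be `1` off `B`. -/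
def Between (κ : Γ → CircleColor C) (A B D : Finset Γ) (f h : Γ → ℤˣ) : Type _ :=
  {g : Γ → ℤˣ // (∀ x, x ∉ B → g x = 1) ∧ Incident κ A B f g ∧ Incident κ B D g h}

section Count

variable {A B D : Finset Γ} {f h : Γ → ℤˣ}

theorem card_between_eq_zero (hAD : A ∩ D ⊆ B) (hfh : ¬ ∀ x ∈ A, x ∈ D → f x = h x) :
    Nat.card (Between κ A B D f h) = 0 := by
  have : IsEmpty (Between κ A B D f h) := ⟨fun ⟨g, _, h1, h2⟩ => hfh fun x hA hD => by
    have hB := hAD (Finset.mem_inter.2 ⟨hA, hD⟩)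
    rw [h1.1 x hA hB, h2.1 x hB hD]⟩
  exact Nat.card_of_isEmpty

/-- The signs that are forced by the two neighboring states. -/
noncomputable def forced (A D : Finset Γ) (f h : Γ → ℤˣ) (B : Finset Γ) (x : Γ) : ℤˣ :=
  if x ∈ B then if x ∈ A then f x else if x ∈ D then h x else 1 else 1

open Classical in
theorem card_between_of_subset (hfh : ∀ x ∈ A, x ∈ D → f x = h x) (hB : B ⊆ A ∪ D)
    (R₁ R₂ : Prop)
    (h₁ : ∀ g : Γ → ℤˣ, (∀ x ∈ A, x ∈ B → f x = g x) → (∀ x ∈ B, x ∈ D → g x = h x) →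
      (Balanced κ (A \ B) (B \ A) f g ↔ R₁))
    (h₂ : ∀ g : Γ → ℤˣ, (∀ x ∈ A, x ∈ B → f x = g x) → (∀ x ∈ B, x ∈ D → g x = h x) →
      (Balanced κ (B \ D) (D \ B) g h ↔ R₂)) :
    Nat.card (Between κ A B D f h) = if R₁ ∧ R₂ then 1 else 0 := by
  have e1 : ∀ x ∈ A, x ∈ B → f x = forced A D f h B x := fun x hA hB => by simp [forced, hA, hB]
  have e2 : ∀ x ∈ B, x ∈ D → forced A D f h B x = h x := fun x hB hD => by
    by_cases hA : x ∈ A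
    · simp [forced, hA, hB, hfh x hA hD]
    · simp [forced, hA, hB, hD]
  have hsub : Subsingleton (Between κ A B D f h) := ⟨fun ⟨g, a1, a2, a3⟩ ⟨g', b1, b2, b3⟩ => by
    refine Subtype.ext (funext fun x => ?_)
    change g x = g' x
    by_cases hx : x ∈ B
    · rcases Finset.mem_union.1 (hB hx) with hA | hD
      · rw [← a2.1 x hA hx, ← b2.1 x hA hx]
      · rw [a3.1 x hx hD, b3.1 x hx hD]
    · rw [a1 x hx, b1 x hx]⟩
  split_ifs with hR
  · refine Nat.card_eq_one_iff_unique.2 ⟨hsub, ⟨⟨forced A D f h B, ?_, ?_, ?_⟩⟩⟩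
    · intro x hx; simp [forced, hx]
    · exact ⟨e1, (balanced_sdiff_iff e1).2 ((h₁ _ e1 e2).2 hR.1)⟩
    · exact ⟨e2, (balanced_sdiff_iff e2).2 ((h₂ _ e1 e2).2 hR.2)⟩
  · have : IsEmpty (Between κ A B D f h) := ⟨fun ⟨g, a1, a2, a3⟩ => hR
      ⟨(h₁ g a2.1 a3.1).1 ((balanced_sdiff_iff a2.1).1 a2.2),
        (h₂ g a2.1 a3.1).1 ((balanced_sdiff_iff a3.1).1 a3.2)⟩⟩
    exact Nat.card_of_isEmpty

theorem card_between_of_singleton (hfh : ∀ x ∈ A, x ∈ D → f x = h x) {b : Γ}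
    (hB : B \ (A ∪ D) = {b}) (R₁ R₂ : ℤˣ → Prop)
    (h₁ : ∀ g : Γ → ℤˣ, (∀ x ∈ A, x ∈ B → f x = g x) → (∀ x ∈ B, x ∈ D → g x = h x) →
      (Balanced κ (A \ B) (B \ A) f g ↔ R₁ (g b)))
    (h₂ : ∀ g : Γ → ℤˣ, (∀ x ∈ A, x ∈ B → f x = g x) → (∀ x ∈ B, x ∈ D → g x = h x) →
      (Balanced κ (B \ D) (D \ B) g h ↔ R₂ (g b))) :
    Nat.card (Between κ A B D f h) = Nat.card {s // R₁ s ∧ R₂ s} := by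
  have hb : b ∈ B \ (A ∪ D) := hB ▸ Finset.mem_singleton_self b
  simp only [Finset.mem_sdiff, Finset.mem_union, not_or] at hb
  have hm : ∀ x ∈ B, x ∉ A → x ∉ D → x = b := fun x h1 h2 h3 => by
    rw [← Finset.mem_singleton, ← hB]; simp [h1, h2, h3]
  refine Nat.card_eq_of_bijective (fun g => ⟨g.1 b,
    (h₁ g.1 g.2.2.1.1 g.2.2.2.1).1 ((balanced_sdiff_iff g.2.2.1.1).1 g.2.2.1.2),
    (h₂ g.1 g.2.2.1.1 g.2.2.2.1).1 ((balanced_sdiff_iff g.2.2.2.1).1 g.2.2.2.2)⟩) ⟨?_, ?_⟩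
  · rintro ⟨g, a1, a2, a3⟩ ⟨g', b1, b2, b3⟩ hg
    have hg : g b = g' b := congrArg Subtype.val hg
    refine Subtype.ext (funext fun x => ?_)
    change g x = g' x
    by_cases hx : x ∈ B
    · by_cases hA : x ∈ A
      · rw [← a2.1 x hA hx, ← b2.1 x hA hx]
      by_cases hD : x ∈ D
      · rw [a3.1 x hx hD, b3.1 x hx hD]
      rw [hm x hx hA hD, hg]
    · rw [a1 x hx, b1 x hx]
  · rintro ⟨s, r1, r2⟩
    set g := Function.update (forced A D f h B) b s with hg
    have e0 : g b = s := Function.update_self ..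
    have e1 : ∀ x ∈ A, x ∈ B → f x = g x := fun x hA hB => by
      rw [hg, Function.update_of_ne (by rintro rfl; exact hb.2.1 hA)]; simp [forced, hA, hB]
    have e2 : ∀ x ∈ B, x ∈ D → g x = h x := fun x hB hD => by
      rw [hg, Function.update_of_ne (by rintro rfl; exact hb.2.2 hD)]
      by_cases hA : x ∈ A
      · simp [forced, hA, hB, hfh x hA hD]
      · simp [forced, hA, hB, hD]
    refine ⟨⟨g, fun x hx => ?_, ⟨e1, (balanced_sdiff_iff e1).2 ((h₁ _ e1 e2).2 (e0.symm ▸ r1))⟩,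
      ⟨e2, (balanced_sdiff_iff e2).2 ((h₂ _ e1 e2).2 (e0.symm ▸ r2))⟩⟩, Subtype.ext e0⟩
    rw [hg, Function.update_of_ne (by rintro rfl; exact hx hb.1)]; simp [forced, hx]

theorem card_between_of_pair (hfh : ∀ x ∈ A, x ∈ D → f x = h x) {b₁ b₂ : Γ} (hne : b₁ ≠ b₂)
    (hB : B \ (A ∪ D) = {b₁, b₂}) (R₁ R₂ : ℤˣ → ℤˣ → Prop)
    (h₁ : ∀ g : Γ → ℤˣ, (Balanced κ (A \ B) (B \ A) f g ↔ R₁ (g b₁) (g b₂)))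
    (h₂ : ∀ g : Γ → ℤˣ, (Balanced κ (B \ D) (D \ B) g h ↔ R₂ (g b₁) (g b₂))) :
    Nat.card (Between κ A B D f h) =
      Nat.card {s : ℤˣ × ℤˣ // R₁ s.1 s.2 ∧ R₂ s.1 s.2} := by
  have hb₁ : b₁ ∈ B \ (A ∪ D) := by rw [hB]; simp
  have hb₂ : b₂ ∈ B \ (A ∪ D) := by rw [hB]; simp
  simp only [Finset.mem_sdiff, Finset.mem_union, not_or] at hb₁ hb₂
  have hm : ∀ x ∈ B, x ∉ A → x ∉ D → x = b₁ ∨ x = b₂ := fun x h1 h2 h3 => by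
    have : x ∈ B \ (A ∪ D) := by simp [h1, h2, h3]
    rw [hB] at this; simpa using this
  refine Nat.card_eq_of_bijective (fun g => ⟨(g.1 b₁, g.1 b₂),
    (h₁ g.1).1 ((balanced_sdiff_iff g.2.2.1.1).1 g.2.2.1.2),
    (h₂ g.1).1 ((balanced_sdiff_iff g.2.2.2.1).1 g.2.2.2.2)⟩) ⟨?_, ?_⟩
  · rintro ⟨g, a1, a2, a3⟩ ⟨g', b1, b2, b3⟩ hg
    have hg : (g b₁, g b₂) = (g' b₁, g' b₂) := congrArg Subtype.val hg
    rw [Prod.mk.injEq] at hg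
    refine Subtype.ext (funext fun x => ?_)
    change g x = g' x
    by_cases hx : x ∈ B
    · by_cases hA : x ∈ A
      · rw [← a2.1 x hA hx, ← b2.1 x hA hx]
      by_cases hD : x ∈ D
      · rw [a3.1 x hx hD, b3.1 x hx hD]
      rcases hm x hx hA hD with rfl | rfl
      · exact hg.1
      · exact hg.2
    · rw [a1 x hx, b1 x hx]
  · rintro ⟨⟨s₁, s₂⟩, r1, r2⟩
    set g := Function.update (Function.update (forced A D f h B) b₁ s₁) b₂ s₂ with hg
    have ea : g b₂ = s₂ := Function.update_self ..
    have eb : g b₁ = s₁ := by rw [hg, Function.update_of_ne hne, Function.update_self]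
    have e1 : ∀ x ∈ A, x ∈ B → f x = g x := fun x hA hB => by
      rw [hg, Function.update_of_ne (by rintro rfl; exact hb₂.2.1 hA),
        Function.update_of_ne (by rintro rfl; exact hb₁.2.1 hA)]; simp [forced, hA, hB]
    have e2 : ∀ x ∈ B, x ∈ D → g x = h x := fun x hB hD => by
      rw [hg, Function.update_of_ne (by rintro rfl; exact hb₂.2.2 hD),
        Function.update_of_ne (by rintro rfl; exact hb₁.2.2 hD)]
      by_cases hA : x ∈ A
      · simp [forced, hA, hB, hfh x hA hD]
      · simp [forced, hA, hB, hD]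
    refine ⟨⟨g, fun x hx => ?_,
      ⟨e1, (balanced_sdiff_iff e1).2 ((h₁ _).2 (by rw [ea, eb]; exact r1))⟩,
      ⟨e2, (balanced_sdiff_iff e2).2 ((h₂ _).2 (by rw [ea, eb]; exact r2))⟩⟩,
      Subtype.ext (Prod.ext eb ea)⟩
    rw [hg, Function.update_of_ne (by rintro rfl; exact hx hb₂.1),
      Function.update_of_ne (by rintro rfl; exact hx hb₁.1)]; simp [forced, hx]

end Count

end ColoredCircles

/-! ### Changes at two crossings -/

namespace ColoredCircles

open CircleColor

variable {Γ C : Type*} {κ : Γ → CircleColor C}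

theorem eq_singleton_of_card_le {X : Finset Γ} {x : Γ} (hx : x ∈ X) (hc : X.card ≤ 1) :
    X = {x} :=
  (Finset.eq_of_subset_of_card_le (by simp [hx]) (by simpa using hc)).symm

variable [DecidableEq Γ]

theorem mem_of_sdiff_eq {A B P : Finset Γ} (h : A \ B = P) {x : Γ} (hx : x ∈ P) :
    x ∈ A ∧ x ∉ B := by
  rw [← h] at hx; simpa using hx

/-- The configuration of the circles in the four states that differ only at two crossings `v`
and `w`: `A` are the circles before both changes, `B` and `B'` those after the change at `v`,
respectively `w`, and `D` those after both changes. A circle that meets neither crossing lies in all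
four sets, one that meets only `v` or only `w` in two of them, and one that meets both in
exactly one. -/
structure Square (κ : Γ → CircleColor C) (p : Prop) (A B B' D : Finset Γ) : Prop where
  AB : Transition κ p A B
  AB' : Transition κ p A B'
  BD : Transition κ p B D
  B'D : Transition κ p B' D
  mem_of_mem : ∀ x, x ∈ A ∧ x ∈ D ↔ x ∈ B ∧ x ∈ B'
  near_B : (A \ (B ∪ B')).Nonempty ↔ (B \ (A ∪ D)).Nonempty
  near_B' : (A \ (B ∪ B')).Nonempty ↔ (B' \ (A ∪ D)).Nonempty
  near_D : (A \ (B ∪ B')).Nonempty ↔ (D \ (B ∪ B')).Nonempty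

theorem Square.swap {p : Prop} {A B B' D : Finset Γ} (h : Square κ p A B B' D) :
    Square κ p A B' B D where
  AB := h.AB'
  AB' := h.AB
  BD := h.B'D
  B'D := h.BD
  mem_of_mem x := (h.mem_of_mem x).trans and_comm
  near_B := by rw [Finset.union_comm]; exact h.near_B'
  near_B' := by rw [Finset.union_comm]; exact h.near_B
  near_D := by rw [Finset.union_comm]; exact h.near_D

variable {p : Prop} {A B B' D : Finset Γ} {f h : Γ → ℤˣ}

/-- If no circle meets both crossings, then the two changes do not interact. -/
theorem Square.card_between_of_far (S : Square κ p A B B' D)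
    (hfh : ∀ x ∈ A, x ∈ D → f x = h x) (hfar : ¬ (A \ (B ∪ B')).Nonempty) :
    Nat.card (Between κ A B D f h) = Nat.card (Between κ A B' D f h) := by
  have hA := Finset.not_nonempty_iff_eq_empty.1 hfar
  have hB := Finset.not_nonempty_iff_eq_empty.1 (S.near_B.not.1 hfar)
  have hB' := Finset.not_nonempty_iff_eq_empty.1 (S.near_B'.not.1 hfar)
  have hD := Finset.not_nonempty_iff_eq_empty.1 (S.near_D.not.1 hfar)
  rw [Finset.sdiff_eq_empty_iff_subset] at hA hB hB' hD
  have m := S.mem_of_mem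
  have e1 : A \ B = B' \ D := by
    ext x; have := m x; have := @hA x; have := @hB' x
    simp only [Finset.mem_sdiff, Finset.mem_union] at *; tauto
  have e2 : B \ A = D \ B' := by
    ext x; have := m x; have := @hB x; have := @hD x
    simp only [Finset.mem_sdiff, Finset.mem_union] at *; tauto
  have e3 : A \ B' = B \ D := by
    ext x; have := m x; have := @hA x; have := @hB x
    simp only [Finset.mem_sdiff, Finset.mem_union] at *; tauto
  have e4 : B' \ A = D \ B := by
    ext x; have := m x; have := @hB' x; have := @hD x
    simp only [Finset.mem_sdiff, Finset.mem_union] at *; tauto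
  have key : ∀ {P Q : Finset Γ} {g₁ g₁' g₂ g₂' : Γ → ℤˣ}, (∀ x ∈ P, g₁ x = g₁' x) →
      (∀ x ∈ Q, g₂ x = g₂' x) → (Balanced κ P Q g₁ g₂ ↔ Balanced κ P Q g₁' g₂') := by
    intro P Q g₁ g₁' g₂ g₂' h1 h2
    unfold Balanced; rw [weight_congr h1, weight_congr h2]
  rw [card_between_of_subset hfh hB (Balanced κ (A \ B) (B \ A) f h)
      (Balanced κ (A \ B') (B' \ A) f h), card_between_of_subset hfh hB'
      (Balanced κ (A \ B') (B' \ A) f h) (Balanced κ (A \ B) (B \ A) f h)]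
  · classical exact if_congr and_comm rfl rfl
  · exact fun g h1 h2 => key (fun _ _ => rfl) fun x hx => by
      rw [e4] at hx; simp only [Finset.mem_sdiff] at hx
      exact h2 x (by rw [← Finset.mem_sdiff, ← e4] at hx; exact (Finset.mem_sdiff.1 hx).1) hx.1
  · intro g h1 h2
    rw [← e1, ← e2]
    refine key (fun x hx => ?_) fun _ _ => rfl
    have hx' := hx; rw [e1] at hx'
    exact (h1 x (Finset.mem_sdiff.1 hx).1 (Finset.mem_sdiff.1 hx').1).symm
  · intro g h1 h2
    refine key (fun _ _ => rfl) fun x hx => ?_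
    have hx' := hx; rw [e2] at hx'
    exact h2 x (Finset.mem_sdiff.1 hx).1 (Finset.mem_sdiff.1 hx').1
  · intro g h1 h2
    rw [← e3, ← e4]
    refine key (fun x hx => ?_) fun _ _ => rfl
    have hx' := hx; rw [e3] at hx'
    exact (h1 x (Finset.mem_sdiff.1 hx).1 (Finset.mem_sdiff.1 hx').1).symm

/-- Two circles merge at either crossing and a single circle results. -/
theorem Square.card_between_of_pair_left (S : Square κ p A B B' D)
    (hfh : ∀ x ∈ A, x ∈ D → f x = h x) {a₁ a₂ b b' : Γ} (hne : a₁ ≠ a₂)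
    (h1 : A \ B = {a₁, a₂}) (h2 : B \ A = {b}) (h3 : A \ B' = {a₁, a₂}) (h4 : B' \ A = {b'})
    (h5 : B \ D = {b}) (h6 : B' \ D = {b'}) (h7 : D \ B = D \ B')
    (hB : B \ (A ∪ D) = {b}) (hB' : B' \ (A ∪ D) = {b'}) :
    Nat.card (Between κ A B D f h) = Nat.card (Between κ A B' D f h) := by
  have T1 := S.AB.triple_of_merge hne h1 h2
  have T2 := S.AB'.triple_of_merge hne h3 h4
  have hc := S.BD.card_le
  rw [h5] at hc
  simp only [Finset.card_singleton] at hc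
  rcases (by omega : (D \ B).card = 1 ∨ (D \ B).card = 2) with hc | hc
  · obtain ⟨d, hd⟩ := Finset.card_eq_one.1 hc
    rw [card_between_of_singleton hfh hB
      (fun s => MergeRule (κ a₁) (f a₁) (κ a₂) (f a₂) (κ b) s) (fun s => FlipRule (κ b) s (κ d)
        (h d)),
      card_between_of_singleton hfh hB'
      (fun s => MergeRule (κ a₁) (f a₁) (κ a₂) (f a₂) (κ b') s)
      (fun s => FlipRule (κ b') s (κ d) (h d))]
    · exact card_mergeBoth_flip _ _ _ T1 T2
    · intro g _ _; rw [h3, h4, balanced_merge_iff hne]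
    · intro g _ _; rw [h6, ← h7, hd, balanced_flip_iff]
    · intro g _ _; rw [h1, h2, balanced_merge_iff hne]
    · intro g _ _; rw [h5, hd, balanced_flip_iff]
  · obtain ⟨d₁, d₂, hd12, hd⟩ := Finset.card_eq_two.1 hc
    have T3 := S.BD.triple_of_split hd12 h5 hd
    have T4 := S.B'D.triple_of_split hd12 h6 (h7 ▸ hd)
    rw [card_between_of_singleton hfh hB
      (fun s => MergeRule (κ a₁) (f a₁) (κ a₂) (f a₂) (κ b) s)
      (fun s => SplitRule (κ b) s (κ d₁) (h d₁) (κ d₂) (h d₂)),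
      card_between_of_singleton hfh hB'
      (fun s => MergeRule (κ a₁) (f a₁) (κ a₂) (f a₂) (κ b') s)
      (fun s => SplitRule (κ b') s (κ d₁) (h d₁) (κ d₂) (h d₂))]
    · exact card_mergeBoth_splitBoth _ _ _ _ T1 T3 T2 T4
    · intro g _ _; rw [h3, h4, balanced_merge_iff hne]
    · intro g _ _; rw [h6, ← h7, hd, balanced_split_iff hd12]
    · intro g _ _; rw [h1, h2, balanced_merge_iff hne]
    · intro g _ _; rw [h5, hd, balanced_split_iff hd12]

/-- One circle results in one circle after either change, and both of these split into the same two
circles. -/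
theorem Square.card_between_of_pair_right (S : Square κ p A B B' D)
    (hfh : ∀ x ∈ A, x ∈ D → f x = h x) {d₁ d₂ b b' : Γ} (hne : d₁ ≠ d₂)
    (h1 : D \ B = {d₁, d₂}) (h2 : B \ D = {b}) (h3 : D \ B' = {d₁, d₂}) (h4 : B' \ D = {b'})
    (h5 : B \ A = {b}) (h6 : B' \ A = {b'}) (h7 : A \ B = A \ B')
    (hB : B \ (A ∪ D) = {b}) (hB' : B' \ (A ∪ D) = {b'}) :
    Nat.card (Between κ A B D f h) = Nat.card (Between κ A B' D f h) := by
  have T1 := S.BD.triple_of_split hne h2 h1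
  have T2 := S.B'D.triple_of_split hne h4 h3
  have hc := S.AB.card_le
  rw [h5] at hc
  simp only [Finset.card_singleton] at hc
  rcases (by omega : (A \ B).card = 1 ∨ (A \ B).card = 2) with hc | hc
  · obtain ⟨a, ha⟩ := Finset.card_eq_one.1 hc
    rw [card_between_of_singleton hfh hB
      (fun s => FlipRule (κ a) (f a) (κ b) s)
      (fun s => SplitRule (κ b) s (κ d₁) (h d₁) (κ d₂) (h d₂)),
      card_between_of_singleton hfh hB'
      (fun s => FlipRule (κ a) (f a) (κ b') s)
      (fun s => SplitRule (κ b') s (κ d₁) (h d₁) (κ d₂) (h d₂))]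
    · exact card_flip_splitBoth _ _ _ T1 T2
    · intro g _ _; rw [← h7, ha, h6, balanced_flip_iff]
    · intro g _ _; rw [h4, h3, balanced_split_iff hne]
    · intro g _ _; rw [ha, h5, balanced_flip_iff]
    · intro g _ _; rw [h2, h1, balanced_split_iff hne]
  · obtain ⟨a₁, a₂, ha12, ha⟩ := Finset.card_eq_two.1 hc
    have T3 := S.AB.triple_of_merge ha12 ha h5
    have T4 := S.AB'.triple_of_merge ha12 (h7 ▸ ha) h6
    rw [card_between_of_singleton hfh hB
      (fun s => MergeRule (κ a₁) (f a₁) (κ a₂) (f a₂) (κ b) s)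
      (fun s => SplitRule (κ b) s (κ d₁) (h d₁) (κ d₂) (h d₂)),
      card_between_of_singleton hfh hB'
      (fun s => MergeRule (κ a₁) (f a₁) (κ a₂) (f a₂) (κ b') s)
      (fun s => SplitRule (κ b') s (κ d₁) (h d₁) (κ d₂) (h d₂))]
    · exact card_mergeBoth_splitBoth _ _ _ _ T3 T1 T4 T2
    · intro g _ _; rw [← h7, ha, h6, balanced_merge_iff ha12]
    · intro g _ _; rw [h4, h3, balanced_split_iff hne]
    · intro g _ _; rw [ha, h5, balanced_merge_iff ha12]
    · intro g _ _; rw [h2, h1, balanced_split_iff hne]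

open Classical in
/-- A circle splits and the two parts merge again. -/
theorem Square.card_between_of_pair_middle (S : Square κ p A B B' D)
    (hfh : ∀ x ∈ A, x ∈ D → f x = h x) {a b₁ b₂ d : Γ} (hne : b₁ ≠ b₂)
    (h1 : A \ B = {a}) (h2 : B \ A = {b₁, b₂}) (h3 : B \ D = {b₁, b₂}) (h4 : D \ B = {d})
    (hB : B \ (A ∪ D) = {b₁, b₂}) :
    Nat.card (Between κ A B D f h) =
      if κ a = disk ∧ f a = -1 ∧ κ d = disk ∧ h d = 1 then 2 else 0 := by
  rw [card_between_of_pair hfh hne hB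
    (fun s t => SplitRule (κ a) (f a) (κ b₁) s (κ b₂) t)
    (fun s t => MergeRule (κ b₁) s (κ b₂) t (κ d) (h d))]
  · exact card_split_merge _ _ (S.AB.triple_of_split hne h1 h2)
      (S.BD.triple_of_merge hne h3 h4)
  · intro g; rw [h1, h2, balanced_split_iff hne]
  · intro g; rw [h3, h4, balanced_merge_iff hne]

open Classical in
/-- A circle is changed into a single circle, twice. -/
theorem Square.card_between_of_flip_flip
    (hfh : ∀ x ∈ A, x ∈ D → f x = h x) {a b d : Γ}
    (h1 : A \ B = {a}) (h2 : B \ A = {b}) (h3 : B \ D = {b}) (h4 : D \ B = {d})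
    (hB : B \ (A ∪ D) = {b}) :
    Nat.card (Between κ A B D f h) =
      if (κ a = disk ∧ f a = -1 ∧ κ d = disk ∧ h d = 1) ∧ κ b = mobius then 2 else 0 := by
  rw [card_between_of_singleton hfh hB
      (fun s => FlipRule (κ a) (f a) (κ b) s) (fun s => FlipRule (κ b) s (κ d) (h d))]
  · exact card_flip_flip _ _
  · intro g _ _; rw [h1, h2, balanced_flip_iff]
  · intro g _ _; rw [h3, h4, balanced_flip_iff]

/-- The sets of circles when each state has exactly one circle that meets both crossings. The
sets `P`, `Q` consist of the circles that meet only the first crossing, and `R`, `U` of those that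
meet only the second one. -/
theorem Square.card_between_of_single (S : Square κ p A B B' D)
    (hfh : ∀ x ∈ A, x ∈ D → f x = h x) {a b b' d : Γ} {P Q R U : Finset Γ}
    (haP : a ∉ P) (haR : a ∉ R) (hbQ : b ∉ Q) (hbR : b ∉ R) (hbU : b' ∉ U) (hbP : b' ∉ P)
    (hdU : d ∉ U) (hdQ : d ∉ Q)
    (h1 : A \ B = insert a P) (h2 : B \ A = insert b Q) (h3 : B \ D = insert b R)
    (h4 : D \ B = insert d U) (h1' : A \ B' = insert a R) (h2' : B' \ A = insert b' U)
    (h3' : B' \ D = insert b' P) (h4' : D \ B' = insert d Q)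
    (hB : B \ (A ∪ D) = {b}) (hB' : B' \ (A ∪ D) = {b'}) :
    Nat.card (Between κ A B D f h) = Nat.card (Between κ A B' D f h) ∨
      (p ∧ Even (Nat.card (Between κ A B D f h)) ∧ Even (Nat.card (Between κ A B' D f h))) := by
  have c1 : (P = ∅ ∧ Q = ∅) ∨ (∃ u, P = {u} ∧ Q = ∅) ∨ (∃ u, P = ∅ ∧ Q = {u}) := by
    have := S.AB.card_le
    rw [h1, h2, Finset.card_insert_of_notMem haP, Finset.card_insert_of_notMem hbQ] at this
    rcases this with ⟨e1, e2⟩ | ⟨e1, e2⟩ | ⟨e1, e2⟩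
    · obtain ⟨u, hu⟩ := Finset.card_eq_one.1 (Nat.succ.inj e1)
      exact Or.inr (Or.inl ⟨u, hu, Finset.card_eq_zero.1 (Nat.succ.inj e2)⟩)
    · obtain ⟨u, hu⟩ := Finset.card_eq_one.1 (Nat.succ.inj e2)
      exact Or.inr (Or.inr ⟨u, Finset.card_eq_zero.1 (Nat.succ.inj e1), hu⟩)
    · exact Or.inl ⟨Finset.card_eq_zero.1 (Nat.succ.inj e1),
        Finset.card_eq_zero.1 (Nat.succ.inj e2)⟩
  have c2 : (R = ∅ ∧ U = ∅) ∨ (∃ u, R = {u} ∧ U = ∅) ∨ (∃ u, R = ∅ ∧ U = {u}) := by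
    have := S.AB'.card_le
    rw [h1', h2', Finset.card_insert_of_notMem haR, Finset.card_insert_of_notMem hbU] at this
    rcases this with ⟨e1, e2⟩ | ⟨e1, e2⟩ | ⟨e1, e2⟩
    · obtain ⟨u, hu⟩ := Finset.card_eq_one.1 (Nat.succ.inj e1)
      exact Or.inr (Or.inl ⟨u, hu, Finset.card_eq_zero.1 (Nat.succ.inj e2)⟩)
    · obtain ⟨u, hu⟩ := Finset.card_eq_one.1 (Nat.succ.inj e2)
      exact Or.inr (Or.inr ⟨u, Finset.card_eq_zero.1 (Nat.succ.inj e1), hu⟩)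
    · exact Or.inl ⟨Finset.card_eq_zero.1 (Nat.succ.inj e1),
        Finset.card_eq_zero.1 (Nat.succ.inj e2)⟩
  have Bfl : ∀ {X Y : Finset Γ} {x y : Γ} {f g : Γ → ℤˣ}, X = {x} → Y = {y} →
      (Balanced κ X Y f g ↔ FlipRule (κ x) (f x) (κ y) (g y)) := by
    rintro X Y x y f g rfl rfl; exact balanced_flip_iff f g
  have Bme : ∀ {X Y : Finset Γ} {x u y : Γ} {f g : Γ → ℤˣ}, x ≠ u → X = {x, u} → Y = {y} →
      (Balanced κ X Y f g ↔ MergeRule (κ x) (f x) (κ u) (f u) (κ y) (g y)) := by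
    rintro X Y x u y f g hne rfl rfl; exact balanced_merge_iff hne f g
  have Bsp : ∀ {X Y : Finset Γ} {x y u : Γ} {f g : Γ → ℤˣ}, y ≠ u → X = {x} → Y = {y, u} →
      (Balanced κ X Y f g ↔ SplitRule (κ x) (f x) (κ y) (g y) (κ u) (g u)) := by
    rintro X Y x y u f g hne rfl rfl; exact balanced_split_iff hne f g
  -- At either crossing, the circle that meets both is changed alone, merges with a circle `u`
  -- or `w` that meets only that crossing, or splits one off: nine cases. Only in the first one the
  -- numbers can differ, namely if a trivial circle turns into a trivial one.
  rcases c1 with ⟨rfl, rfl⟩ | ⟨u, rfl, rfl⟩ | ⟨u, rfl, rfl⟩ <;>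
  rcases c2 with ⟨rfl, rfl⟩ | ⟨w, rfl, rfl⟩ | ⟨w, rfl, rfl⟩ <;>
  simp only [insert_empty_eq, Finset.mem_singleton] at *
  · have hc := S.AB.color_of_flip h1 h2
    have hc' := S.AB'.color_of_flip h1' h2'
    rw [card_between_of_flip_flip hfh h1 h2 h3 h4 hB,
      card_between_of_flip_flip hfh h1' h2' h3' h4' hB']
    by_cases hp : p
    · exact Or.inr ⟨hp, by split_ifs <;> decide, by split_ifs <;> decide⟩
    · refine Or.inl ?_
      simp only [hp, and_false, or_false] at hc hc'
      classical exact if_congr (and_congr_right fun e => ⟨fun _ => hc' e.1,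
        fun _ => hc e.1⟩) rfl rfl
  · obtain ⟨wA, wB'⟩ := mem_of_sdiff_eq h1' (x := w) (by simp)
    obtain ⟨wB, wD⟩ := mem_of_sdiff_eq h3 (x := w) (by simp)
    refine Or.inl ?_
    rw [card_between_of_singleton hfh hB (fun s => FlipRule (κ a) (f a) (κ b) s)
        (fun s => MergeRule (κ b) s (κ w) (f w) (κ d) (h d)),
      card_between_of_singleton hfh hB' (fun s => MergeRule (κ a) (f a) (κ w) (f w) (κ b') s)
        (fun s => FlipRule (κ b') s (κ d) (h d))]
    · exact (card_merge_flip _ _ _ (S.AB'.triple_of_merge haR h1' h2')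
        (S.BD.triple_of_merge hbR h3 h4)).symm
    · intro g hg hh; rw [(Bme haR h1' h2')]
    · intro g hg hh; rw [(Bfl h3' h4')]
    · intro g hg hh; rw [(Bfl h1 h2)]
    · intro g hg hh; rw [(Bme hbR h3 h4), ← hg w wA wB]
  · obtain ⟨wB', wA⟩ := mem_of_sdiff_eq h2' (x := w) (by simp)
    obtain ⟨wD, wB⟩ := mem_of_sdiff_eq h4 (x := w) (by simp)
    refine Or.inl ?_
    rw [card_between_of_singleton hfh hB (fun s => FlipRule (κ a) (f a) (κ b) s)
        (fun s => SplitRule (κ b) s (κ d) (h d) (κ w) (h w)),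
      card_between_of_singleton hfh hB' (fun s => SplitRule (κ a) (f a) (κ b') s (κ w) (h w))
        (fun s => FlipRule (κ b') s (κ d) (h d))]
    · exact (card_split_flip _ _ _ (S.AB'.triple_of_split hbU h1' h2')
        (S.BD.triple_of_split hdU h3 h4)).symm
    · intro g hg hh; rw [(Bsp hbU h1' h2'), hh w wB' wD]
    · intro g hg hh; rw [(Bfl h3' h4')]
    · intro g hg hh; rw [(Bfl h1 h2)]
    · intro g hg hh; rw [(Bsp hdU h3 h4)]
  · obtain ⟨uA, uB⟩ := mem_of_sdiff_eq h1 (x := u) (by simp)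
    obtain ⟨uB', uD⟩ := mem_of_sdiff_eq h3' (x := u) (by simp)
    refine Or.inl ?_
    rw [card_between_of_singleton hfh hB (fun s => MergeRule (κ a) (f a) (κ u) (f u) (κ b) s)
        (fun s => FlipRule (κ b) s (κ d) (h d)),
      card_between_of_singleton hfh hB' (fun s => FlipRule (κ a) (f a) (κ b') s)
        (fun s => MergeRule (κ b') s (κ u) (f u) (κ d) (h d))]
    · exact card_merge_flip _ _ _ (S.AB.triple_of_merge haP h1 h2)
        (S.B'D.triple_of_merge hbP h3' h4')
    · intro g hg hh; rw [(Bfl h1' h2')]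
    · intro g hg hh; rw [(Bme hbP h3' h4'), ← hg u uA uB']
    · intro g hg hh; rw [(Bme haP h1 h2)]
    · intro g hg hh; rw [(Bfl h3 h4)]
  · obtain ⟨uA, uB⟩ := mem_of_sdiff_eq h1 (x := u) (by simp)
    obtain ⟨uB', uD⟩ := mem_of_sdiff_eq h3' (x := u) (by simp)
    obtain ⟨wA, wB'⟩ := mem_of_sdiff_eq h1' (x := w) (by simp)
    obtain ⟨wB, wD⟩ := mem_of_sdiff_eq h3 (x := w) (by simp)
    refine Or.inl ?_
    rw [card_between_of_singleton hfh hB (fun s => MergeRule (κ a) (f a) (κ u) (f u) (κ b) s)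
        (fun s => MergeRule (κ b) s (κ w) (f w) (κ d) (h d)),
      card_between_of_singleton hfh hB' (fun s => MergeRule (κ a) (f a) (κ w) (f w) (κ b') s)
        (fun s => MergeRule (κ b') s (κ u) (f u) (κ d) (h d))]
    · exact card_merge_merge _ _ _ _ (S.AB.triple_of_merge haP h1 h2)
        (S.BD.triple_of_merge hbR h3 h4) (S.AB'.triple_of_merge haR h1' h2')
        (S.B'D.triple_of_merge hbP h3' h4')
    · intro g hg hh; rw [(Bme haR h1' h2')]
    · intro g hg hh; rw [(Bme hbP h3' h4'), ← hg u uA uB']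
    · intro g hg hh; rw [(Bme haP h1 h2)]
    · intro g hg hh; rw [(Bme hbR h3 h4), ← hg w wA wB]
  · obtain ⟨uA, uB⟩ := mem_of_sdiff_eq h1 (x := u) (by simp)
    obtain ⟨uB', uD⟩ := mem_of_sdiff_eq h3' (x := u) (by simp)
    obtain ⟨wB', wA⟩ := mem_of_sdiff_eq h2' (x := w) (by simp)
    obtain ⟨wD, wB⟩ := mem_of_sdiff_eq h4 (x := w) (by simp)
    refine Or.inl ?_
    rw [card_between_of_singleton hfh hB (fun s => MergeRule (κ a) (f a) (κ u) (f u) (κ b) s)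
        (fun s => SplitRule (κ b) s (κ d) (h d) (κ w) (h w)),
      card_between_of_singleton hfh hB' (fun s => SplitRule (κ a) (f a) (κ b') s (κ w) (h w))
        (fun s => MergeRule (κ b') s (κ u) (f u) (κ d) (h d))]
    · exact card_merge_split _ _ _ _ (S.AB.triple_of_merge haP h1 h2)
        (S.BD.triple_of_split hdU h3 h4) (S.AB'.triple_of_split hbU h1' h2')
        (S.B'D.triple_of_merge hbP h3' h4')
    · intro g hg hh; rw [(Bsp hbU h1' h2'), hh w wB' wD]
    · intro g hg hh; rw [(Bme hbP h3' h4'), ← hg u uA uB']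
    · intro g hg hh; rw [(Bme haP h1 h2)]
    · intro g hg hh; rw [(Bsp hdU h3 h4)]
  · obtain ⟨uB, uA⟩ := mem_of_sdiff_eq h2 (x := u) (by simp)
    obtain ⟨uD, uB'⟩ := mem_of_sdiff_eq h4' (x := u) (by simp)
    refine Or.inl ?_
    rw [card_between_of_singleton hfh hB (fun s => SplitRule (κ a) (f a) (κ b) s (κ u) (h u))
        (fun s => FlipRule (κ b) s (κ d) (h d)),
      card_between_of_singleton hfh hB' (fun s => FlipRule (κ a) (f a) (κ b') s)
        (fun s => SplitRule (κ b') s (κ d) (h d) (κ u) (h u))]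
    · exact card_split_flip _ _ _ (S.AB.triple_of_split hbQ h1 h2)
        (S.B'D.triple_of_split hdQ h3' h4')
    · intro g hg hh; rw [(Bfl h1' h2')]
    · intro g hg hh; rw [(Bsp hdQ h3' h4')]
    · intro g hg hh; rw [(Bsp hbQ h1 h2), hh u uB uD]
    · intro g hg hh; rw [(Bfl h3 h4)]
  · obtain ⟨uB, uA⟩ := mem_of_sdiff_eq h2 (x := u) (by simp)
    obtain ⟨uD, uB'⟩ := mem_of_sdiff_eq h4' (x := u) (by simp)
    obtain ⟨wA, wB'⟩ := mem_of_sdiff_eq h1' (x := w) (by simp)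
    obtain ⟨wB, wD⟩ := mem_of_sdiff_eq h3 (x := w) (by simp)
    refine Or.inl ?_
    rw [card_between_of_singleton hfh hB (fun s => SplitRule (κ a) (f a) (κ b) s (κ u) (h u))
        (fun s => MergeRule (κ b) s (κ w) (f w) (κ d) (h d)),
      card_between_of_singleton hfh hB' (fun s => MergeRule (κ a) (f a) (κ w) (f w) (κ b') s)
        (fun s => SplitRule (κ b') s (κ d) (h d) (κ u) (h u))]
    · exact (card_merge_split _ _ _ _ (S.AB'.triple_of_merge haR h1' h2')
        (S.B'D.triple_of_split hdQ h3' h4') (S.AB.triple_of_split hbQ h1 h2)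
        (S.BD.triple_of_merge hbR h3 h4)).symm
    · intro g hg hh; rw [(Bme haR h1' h2')]
    · intro g hg hh; rw [(Bsp hdQ h3' h4')]
    · intro g hg hh; rw [(Bsp hbQ h1 h2), hh u uB uD]
    · intro g hg hh; rw [(Bme hbR h3 h4), ← hg w wA wB]
  · obtain ⟨uB, uA⟩ := mem_of_sdiff_eq h2 (x := u) (by simp)
    obtain ⟨uD, uB'⟩ := mem_of_sdiff_eq h4' (x := u) (by simp)
    obtain ⟨wB', wA⟩ := mem_of_sdiff_eq h2' (x := w) (by simp)
    obtain ⟨wD, wB⟩ := mem_of_sdiff_eq h4 (x := w) (by simp)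
    refine Or.inl ?_
    rw [card_between_of_singleton hfh hB (fun s => SplitRule (κ a) (f a) (κ b) s (κ u) (h u))
        (fun s => SplitRule (κ b) s (κ d) (h d) (κ w) (h w)),
      card_between_of_singleton hfh hB' (fun s => SplitRule (κ a) (f a) (κ b') s (κ w) (h w))
        (fun s => SplitRule (κ b') s (κ d) (h d) (κ u) (h u))]
    · exact card_split_split _ _ _ _ (S.AB.triple_of_split hbQ h1 h2)
        (S.BD.triple_of_split hdU h3 h4) (S.AB'.triple_of_split hbU h1' h2')
        (S.B'D.triple_of_split hdQ h3' h4')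
    · intro g hg hh; rw [(Bsp hbU h1' h2'), hh w wB' wD]
    · intro g hg hh; rw [(Bsp hdQ h3' h4')]
    · intro g hg hh; rw [(Bsp hbQ h1 h2), hh u uB uD]
    · intro g hg hh; rw [(Bsp hdU h3 h4)]

theorem eq_pair_of_card_le {X : Finset Γ} {x y : Γ} (hx : x ∈ X) (hy : y ∈ X) (hne : x ≠ y)
    (hc : X.card ≤ 2) : X = {x, y} :=
  (Finset.eq_of_subset_of_card_le (by simp [Finset.insert_subset_iff, hx, hy])
    (by rwa [Finset.card_pair hne])).symm

/-- One of the two ways around the square splits a circle and merges its parts again. -/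
theorem Square.card_between_of_split_merge (S : Square κ p A B B' D)
    (hfh : ∀ x ∈ A, x ∈ D → f x = h x) {a b b₂ b' d : Γ}
    (ha : a ∈ A ∧ a ∉ B ∧ a ∉ B') (hb : b ∈ B ∧ b ∉ A ∧ b ∉ D) (hb' : b' ∈ B' ∧ b' ∉ A ∧ b' ∉ D)
    (hd : d ∈ D ∧ d ∉ B ∧ d ∉ B') (hb₂ : b₂ ∈ B ∧ b₂ ∉ A ∧ b₂ ∉ D) (hne : b ≠ b₂) :
    Nat.card (Between κ A B D f h) = Nat.card (Between κ A B' D f h) ∨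
      (p ∧ Even (Nat.card (Between κ A B D f h)) ∧ Even (Nat.card (Between κ A B' D f h))) := by
  have m := S.mem_of_mem
  have c1 := S.AB.card_le
  have c2 := S.AB'.card_le
  have c3 := S.BD.card_le
  have c1' : (B \ A).card ≤ 2 := by omega
  have c3' : (B \ D).card ≤ 2 := by omega
  have h2 : B \ A = {b, b₂} :=
    eq_pair_of_card_le (Finset.mem_sdiff.2 ⟨hb.1, hb.2.1⟩)
      (Finset.mem_sdiff.2 ⟨hb₂.1, hb₂.2.1⟩) hne c1'
  have h3 : B \ D = {b, b₂} :=
    eq_pair_of_card_le (Finset.mem_sdiff.2 ⟨hb.1, hb.2.2⟩)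
      (Finset.mem_sdiff.2 ⟨hb₂.1, hb₂.2.2⟩) hne c3'
  rw [h2, Finset.card_pair hne] at c1
  rw [h3, Finset.card_pair hne] at c3
  have h1 : A \ B = {a} := eq_singleton_of_card_le (by simp [ha]) (by omega)
  have h4 : D \ B = {d} := eq_singleton_of_card_le (by simp [hd]) (by omega)
  clear c1 c3
  have e1 := Finset.ext_iff.1 h1
  have e2 := Finset.ext_iff.1 h2
  have e3 := Finset.ext_iff.1 h3
  have e4 := Finset.ext_iff.1 h4
  simp only [Finset.mem_sdiff, Finset.mem_insert, Finset.mem_singleton] at e1 e2 e3 e4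
  have hB : B \ (A ∪ D) = {b, b₂} := by
    ext x
    simp only [Finset.mem_sdiff, Finset.mem_insert, Finset.mem_singleton, Finset.mem_union]
    have e2 := e2 x; have e3 := e3 x
    clear * - e2 e3 hb hb₂; grind
  -- Both circles of `B` meet both crossings, so `a` and `d` are the only circles affected on the
  -- other way through `B'`, too.
  have h1' : A \ B' = {a} := by
    ext x
    simp only [Finset.mem_sdiff, Finset.mem_singleton]
    have m := m x; have e1 := e1 x; have e2 := e2 x; have e3 := e3 x
    clear * - m e1 e2 e3 ha hb hb₂; grind
  have h4' : D \ B' = {d} := by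
    ext x
    simp only [Finset.mem_sdiff, Finset.mem_singleton]
    have m := m x; have e4 := e4 x; have e2 := e2 x; have e3 := e3 x
    clear * - m e4 e2 e3 hd hb hb₂; grind
  have h23 : B' \ A = B' \ D := by
    ext x
    simp only [Finset.mem_sdiff]
    have m := m x; have e1 := e1 x; have e4 := e4 x
    clear * - m e1 e4 ha hd; grind
  have hB' : B' \ (A ∪ D) = B' \ A := by
    rw [Finset.sdiff_union_distrib, ← h23, Finset.inter_self]
  rw [h1', Finset.card_singleton] at c2
  rw [S.card_between_of_pair_middle hfh hne h1 h2 h3 h4 hB]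
  rcases (by omega : (B' \ A).card = 1 ∨ (B' \ A).card = 2) with hc | hc
  · have h2' := eq_singleton_of_card_le (x := b') (by simp [hb']) hc.le
    rw [card_between_of_flip_flip hfh h1' h2' (h23 ▸ h2') h4' (hB' ▸ h2')]
    by_cases hp : p
    · exact Or.inr ⟨hp, by split_ifs <;> decide, by split_ifs <;> decide⟩
    · refine Or.inl ?_
      have hc' := S.AB'.color_of_flip h1' h2'
      simp only [hp, and_false, or_false] at hc'
      classical exact if_congr ⟨fun e => ⟨e, hc' e.1⟩, fun e => e.1⟩ rfl rfl
  · obtain ⟨x, y, hxy, hX⟩ := Finset.card_eq_two.1 hc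
    rw [S.swap.card_between_of_pair_middle hfh hxy h1' hX (h23 ▸ hX) h4' (hB' ▸ hX)]
    exact Or.inl rfl

/-- The two ways around a square of states have equally many intermediate states, except on a
projective plane, where both numbers are even if they differ. -/
theorem Square.card_between (S : Square κ p A B B' D) (f h : Γ → ℤˣ) :
    Nat.card (Between κ A B D f h) = Nat.card (Between κ A B' D f h) ∨
      (p ∧ Even (Nat.card (Between κ A B D f h)) ∧ Even (Nat.card (Between κ A B' D f h))) := by
  have m := S.mem_of_mem
  by_cases hfh : ∀ x ∈ A, x ∈ D → f x = h x
  swap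
  · left
    rw [card_between_eq_zero (fun x hx => ((m x).1 (Finset.mem_inter.1 hx)).1) hfh,
      card_between_eq_zero (fun x hx => ((m x).1 (Finset.mem_inter.1 hx)).2) hfh]
  by_cases hnear : (A \ (B ∪ B')).Nonempty
  swap
  · exact Or.inl (S.card_between_of_far hfh hnear)
  obtain ⟨a, ha⟩ := hnear
  obtain ⟨b, hb⟩ := S.near_B.1 ⟨a, ha⟩
  obtain ⟨b', hb'⟩ := S.near_B'.1 ⟨a, ha⟩
  obtain ⟨d, hd⟩ := S.near_D.1 ⟨a, ha⟩
  have c1 := S.AB.card_le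
  have c2 := S.AB'.card_le
  have c3 := S.BD.card_le
  have c4 := S.B'D.card_le
  simp only [Finset.mem_sdiff, Finset.mem_union, not_or] at ha hb hb' hd
  have haB : a ∈ A \ B := by simp [ha]
  have haB' : a ∈ A \ B' := by simp [ha]
  have hbA : b ∈ B \ A := by simp [hb]
  have hbD : b ∈ B \ D := by simp [hb]
  have hbA' : b' ∈ B' \ A := by simp [hb']
  have hbD' : b' ∈ B' \ D := by simp [hb']
  have hdB : d ∈ D \ B := by simp [hd]
  have hdB' : d ∈ D \ B' := by simp [hd]
  have pA := Finset.card_pos.2 ⟨a, haB⟩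
  have pA' := Finset.card_pos.2 ⟨a, haB'⟩
  have pD := Finset.card_pos.2 ⟨d, hdB⟩
  have pD' := Finset.card_pos.2 ⟨d, hdB'⟩
  -- At most two circles of a state are affected by a change. The case distinction is on the states
  -- with two circles that meet both crossings: `A`, then `D`, then `B` or `B'`, then none.
  by_cases hA : ∃ a₂, a₂ ∈ A \ (B ∪ B') ∧ a ≠ a₂
  · obtain ⟨a₂, ha₂, hne⟩ := hA
    simp only [Finset.mem_sdiff, Finset.mem_union, not_or] at ha₂
    have h1 := eq_pair_of_card_le haB (y := a₂) (by simp [ha₂]) hne (by omega)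
    have h3 := eq_pair_of_card_le haB' (y := a₂) (by simp [ha₂]) hne (by omega)
    rw [h1, Finset.card_pair hne] at c1
    rw [h3, Finset.card_pair hne] at c2
    have h2 := eq_singleton_of_card_le hbA (by omega)
    have h4 := eq_singleton_of_card_le hbA' (by omega)
    simp only [Finset.ext_iff, Finset.mem_sdiff, Finset.mem_insert,
      Finset.mem_singleton] at h1 h2 h3 h4
    left
    refine S.card_between_of_pair_left hfh hne (b := b) (b' := b') ?_ ?_ ?_ ?_ ?_ ?_ ?_ ?_ ?_ <;>
    · ext x
      simp only [Finset.mem_sdiff, Finset.mem_insert, Finset.mem_singleton, Finset.mem_union]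
      have m := m x; have h1 := h1 x; have h2 := h2 x; have h3 := h3 x; have h4 := h4 x
      clear * - m h1 h2 h3 h4 ha hb hb' hd; grind
  by_cases hD : ∃ d₂, d₂ ∈ D \ (B ∪ B') ∧ d ≠ d₂
  · obtain ⟨d₂, hd₂, hne⟩ := hD
    simp only [Finset.mem_sdiff, Finset.mem_union, not_or] at hd₂
    have h1 := eq_pair_of_card_le hdB (y := d₂) (by simp [hd₂]) hne (by omega)
    have h3 := eq_pair_of_card_le hdB' (y := d₂) (by simp [hd₂]) hne (by omega)
    rw [h1, Finset.card_pair hne] at c3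
    rw [h3, Finset.card_pair hne] at c4
    have h2 := eq_singleton_of_card_le hbD (by omega)
    have h4 := eq_singleton_of_card_le hbD' (by omega)
    simp only [Finset.ext_iff, Finset.mem_sdiff, Finset.mem_insert,
      Finset.mem_singleton] at h1 h2 h3 h4
    left
    refine S.card_between_of_pair_right hfh hne (b := b) (b' := b') ?_ ?_ ?_ ?_ ?_ ?_ ?_ ?_ ?_ <;>
    · ext x
      simp only [Finset.mem_sdiff, Finset.mem_insert, Finset.mem_singleton, Finset.mem_union]
      have m := m x; have h1 := h1 x; have h2 := h2 x; have h3 := h3 x; have h4 := h4 x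
      clear * - m h1 h2 h3 h4 ha hb hb' hd; grind
  have ea : ∀ x, x ∈ A → x ∉ B → x ∉ B' → x = a := fun x h1 h2 h3 => by
    by_contra h; exact hA ⟨x, by simp [h1, h2, h3], Ne.symm h⟩
  have ed : ∀ x, x ∈ D → x ∉ B → x ∉ B' → x = d := fun x h1 h2 h3 => by
    by_contra h; exact hD ⟨x, by simp [h1, h2, h3], Ne.symm h⟩
  by_cases hbb : (∃ b₂, b₂ ∈ B \ (A ∪ D) ∧ b ≠ b₂) ∨ ∃ b₂', b₂' ∈ B' \ (A ∪ D) ∧ b' ≠ b₂'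
  · rcases hbb with ⟨b₂, h2, hne⟩ | ⟨b₂, h2, hne⟩
    · exact S.card_between_of_split_merge hfh ha hb hb' hd (by simpa using h2) hne
    · rcases S.swap.card_between_of_split_merge hfh ⟨ha.1, ha.2.symm⟩ hb' hb ⟨hd.1, hd.2.symm⟩
        (by simpa using h2) hne with e | ⟨e1, e2, e3⟩
      · exact Or.inl e.symm
      · exact Or.inr ⟨e1, e3, e2⟩
  rw [not_or] at hbb
  have eb : ∀ x, x ∈ B → x ∉ A → x ∉ D → x = b := fun x h1 h2 h3 => by
    by_contra h; exact hbb.1 ⟨x, by simp [h1, h2, h3], Ne.symm h⟩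
  have eb' : ∀ x, x ∈ B' → x ∉ A → x ∉ D → x = b' := fun x h1 h2 h3 => by
    by_contra h; exact hbb.2 ⟨x, by simp [h1, h2, h3], Ne.symm h⟩
  clear c1 c2 c3 c4 hA hD hbb pA pA' pD pD'
  refine S.card_between_of_single hfh (a := a) (b := b) (b' := b') (d := d)
    (P := (A ∩ B') \ B) (Q := (B ∩ D) \ A) (R := (A ∩ B) \ B') (U := (B' ∩ D) \ A)
    (by simp [ha]) (by simp [ha]) (by simp [hb]) (by simp [hb]) (by simp [hb']) (by simp [hb'])
    (by simp [hd]) (by simp [hd]) ?_ ?_ ?_ ?_ ?_ ?_ ?_ ?_ ?_ ?_ <;>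
  · ext x
    simp only [Finset.mem_sdiff, Finset.mem_insert, Finset.mem_singleton, Finset.mem_union,
      Finset.mem_inter]
    have m := m x; have ea := ea x; have eb := eb x; have eb' := eb' x; have ed := ed x
    clear * - m ea eb eb' ed ha hb hb' hd; grind

end ColoredCircles

namespace PreAbstractSimplicialComplex

variable {V : Type*} [DecidableEq V]

/-! ### Chains of triangles modulo two -/

/-- The number of triangles in `T` that contain both `x` and `y`. -/
def pairDegree (T : Finset (Finset V)) (x y : V) : ℕ := (T.filter fun t => x ∈ t ∧ y ∈ t).card

theorem pairDegree_comm (T : Finset (Finset V)) (x y : V) : pairDegree T x y =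
    pairDegree T y x := by
  unfold pairDegree; simp only [and_comm]

/-- The boundary modulo two of a finite set of triangles: the edges that lie in an odd number of
the triangles. -/
def bdry (T : Finset (Finset V)) : Set (Sym2 V) :=
  Sym2.fromRel (r := fun x y => x ≠ y ∧ Odd (pairDegree T x y))
    ⟨fun x y h => ⟨h.1.symm, pairDegree_comm T x y ▸ h.2⟩⟩

theorem mem_bdry {T : Finset (Finset V)} {x y : V} :
    s(x, y) ∈ bdry T ↔ x ≠ y ∧ Odd (pairDegree T x y) := Iff.rfl

/-- The vertices of the triangles in `T`. -/
def verts (T : Finset (Finset V)) : Finset V := T.biUnion id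

theorem mem_verts {T : Finset (Finset V)} {x : V} : x ∈ verts T ↔ ∃ t ∈ T, x ∈ t := by
  simp [verts]

/-- The graph formed by the sides of the triangles in `T`. -/
def sides (T : Finset (Finset V)) : SimpleGraph V where
  Adj x y := x ≠ y ∧ ∃ t ∈ T, x ∈ t ∧ y ∈ t
  symm := ⟨fun _ _ h => ⟨h.1.symm, h.2.imp fun _ h => ⟨h.1, h.2.symm⟩⟩⟩
  loopless := ⟨fun _ h => h.1 rfl⟩

theorem sides_mono {T T' : Finset (Finset V)} (h : T ⊆ T') : sides T ≤ sides T' :=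
  fun _ _ hxy => ⟨hxy.1, hxy.2.imp fun _ ht => ⟨h ht.1, ht.2⟩⟩

theorem verts_mono {T T' : Finset (Finset V)} (h : T ⊆ T') : verts T ⊆ verts T' :=
  Finset.biUnion_subset_biUnion_of_subset_left _ h

theorem pairDegree_pos {T : Finset (Finset V)} {x y : V} :
    0 < pairDegree T x y ↔ ∃ t ∈ T, x ∈ t ∧ y ∈ t := by
  simp [pairDegree, Finset.card_pos, Finset.Nonempty]

theorem pairDegree_union {S T : Finset (Finset V)} (h : Disjoint S T) (x y : V) :
    pairDegree (S ∪ T) x y = pairDegree S x y + pairDegree T x y := by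
  unfold pairDegree
  rw [Finset.filter_union, Finset.card_union_of_disjoint (Finset.disjoint_filter_filter h)]

theorem pairDegree_mono {S T : Finset (Finset V)} (h : S ⊆ T) (x y : V) :
    pairDegree S x y ≤ pairDegree T x y :=
  Finset.card_le_card (Finset.filter_subset_filter _ h)

theorem bdry_empty : bdry (∅ : Finset (Finset V)) = ∅ := by
  ext ⟨x, y⟩
  change s(x, y) ∈ _ ↔ _
  simp [mem_bdry, pairDegree]

theorem mem_verts_of_mem_bdry {T : Finset (Finset V)} {x : V} {e : Sym2 V} (he : e ∈ bdry T)
    (hx : x ∈ e) : x ∈ verts T := by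
  obtain ⟨y, rfl⟩ := hx
  obtain ⟨t, ht, hx, -⟩ := pairDegree_pos.1 (mem_bdry.1 he).2.pos
  exact mem_verts.2 ⟨t, ht, hx⟩

open scoped symmDiff

theorem odd_pairDegree_symmDiff (S T : Finset (Finset V)) (x y : V) :
    Odd (pairDegree (S ∆ T) x y) ↔ ¬ (Odd (pairDegree S x y) ↔ Odd (pairDegree T x y)) := by
  have h1 : pairDegree (S ∆ T) x y = pairDegree (S \ T) x y + pairDegree (T \ S) x y := by
    rw [← pairDegree_union disjoint_sdiff_sdiff]; rfl
  have h2 : pairDegree S x y = pairDegree (S \ T) x y + pairDegree (S ∩ T) x y := by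
    rw [← pairDegree_union (Finset.disjoint_sdiff_inter S T), Finset.sdiff_union_inter]
  have h3 : pairDegree T x y = pairDegree (T \ S) x y + pairDegree (S ∩ T) x y := by
    rw [Finset.inter_comm, ← pairDegree_union (Finset.disjoint_sdiff_inter T S),
      Finset.sdiff_union_inter]
  rw [h1, h2, h3]
  simp only [Nat.odd_add, ← Nat.not_odd_iff_even]
  tauto

theorem bdry_symmDiff (S T : Finset (Finset V)) : bdry (S ∆ T) = bdry S ∆ bdry T := by
  ext ⟨x, y⟩
  change s(x, y) ∈ _ ↔ s(x, y) ∈ _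
  rw [Set.mem_symmDiff, mem_bdry, mem_bdry, mem_bdry, odd_pairDegree_symmDiff]
  tauto

variable {K : PreAbstractSimplicialComplex V}

/-- A finite set of triangles of the complex `K`. -/
def IsPatch (K : PreAbstractSimplicialComplex V) (T : Finset (Finset V)) : Prop :=
  ∀ t ∈ T, t ∈ K.faces ∧ t.card = 3

theorem IsPatch.mono {S T : Finset (Finset V)} (h : K.IsPatch T) (hS : S ⊆ T) : K.IsPatch S :=
  fun t ht => h t (hS ht)

theorem IsPatch.symmDiff {S T : Finset (Finset V)} (hS : K.IsPatch S) (hT : K.IsPatch T) :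
    K.IsPatch (S ∆ T) := fun t ht => by
  rcases Finset.mem_symmDiff.1 ht with h | h
  exacts [hS t h.1, hT t h.1]

theorem IsPatch.union {S T : Finset (Finset V)} (hS : K.IsPatch S) (hT : K.IsPatch T) :
    K.IsPatch (S ∪ T) := fun t ht => by
  rcases Finset.mem_union.1 ht with h | h
  exacts [hS t h, hT t h]

theorem face_mono {s t : Finset V} (ht : t ∈ K.faces) (hst : s ⊆ t) (hs : s.Nonempty) :
    s ∈ K.faces :=
  (K.isRelLowerSet_faces ht).2 hst hs

theorem IsPatch.sides_le {T : Finset (Finset V)} (h : K.IsPatch T) : sides T ≤ K.oneSkeleton := by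
  rintro x y ⟨hne, t, ht, hx, hy⟩
  exact ⟨hne, face_mono (h t ht).1 (by simp [Finset.insert_subset_iff, hx, hy]) (by simp)⟩

/-- A triangle with two given vertices has a third one. -/
theorem exists_third {t : Finset V} (ht : t.card = 3) {x y : V} (hxy : x ≠ y) (hx : x ∈ t)
    (hy : y ∈ t) : ∃ z, z ≠ x ∧ z ≠ y ∧ t = {x, y, z} := by
  have h1 : ((t.erase x).erase y).card = 1 := by
    rw [Finset.card_erase_of_mem (by simp [hy, hxy.symm]), Finset.card_erase_of_mem hx, ht]
  obtain ⟨z, hz⟩ := Finset.card_eq_one.1 h1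
  have hz' : z ∈ (t.erase x).erase y := hz ▸ Finset.mem_singleton_self z
  simp only [Finset.mem_erase] at hz'
  refine ⟨z, hz'.2.1, hz'.1, ?_⟩
  rw [← hz, Finset.insert_erase (by simp [hy, hxy.symm]), Finset.insert_erase hx]

theorem exists_two_others {t : Finset V} (ht : t.card = 3) {x : V} (hx : x ∈ t) :
    ∃ y z, y ≠ x ∧ z ≠ x ∧ y ≠ z ∧ t = {x, y, z} := by
  have h1 : (t.erase x).card = 2 := by rw [Finset.card_erase_of_mem hx, ht]
  obtain ⟨y, z, hyz, h⟩ := Finset.card_eq_two.1 h1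
  have hy : y ∈ t.erase x := by rw [h]; simp
  have hz : z ∈ t.erase x := by rw [h]; simp
  refine ⟨y, z, (Finset.mem_erase.1 hy).1, (Finset.mem_erase.1 hz).1, hyz, ?_⟩
  rw [← h, Finset.insert_erase hx]

namespace IsSurface

variable (hK : K.IsSurface)
include hK

/-- In a surface, at most two triangles meet in an edge. -/
theorem pairDegree_le {T : Finset (Finset V)} (hT : K.IsPatch T) {x y : V} (hxy : x ≠ y) :
    pairDegree T x y ≤ 2 := by
  have h : ((T.filter fun t => x ∈ t ∧ y ∈ t : Finset (Finset V)) : Set (Finset V)) ⊆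
      (fun z => {x, y, z}) '' ((K.linkGraph x).neighborSet y) := by
    intro t ht
    obtain ⟨ht, hx, hy⟩ := Finset.mem_filter.1 (Finset.mem_coe.1 ht)
    obtain ⟨z, hzx, hzy, rfl⟩ := exists_third (hT t ht).2 hxy hx hy
    exact ⟨z, ⟨hzy.symm, hxy.symm, hzx, (hT _ ht).1⟩, rfl⟩
  have h1 := (Set.encard_le_encard h).trans ((Set.encard_image_le _ _).trans (hK.link_degree x y))
  rw [Set.encard_coe_eq_coe_finsetCard] at h1
  exact_mod_cast h1

/-- A triangle of `K` at an edge of which `T` contains an even, positive number of triangles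
belongs to `T`. -/
theorem mem_of_not_mem_bdry {T : Finset (Finset V)} (hT : K.IsPatch T) {x y : V} (hxy : x ≠ y)
    (hb : s(x, y) ∉ bdry T) {t t' : Finset V} (ht : t ∈ T) (hx : x ∈ t) (hy : y ∈ t)
    (ht' : t' ∈ K.faces) (hc : t'.card = 3) (hx' : x ∈ t') (hy' : y ∈ t') : t' ∈ T := by
  by_contra hn
  have h1 : K.IsPatch (insert t' T) := fun s hs => by
    rcases Finset.mem_insert.1 hs with rfl | hs
    exacts [⟨ht', hc⟩, hT s hs]
  have h2 := hK.pairDegree_le h1 hxy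
  have h3 : pairDegree (insert t' T) x y = pairDegree T x y + 1 := by
    unfold pairDegree
    rw [Finset.filter_insert, if_pos ⟨hx', hy'⟩, Finset.card_insert_of_notMem (by simp [hn])]
  have h4 : 0 < pairDegree T x y := pairDegree_pos.2 ⟨t, ht, hx, hy⟩
  have h5 : ¬ Odd (pairDegree T x y) := fun h => hb (mem_bdry.2 ⟨hxy, h⟩)
  have h6 : pairDegree T x y = 1 := by omega
  exact h5 (h6 ▸ odd_one)

/-- Around a vertex off its boundary, a patch contains all the triangles or none. -/
theorem mem_of_vertex {T : Finset (Finset V)} (hT : K.IsPatch T) {x : V}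
    (hb : ∀ y, s(x, y) ∉ bdry T) {t t' : Finset V} (ht : t ∈ T) (hx : x ∈ t)
    (ht' : t' ∈ K.faces) (hc : t'.card = 3) (hx' : x ∈ t') : t' ∈ T := by
  obtain ⟨y, z, hyx, hzx, hyz, rfl⟩ := exists_two_others (hT t ht).2 hx
  obtain ⟨y', z', hyx', hzx', hyz', rfl⟩ := exists_two_others hc hx'
  have key : ∀ {u v : V} (w : (K.linkGraph x).Walk u v), x ≠ u → (∃ s ∈ T, x ∈ s ∧ u ∈ s) →
      ∃ s ∈ T, x ∈ s ∧ v ∈ s := by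
    intro u v w
    induction w with
    | nil => exact fun _ h => h
    | @cons u v w h p ih =>
      rintro hxu ⟨s, hs, hxs, hus⟩
      refine ih h.2.2.1.symm ⟨{x, u, v}, ?_, by simp, by simp⟩
      exact hK.mem_of_not_mem_bdry hT hxu (hb u) hs hxs hus h.2.2.2
        (Finset.card_eq_three.2 ⟨x, u, v, hxu, h.2.2.1.symm, h.1, rfl⟩) (by simp) (by simp)
  have a1 : K.oneSkeleton.Adj x y :=
    ⟨hyx.symm, face_mono (hT _ ht).1 (by simp [Finset.insert_subset_iff]) (by simp)⟩
  have a2 : K.oneSkeleton.Adj x y' :=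
    ⟨hyx'.symm, face_mono ht' (by simp [Finset.insert_subset_iff]) (by simp)⟩
  obtain ⟨w⟩ := hK.link_connected x y y' a1 a2
  obtain ⟨s, hs, h1, h2⟩ := key w hyx.symm ⟨_, ht, by simp, by simp⟩
  exact hK.mem_of_not_mem_bdry hT hyx'.symm (hb y') hs h1 h2 ht' hc (by simp) (by simp)

/-- In a connected surface, a patch without boundary is empty or contains all the triangles. -/
theorem mem_of_bdry_eq_empty (hconn : K.IsConnected) {T : Finset (Finset V)} (hT : K.IsPatch T)
    (hb : bdry T = ∅) (hne : T.Nonempty) {t : Finset V} (ht : t ∈ K.faces) (hc : t.card = 3) :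
    t ∈ T := by
  obtain ⟨t₀, ht₀⟩ := hne
  have hb' : ∀ x y, s(x, y) ∉ bdry T := fun x y => hb ▸ Set.notMem_empty _
  obtain ⟨x, hx⟩ := Finset.card_pos.1 (by rw [(hT t₀ ht₀).2]; decide : 0 < t₀.card)
  obtain ⟨y, hy⟩ := Finset.card_pos.1 (by rw [hc]; decide : 0 < t.card)
  have key : ∀ {u v : V} (w : K.oneSkeleton.Walk u v), (∃ s ∈ T, u ∈ s) → ∃ s ∈ T, v ∈ s := by
    intro u v w
    induction w with
    | nil => exact id
    | @cons u v w h p ih =>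
      rintro ⟨s, hs, hus⟩
      obtain ⟨s', hs', h1, h2⟩ := hK.pure _ h.2
      exact ih ⟨s', hK.mem_of_vertex hT (hb' u) hs hus hs' h2 (h1 (by simp)), h1 (by simp)⟩
  obtain ⟨w⟩ := hconn.2 x y (face_mono (hT t₀ ht₀).1 (by simpa using hx) (by simp))
    (face_mono ht (by simpa using hy) (by simp))
  obtain ⟨s, hs, hys⟩ := key w ⟨t₀, ht₀, hx⟩
  exact hK.mem_of_vertex hT (hb' y) hs hys ht hc hy

end IsSurface

open Classical in
/-- At every vertex, a boundary has an even number of edges. -/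
theorem IsPatch.even_bdry {T : Finset (Finset V)} (hT : K.IsPatch T) (x : V) :
    Even ((verts T).filter fun y => s(x, y) ∈ bdry T).card := by
  have h1 : ∑ y ∈ (verts T).erase x, pairDegree T x y = ∑ t ∈ T.filter (fun t => x ∈ t), 2 := by
    unfold pairDegree
    simp only [Finset.card_filter]
    rw [Finset.sum_comm, Finset.sum_filter]
    refine Finset.sum_congr rfl fun t ht => ?_
    split_ifs with hx
    · simp only [hx, true_and]
      rw [← Finset.card_filter]
      have : ((verts T).erase x).filter (fun y => y ∈ t) = t.erase x := by
        ext y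
        simp only [Finset.mem_filter, Finset.mem_erase, mem_verts]
        exact ⟨fun h => ⟨h.1.1, h.2⟩, fun h => ⟨⟨h.1, t, ht, h.2⟩, h.2⟩⟩
      rw [this, Finset.card_erase_of_mem hx, (hT t ht).2]
    · simp [hx]
  have h2 : Even (∑ y ∈ (verts T).erase x, pairDegree T x y) := by
    rw [h1]; simp
  rw [Finset.even_sum_iff_even_card_odd] at h2
  convert h2 using 2
  ext y
  simp only [Finset.mem_filter, Finset.mem_erase, mem_bdry]
  tauto

end PreAbstractSimplicialComplex

namespace PreAbstractSimplicialComplex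

variable {V : Type*} [DecidableEq V]

open scoped symmDiff

/-! ### Simple closed curves and the patches that they bound -/

/-- The vertices of a set of edges. -/
def curveVerts (γ : Set (Sym2 V)) : Set V := {x | ∃ y, s(x, y) ∈ γ}

/-- The combinatorial properties of the set of edges of a cycle in a graph: it is finite and
non-empty, every vertex has exactly two neighbors, it is connected, and it has as many edges as
vertices. -/
structure IsCurve (γ : Set (Sym2 V)) : Prop where
  finite : γ.Finite
  nonempty : γ.Nonempty
  ne_of_mem : ∀ x y, s(x, y) ∈ γ → x ≠ y
  nbr : ∀ x y, s(x, y) ∈ γ → ∃ z, z ≠ y ∧ ∀ u, s(x, u) ∈ γ ↔ u = y ∨ u = z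
  conn : ∀ X : Set V, (∀ x y, s(x, y) ∈ γ → x ∈ X → y ∈ X) →
    ∀ x ∈ curveVerts γ, ∀ y ∈ curveVerts γ, x ∈ X → y ∈ X
  card : γ.ncard = (curveVerts γ).ncard

theorem isCurve_of_isCycle {G : SimpleGraph V} {a : V} {w : G.Walk a a} (hw : w.IsCycle) :
    IsCurve {e | e ∈ w.edges} := by
  have hv : ∀ x, x ∈ curveVerts {e | e ∈ w.edges} ↔ x ∈ w.support.tail := by
    intro x
    constructor
    · rintro ⟨y, hy⟩
      have := w.fst_mem_support_of_mem_edges hy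
      rcases w.mem_support_iff.1 this with rfl | h
      · exact w.end_mem_tail_support hw.not_nil
      · exact h
    · intro hx
      have h2 := hw.ncard_neighborSet_toSubgraph_eq_two (List.mem_of_mem_tail hx)
      obtain ⟨y, hy⟩ := (Set.ncard_pos (Set.finite_of_ncard_ne_zero (by omega))).1
        (by omega : 0 < (w.toSubgraph.neighborSet x).ncard)
      exact ⟨y, SimpleGraph.Walk.adj_toSubgraph_iff_mem_edges.1 hy⟩
  have hfin : {e | e ∈ w.edges}.Finite := List.finite_toSet _
  refine ⟨hfin, ?_, ?_, ?_, ?_, ?_⟩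
  · cases w with
    | nil => exact absurd hw (by simp)
    | @cons _ v _ h p => exact ⟨s(a, v), by simp⟩
  · intro x y h
    exact (w.adj_of_mem_edges h).ne
  · intro x y h
    have h2 := hw.ncard_neighborSet_toSubgraph_eq_two (w.fst_mem_support_of_mem_edges h)
    obtain ⟨u, v, huv, he⟩ := Set.ncard_eq_two.1 h2
    have key : ∀ z, s(x, z) ∈ w.edges ↔ z = u ∨ z = v := fun z => by
      rw [← SimpleGraph.Walk.adj_toSubgraph_iff_mem_edges, ← SimpleGraph.Subgraph.mem_neighborSet,
        he]
      simp
    rcases (key y).1 h with rfl | rfl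
    · exact ⟨v, huv.symm, key⟩
    · exact ⟨u, huv, fun z => (key z).trans or_comm⟩
  · intro X hX
    have key : ∀ {u v : V} (p : G.Walk u v), (∀ e ∈ p.edges, e ∈ w.edges) → ∀ x ∈ p.support,
        (x ∈ X ↔ u ∈ X) := by
      intro u v p
      induction p with
      | nil => intro _ x hx; rw [SimpleGraph.Walk.mem_support_nil_iff.1 hx]
      | @cons u v v' h p ih =>
        intro he x hx
        rw [SimpleGraph.Walk.edges_cons] at he
        have h1 := he s(u, v) (by simp)
        have h2 : u ∈ X ↔ v ∈ X := ⟨hX u v h1, hX v u (by rw [Sym2.eq_swap]; exact h1)⟩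
        rw [SimpleGraph.Walk.support_cons, List.mem_cons] at hx
        rcases hx with rfl | hx
        · rfl
        · rw [h2]; exact ih (fun e h => he e (List.mem_cons_of_mem _ h)) x hx
    intro x hx y hy hxX
    have hx' := List.mem_of_mem_tail ((hv x).1 hx)
    have hy' := List.mem_of_mem_tail ((hv y).1 hy)
    rw [key w (fun _ h => h) y hy', ← key w (fun _ h => h) x hx']
    exact hxX
  · have h1 : curveVerts {e | e ∈ w.edges} = (w.support.tail.toFinset : Set V) := by
      ext x; rw [hv]; simp
    have h2 : {e | e ∈ w.edges} = (w.edges.toFinset : Set (Sym2 V)) := by ext; simp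
    rw [h1, h2, Set.ncard_coe_finset, Set.ncard_coe_finset,
      List.toFinset_card_of_nodup hw.support_nodup, List.toFinset_card_of_nodup hw.edges_nodup]
    simp

namespace IsCurve

variable {γ δ : Set (Sym2 V)} {K : PreAbstractSimplicialComplex V} {T : Finset (Finset V)}

theorem right_mem_curveVerts {x y : V} (h : s(x, y) ∈ γ) : y ∈ curveVerts γ :=
  ⟨x, by rw [Sym2.eq_swap]; exact h⟩

theorem mem_curveVerts_of_mem {x : V} {e : Sym2 V} (h : e ∈ γ) (hx : x ∈ e) :
    x ∈ curveVerts γ := by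
  obtain ⟨y, rfl⟩ := hx; exact ⟨y, h⟩

/-- A boundary which contains an edge of a curve, and does not branch off from it, contains the
whole curve. -/
theorem subset_bdry (hγ : IsCurve γ) (hT : K.IsPatch T)
    (hloc : ∀ x ∈ curveVerts γ, ∀ y, s(x, y) ∈ bdry T → s(x, y) ∈ γ) {e : Sym2 V} (he : e ∈ γ)
    (heT : e ∈ bdry T) : γ ⊆ bdry T := by
  classical
  have step : ∀ x y, s(x, y) ∈ γ → s(x, y) ∈ bdry T → ∀ u, s(x, u) ∈ γ → s(x, u) ∈ bdry T := by
    intro x y h1 h2 u hu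
    obtain ⟨z, hz, h⟩ := hγ.nbr x y h1
    rcases (h u).1 hu with rfl | rfl
    · exact h2
    by_contra hn
    have h3 := hT.even_bdry x
    have h4 : (verts T).filter (fun y => s(x, y) ∈ bdry T) = {y} := by
      ext v
      simp only [Finset.mem_filter, Finset.mem_singleton]
      constructor
      · rintro ⟨-, hv⟩
        rcases (h v).1 (hloc x ⟨y, h1⟩ v hv) with rfl | rfl
        · rfl
        · exact absurd hv hn
      · rintro rfl
        exact ⟨mem_verts_of_mem_bdry h2 (Sym2.mem_mk_right _ _), h2⟩
    rw [h4] at h3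
    simp at h3
  have hX := hγ.conn {x | ∀ y, s(x, y) ∈ γ → s(x, y) ∈ bdry T} (fun x y hxy hx =>
    step y x (by rw [Sym2.eq_swap]; exact hxy) (by rw [Sym2.eq_swap]; exact hx y hxy))
  induction e with | _ x y
  rintro ⟨u, v⟩ huv
  exact hX x ⟨y, he⟩ u ⟨v, huv⟩ (step x y he heT) v huv

theorem bdry_eq_of_subset (hγ : IsCurve γ) (hT : K.IsPatch T) (hsub : bdry T ⊆ γ)
    (hne : (bdry T).Nonempty) : bdry T = γ := by
  obtain ⟨e, he⟩ := hne
  exact hsub.antisymm (hγ.subset_bdry hT (fun _ _ _ h => hsub h) (hsub he) he)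

end IsCurve

/-- The set of triangles cannot be divided into two non-empty parts without common vertices. -/
def IsLinked (T : Finset (Finset V)) : Prop :=
  ∀ S ⊆ T, S.Nonempty → (T \ S).Nonempty → ∃ x, x ∈ verts S ∧ x ∈ verts (T \ S)

theorem sides_adj_of_mem {T : Finset (Finset V)} {t : Finset V} (ht : t ∈ T) {x y : V}
    (hx : x ∈ t) (hy : y ∈ t) (hxy : x ≠ y) : (sides T).Adj x y := ⟨hxy, t, ht, hx, hy⟩

theorem IsLinked.reachable {T : Finset (Finset V)} (h : IsLinked T) {x y : V} (hx : x ∈ verts T)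
    (hy : y ∈ verts T) : (sides T).Reachable x y := by
  classical
  set S := T.filter fun t => ∃ z ∈ t, (sides T).Reachable x z with hS
  have hr : ∀ t ∈ S, ∀ z ∈ t, (sides T).Reachable x z := by
    intro t ht z hz
    obtain ⟨ht, u, hu, hxu⟩ := Finset.mem_filter.1 ht
    by_cases huz : u = z
    · exact huz ▸ hxu
    · exact hxu.trans (sides_adj_of_mem ht hu hz huz).reachable
  obtain ⟨t, ht, hxt⟩ := mem_verts.1 hx
  obtain ⟨t', ht', hyt⟩ := mem_verts.1 hy
  by_cases hy' : t' ∈ S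
  · exact hr t' hy' y hyt
  · obtain ⟨z, hz, hz'⟩ := h S (Finset.filter_subset _ _)
      ⟨t, Finset.mem_filter.2 ⟨ht, x, hxt, SimpleGraph.Reachable.refl _⟩⟩
      ⟨t', Finset.mem_sdiff.2 ⟨ht', hy'⟩⟩
    obtain ⟨s, hs, hzs⟩ := mem_verts.1 hz
    obtain ⟨s', hs', hzs'⟩ := mem_verts.1 hz'
    obtain ⟨h1, h2⟩ := Finset.mem_sdiff.1 hs'
    exact absurd (Finset.mem_filter.2 ⟨h1, z, hzs', hr s hs z hzs⟩) h2

theorem pairDegree_eq_zero {T : Finset (Finset V)} {x y : V} (hx : x ∉ verts T) :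
    pairDegree T x y = 0 := by
  by_contra h
  obtain ⟨t, ht, hxt, -⟩ := pairDegree_pos.1 (Nat.pos_of_ne_zero h)
  exact hx (mem_verts.2 ⟨t, ht, hxt⟩)

theorem bdry_subset_of_no_common_vertex {S T : Finset (Finset V)} (hS : S ⊆ T)
    (h : ∀ x, x ∈ verts S → x ∉ verts (T \ S)) : bdry S ⊆ bdry T := by
  rintro ⟨x, y⟩ he
  change s(x, y) ∈ bdry S at he
  change s(x, y) ∈ bdry T
  refine mem_bdry.2 ⟨(mem_bdry.1 he).1, ?_⟩
  have h1 := pairDegree_union (S := S) (T := T \ S) Finset.disjoint_sdiff x y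
  rw [Finset.union_sdiff_of_subset hS, pairDegree_eq_zero (h x (mem_verts_of_mem_bdry he
    (Sym2.mem_mk_left _ _))), add_zero] at h1
  rw [h1]; exact (mem_bdry.1 he).2

namespace IsSurface

variable {K : PreAbstractSimplicialComplex V} (hK : K.IsSurface) (hconn : K.IsConnected)
include hK hconn

/-- A proper subset of a patch has a non-empty boundary. -/
theorem bdry_nonempty {S : Finset (Finset V)} (hS : K.IsPatch S) (hne : S.Nonempty)
    {t : Finset V} (ht : t ∈ K.faces) (hc : t.card = 3) (htS : t ∉ S) : (bdry S).Nonempty := by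
  rw [Set.nonempty_iff_ne_empty]
  exact fun h => htS (hK.mem_of_bdry_eq_empty hconn hS h hne ht hc)

/-- A patch with non-empty boundary has no non-empty subset without boundary. -/
theorem bdry_nonempty_of_subset {S T : Finset (Finset V)} (hT : K.IsPatch T)
    (hb : (bdry T).Nonempty) (hST : S ⊆ T) (hne : S.Nonempty) : (bdry S).Nonempty := by
  by_cases h : S = T
  · rwa [h]
  · obtain ⟨t, ht, htS⟩ := Finset.exists_of_ssubset (hST.ssubset_of_ne h)
    exact hK.bdry_nonempty hconn (hT.mono hST) hne (hT t ht).1 (hT t ht).2 htS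

/-- A patch which is bounded by a single curve is connected. -/
theorem isLinked {T : Finset (Finset V)} (hT : K.IsPatch T) (hγ : IsCurve (bdry T)) :
    IsLinked T := by
  intro S hS hne hne'
  by_contra hcon
  push Not at hcon
  have h1 := bdry_subset_of_no_common_vertex hS hcon
  have h2 : bdry (T \ S) ⊆ bdry T := by
    refine bdry_subset_of_no_common_vertex Finset.sdiff_subset fun x hx hx' => ?_
    rw [Finset.sdiff_sdiff_eq_self hS] at hx'
    exact hcon x hx' hx
  have e1 := hγ.bdry_eq_of_subset (hT.mono hS) h1
    (hK.bdry_nonempty_of_subset hconn hT hγ.nonempty hS hne)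
  have e2 := hγ.bdry_eq_of_subset (hT.mono Finset.sdiff_subset) h2
    (hK.bdry_nonempty_of_subset hconn hT hγ.nonempty Finset.sdiff_subset hne')
  obtain ⟨⟨x, y⟩, he⟩ := hγ.nonempty
  exact hcon x (mem_verts_of_mem_bdry (e1.symm ▸ he) (Sym2.mem_mk_left _ _))
    (mem_verts_of_mem_bdry (e2.symm ▸ he) (Sym2.mem_mk_left _ _))

end IsSurface

end PreAbstractSimplicialComplex

namespace PreAbstractSimplicialComplex

variable {V : Type*} [DecidableEq V]

/-! ### Patches as subsurfaces -/

/-- The complex formed by the triangles in `T` and their faces. -/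
def span (T : Finset (Finset V)) : PreAbstractSimplicialComplex V where
  faces := {s | s.Nonempty ∧ ∃ t ∈ T, s ⊆ t}
  isRelLowerSet_faces := fun _ h => ⟨h.1, fun _ hs hne => ⟨hne, h.2.imp fun _ ht =>
    ⟨ht.1, hs.trans ht.2⟩⟩⟩

theorem span_finite (T : Finset (Finset V)) : (span T).faces.Finite := by
  refine (T.biUnion Finset.powerset).finite_toSet.subset ?_
  rintro s ⟨-, t, ht, hs⟩
  simp only [Finset.coe_biUnion, Set.mem_iUnion]
  exact ⟨t, ht, by simpa using hs⟩

theorem span_oneSkeleton (T : Finset (Finset V)) : (span T).oneSkeleton = sides T := by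
  ext x y
  constructor
  · rintro ⟨h, -, t, ht, hs⟩
    exact ⟨h, t, ht, hs (by simp), hs (by simp)⟩
  · rintro ⟨h, t, ht, hx, hy⟩
    exact ⟨h, by simp, t, ht, by simp [Finset.insert_subset_iff, hx, hy]⟩

/-- The Euler characteristic of the complex spanned by the triangles in `T`. -/
noncomputable def chi (T : Finset (Finset V)) : ℤ :=
  (verts T).card - (sides T).edgeSet.ncard + T.card

theorem ncard_card_two (K : PreAbstractSimplicialComplex V) :
    {s | s ∈ K.faces ∧ s.card = 2}.ncard = K.oneSkeleton.edgeSet.ncard := by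
  have hinj : Function.Injective (Sym2.toFinset : Sym2 V → Finset V) := fun e e' h =>
    Sym2.ext fun x => by rw [← Sym2.mem_toFinset, h, Sym2.mem_toFinset]
  rw [← Set.ncard_image_of_injective _ hinj]
  congr 1
  ext s
  constructor
  · rintro ⟨hs, hc⟩
    obtain ⟨x, y, hxy, rfl⟩ := Finset.card_eq_two.1 hc
    exact ⟨s(x, y), ⟨hxy, hs⟩, Sym2.toFinset_mk_eq⟩
  · rintro ⟨⟨x, y⟩, h, rfl⟩
    have h : K.oneSkeleton.Adj x y := h
    change Sym2.toFinset s(x, y) ∈ {s | s ∈ K.faces ∧ s.card = 2}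
    rw [Sym2.toFinset_mk_eq]
    exact ⟨h.2, Finset.card_pair h.1⟩

variable {K : PreAbstractSimplicialComplex V}

theorem mem_span_card_three {T : Finset (Finset V)} (hT : K.IsPatch T) {s : Finset V} :
    (s ∈ (span T).faces ∧ s.card = 3) ↔ s ∈ T := by
  constructor
  · rintro ⟨⟨-, t, ht, hs⟩, hc⟩
    rwa [Finset.eq_of_subset_of_card_le hs (by rw [hc, (hT t ht).2])]
  · intro h
    exact ⟨⟨Finset.card_pos.1 (by rw [(hT s h).2]; decide), s, h, subset_rfl⟩, (hT s h).2⟩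

theorem eulerChar_span {T : Finset (Finset V)} (hT : K.IsPatch T) :
    (span T).eulerChar = chi T := by
  unfold eulerChar chi
  rw [ncard_card_two, span_oneSkeleton]
  have h1 : {s | s ∈ (span T).faces ∧ s.card = 1} = (fun x => ({x} : Finset V)) '' (verts T) := by
    ext s
    constructor
    · rintro ⟨⟨-, t, ht, hs⟩, hc⟩
      obtain ⟨x, rfl⟩ := Finset.card_eq_one.1 hc
      exact ⟨x, mem_verts.2 ⟨t, ht, hs (by simp)⟩, rfl⟩
    · rintro ⟨x, hx, rfl⟩
      obtain ⟨t, ht, hxt⟩ := mem_verts.1 hx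
      exact ⟨⟨by simp, t, ht, by simpa using hxt⟩, by simp⟩
  have h3 : {s | s ∈ (span T).faces ∧ s.card = 3} = (T : Set (Finset V)) := by
    ext s; exact mem_span_card_three hT
  rw [h1, h3, Set.ncard_image_of_injective _ Finset.singleton_injective, Set.ncard_coe_finset,
    Set.ncard_coe_finset]

theorem span_le {T : Finset (Finset V)} (hT : K.IsPatch T) : span T ≤ K := by
  rintro s ⟨hne, t, ht, hs⟩
  exact face_mono (hT t ht).1 hs hne

/-- A finite complex of dimension two in which every simplex lies in a triangle is spanned by its
triangles. -/
theorem eq_span {L : PreAbstractSimplicialComplex V} (hL : L.IsSurface) {T : Finset (Finset V)}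
    (hT : ∀ t, t ∈ T ↔ t ∈ L.faces ∧ t.card = 3) : L = span T := by
  apply PreAbstractSimplicialComplex.ext
  ext s
  constructor
  · intro hs
    obtain ⟨t, ht, hst, hc⟩ := hL.pure s hs
    exact ⟨(L.isRelLowerSet_faces hs).1, t, (hT t).2 ⟨ht, hc⟩, hst⟩
  · rintro ⟨hne, t, ht, hs⟩
    exact face_mono ((hT t).1 ht).1 hs hne

namespace IsSurface

variable (hK : K.IsSurface)
include hK

theorem odd_pairDegree_iff {T : Finset (Finset V)} (hT : K.IsPatch T) {x y : V} (hxy : x ≠ y) :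
    Odd (pairDegree T x y) ↔ pairDegree T x y = 1 := by
  have := hK.pairDegree_le hT hxy
  constructor
  · rintro ⟨k, hk⟩; omega
  · intro h; rw [h]; exact odd_one

theorem boundaryEdges_span {T : Finset (Finset V)} (hT : K.IsPatch T) :
    (span T).boundaryEdges = bdry T := by
  ext ⟨x, y⟩
  change (s(x, y) ∈ (span T).oneSkeleton.edgeSet ∧ _) ↔ s(x, y) ∈ bdry T
  rw [span_oneSkeleton, mem_bdry]
  have h1 : ∀ t : Finset V, (t ∈ (span T).faces ∧ t.card = 3 ∧ ∀ z ∈ s(x, y), z ∈ t) ↔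
      t ∈ T.filter fun t => x ∈ t ∧ y ∈ t := fun t => by
    rw [← and_assoc, mem_span_card_three hT, Finset.mem_filter]
    simp
  have h2 : (∃! t : Finset V, t ∈ (span T).faces ∧ t.card = 3 ∧ ∀ z ∈ s(x, y), z ∈ t) ↔
      pairDegree T x y = 1 := by
    unfold pairDegree
    rw [Finset.card_eq_one]
    simp only [h1]
    constructor
    · rintro ⟨t, ht, hu⟩
      exact ⟨t, Finset.eq_singleton_iff_unique_mem.2 ⟨ht, hu⟩⟩
    · rintro ⟨t, ht⟩
      exact ⟨t, by rw [ht]; simp, fun s hs => by rw [ht] at hs; simpa using hs⟩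
  rw [h2]
  constructor
  · rintro ⟨h, h'⟩
    exact ⟨(SimpleGraph.mem_edgeSet _).1 h |>.ne, h' ▸ odd_one⟩
  · rintro ⟨h, h'⟩
    rw [hK.odd_pairDegree_iff hT h] at h'
    obtain ⟨t, ht, hx, hy⟩ := pairDegree_pos.1 (h'.symm ▸ one_pos)
    exact ⟨sides_adj_of_mem ht hx hy h, h'⟩

/-- Every triangle has three sides, and an edge of a patch is a side of one or two triangles. -/
theorem two_mul_ncard_sides {T : Finset (Finset V)} (hT : K.IsPatch T) :
    2 * (sides T).edgeSet.ncard = 3 * T.card + (bdry T).ncard := by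
  classical
  set E : Finset (Sym2 V) := T.biUnion fun t => t.offDiag.image (fun p => s(p.1, p.2)) with hE
  have hm : ∀ x y, s(x, y) ∈ E ↔ x ≠ y ∧ ∃ t ∈ T, x ∈ t ∧ y ∈ t := by
    intro x y
    simp only [hE, Finset.mem_biUnion, Finset.mem_image, Finset.mem_offDiag, Prod.exists]
    constructor
    · rintro ⟨t, ht, a, b, ⟨ha, hb, hab⟩, h⟩
      rcases Sym2.eq_iff.1 h with ⟨rfl, rfl⟩ | ⟨rfl, rfl⟩
      · exact ⟨hab, t, ht, ha, hb⟩
      · exact ⟨hab.symm, t, ht, hb, ha⟩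
    · rintro ⟨h, t, ht, hx, hy⟩
      exact ⟨t, ht, x, y, ⟨hx, hy, h⟩, rfl⟩
  have h1 : (sides T).edgeSet = E := by
    ext ⟨x, y⟩
    exact (hm x y).symm
  have h2 : bdry T = (E.filter fun e => e ∈ bdry T : Finset (Sym2 V)) := by
    ext ⟨x, y⟩
    simp only [Finset.coe_filter, Set.mem_ofPred_eq]
    refine ⟨fun h => ⟨(hm x y).2 ⟨(mem_bdry.1 h).1, pairDegree_pos.1 (mem_bdry.1 h).2.pos⟩, h⟩,
      fun h => h.2⟩
  -- Double counting of the pairs of a side and a triangle in `T`.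
  have h3 : ∑ e ∈ E, (T.filter fun t => ∀ x ∈ e, x ∈ t).card = 3 * T.card := by
    simp only [Finset.card_filter]
    rw [Finset.sum_comm, mul_comm, ← smul_eq_mul, ← Finset.sum_const]
    refine Finset.sum_congr rfl fun t ht => ?_
    rw [← Finset.card_filter]
    have : E.filter (fun e => ∀ x ∈ e, x ∈ t) = t.offDiag.image (fun p => s(p.1, p.2)) := by
      ext ⟨x, y⟩
      change s(x, y) ∈ _ ↔ s(x, y) ∈ _
      rw [Finset.mem_filter, hm]
      simp only [Sym2.mem_iff, forall_eq_or_imp, forall_eq, Finset.mem_image, Finset.mem_offDiag,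
        Prod.exists]
      constructor
      · rintro ⟨⟨h, -⟩, hx, hy⟩
        exact ⟨x, y, ⟨hx, hy, h⟩, rfl⟩
      · rintro ⟨a, b, ⟨ha, hb, hab⟩, h⟩
        rcases Sym2.eq_iff.1 h with ⟨rfl, rfl⟩ | ⟨rfl, rfl⟩
        · exact ⟨⟨hab, t, ht, ha, hb⟩, ha, hb⟩
        · exact ⟨⟨hab.symm, t, ht, hb, ha⟩, hb, ha⟩
    rw [this]
    have := Sym2.card_image_offDiag t
    rw [(hT t ht).2] at this
    exact this
  have h4 : ∀ e ∈ E, (T.filter fun t => ∀ x ∈ e, x ∈ t).card + (if e ∈ bdry T then 1 else 0)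
      = 2 := by
    rintro ⟨x, y⟩ he
    change s(x, y) ∈ E at he
    change (T.filter fun t => ∀ z ∈ s(x, y), z ∈ t).card + (if s(x, y) ∈ bdry T then 1 else 0) = 2
    have h5 : (T.filter fun t => ∀ z ∈ s(x, y), z ∈ t).card = pairDegree T x y := by
      unfold pairDegree; simp
    obtain ⟨hxy, ht⟩ := (hm x y).1 he
    have h6 := hK.pairDegree_le hT hxy
    have h7 := pairDegree_pos.2 ht
    rw [h5, mem_bdry, hK.odd_pairDegree_iff hT hxy]
    split_ifs with h
    · omega
    · have : pairDegree T x y ≠ 1 := fun e => h ⟨hxy, e⟩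
      omega
  have h5 := Finset.sum_congr rfl h4
  rw [Finset.sum_add_distrib, h3, ← Finset.card_filter, Finset.sum_const, smul_eq_mul] at h5
  rw [h1, Set.ncard_coe_finset]
  conv_rhs => rw [h2]
  rw [Set.ncard_coe_finset]
  omega

theorem two_mul_chi {T : Finset (Finset V)} (hT : K.IsPatch T) :
    2 * chi T = 2 * (verts T).card - T.card - (bdry T).ncard := by
  have := hK.two_mul_ncard_sides hT
  unfold chi
  push_cast [← @Nat.cast_inj ℤ] at this
  linarith

end IsSurface

end PreAbstractSimplicialComplex

namespace PreAbstractSimplicialComplex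

variable {V : Type*} [DecidableEq V] {K : PreAbstractSimplicialComplex V}

namespace IsSurface

variable (hK : K.IsSurface)
include hK

/-- The link of a vertex in a patch bounded by a curve is connected: the boundary has at most two
edges at the vertex, and each component of the link uses up two of them or is the whole link in the
surface. -/
theorem link_span_reachable {T : Finset (Finset V)} (hT : K.IsPatch T) (hγ : IsCurve (bdry T))
    {v x y : V} (hx : (sides T).Adj v x) (hy : (sides T).Adj v y) :
    ((span T).linkGraph v).Reachable x y := by
  classical
  by_contra hxy
  -- The triangles at `v` whose sides at `v` are reachable from `x` within the link, and the others.
  set T₁ := T.filter fun t => v ∈ t ∧ ∃ z ∈ t, z ≠ v ∧ ((span T).linkGraph v).Reachable x z with h₁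
  set T₂ := T.filter fun t => v ∈ t ∧ t ∉ T₁ with h₂
  have hT₁ : K.IsPatch T₁ := hT.mono (Finset.filter_subset _ _)
  have hT₂ : K.IsPatch T₂ := hT.mono (Finset.filter_subset _ _)
  have hr : ∀ t ∈ T₁, ∀ z ∈ t, z ≠ v → ((span T).linkGraph v).Reachable x z := by
    intro t ht z hz hzv
    obtain ⟨ht, hv, u, hu, huv, hxu⟩ := Finset.mem_filter.1 ht
    by_cases huz : u = z
    · exact huz ▸ hxu
    · refine hxu.trans (SimpleGraph.Adj.reachable ⟨huz, huv, hzv, by simp, t, ht, ?_⟩)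
      simp [Finset.insert_subset_iff, hv, hu, hz]
  obtain ⟨hvx, t, ht, hvt, hxt⟩ := hx
  obtain ⟨hvy, t', ht', hvt', hyt'⟩ := hy
  have m₁ : t ∈ T₁ := Finset.mem_filter.2 ⟨ht, hvt, x, hxt, hvx.symm, SimpleGraph.Reachable.refl _⟩
  have n₁ : t' ∉ T₁ := fun h => hxy (hr t' h y hyt' hvy.symm)
  have m₂ : t' ∈ T₂ := Finset.mem_filter.2 ⟨ht', hvt', n₁⟩
  have n₂ : t ∉ T₂ := fun h => (Finset.mem_filter.1 h).2.2 m₁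
  have hsum : ∀ u, pairDegree T v u = pairDegree T₁ v u + pairDegree T₂ v u := by
    intro u
    rw [← pairDegree_union]
    · unfold pairDegree
      congr 1
      ext s
      simp only [Finset.mem_filter, Finset.mem_union, h₁, h₂]
      tauto
    · exact Finset.disjoint_left.2 fun s h h' => (Finset.mem_filter.1 h').2.2 h
  have hzero : ∀ u, v ≠ u → pairDegree T₁ v u = 0 ∨ pairDegree T₂ v u = 0 := by
    intro u hvu
    by_contra hcon
    rw [not_or] at hcon
    obtain ⟨s, hs, -, hus⟩ := pairDegree_pos.1 (Nat.pos_of_ne_zero hcon.1)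
    obtain ⟨s', hs', hvs', hus'⟩ := pairDegree_pos.1 (Nat.pos_of_ne_zero hcon.2)
    obtain ⟨hs'T, -, hn⟩ := Finset.mem_filter.1 hs'
    exact hn (Finset.mem_filter.2 ⟨hs'T, hvs', u, hus', hvu.symm, hr s hs u hus hvu.symm⟩)
  -- A part without boundary edges at `v` would contain all the triangles at `v`.
  have b₁ : ∃ u, s(v, u) ∈ bdry T₁ := by
    by_contra hcon
    push Not at hcon
    exact n₁ (hK.mem_of_vertex hT₁ hcon m₁ hvt (hT t' ht').1 (hT t' ht').2 hvt')
  have b₂ : ∃ u, s(v, u) ∈ bdry T₂ := by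
    by_contra hcon
    push Not at hcon
    exact n₂ (hK.mem_of_vertex hT₂ hcon m₂ hvt' (hT t ht).1 (hT t ht).2 hvt)
  have d₁ : ∀ u, s(v, u) ∈ bdry T₁ → s(v, u) ∈ bdry T ∧ s(v, u) ∉ bdry T₂ := by
    intro u hu
    obtain ⟨hvu, hodd⟩ := mem_bdry.1 hu
    have h0 := (hzero u hvu).resolve_left hodd.pos.ne'
    refine ⟨mem_bdry.2 ⟨hvu, by rw [hsum, h0, add_zero]; exact hodd⟩, fun h => ?_⟩
    have := (mem_bdry.1 h).2
    rw [h0] at this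
    exact absurd this (by decide)
  have d₂ : ∀ u, s(v, u) ∈ bdry T₂ → s(v, u) ∈ bdry T := by
    intro u hu
    obtain ⟨hvu, hodd⟩ := mem_bdry.1 hu
    have h0 := (hzero u hvu).resolve_right hodd.pos.ne'
    exact mem_bdry.2 ⟨hvu, by rw [hsum, h0, zero_add]; exact hodd⟩
  obtain ⟨u₁, hu₁⟩ := b₁
  obtain ⟨u₂, hu₂⟩ := b₂
  obtain ⟨z, hz, hnbr⟩ := hγ.nbr v u₁ (d₁ u₁ hu₁).1
  have e₂ : u₂ = z := ((hnbr u₂).1 (d₂ u₂ hu₂)).resolve_left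
    (fun e => (d₁ u₁ hu₁).2 (e ▸ hu₂))
  -- As `bdry T` has only two edges at `v`, each part has a single one, which contradicts parity.
  have hev := hT₁.even_bdry v
  have h4 : (verts T₁).filter (fun u => s(v, u) ∈ bdry T₁) = {u₁} := by
    ext w
    simp only [Finset.mem_filter, Finset.mem_singleton]
    constructor
    · rintro ⟨-, hw⟩
      rcases (hnbr w).1 (d₁ w hw).1 with rfl | rfl
      · rfl
      · exact absurd (e₂ ▸ hu₂) (d₁ _ hw).2
    · rintro rfl
      exact ⟨mem_verts_of_mem_bdry hu₁ (Sym2.mem_mk_right _ _), hu₁⟩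
  rw [h4] at hev
  simp at hev

theorem isSurface_span {T : Finset (Finset V)} (hT : K.IsPatch T) (hγ : IsCurve (bdry T)) :
    (span T).IsSurface where
  pure := by
    rintro s ⟨-, t, ht, hs⟩
    exact ⟨t, ((mem_span_card_three hT).2 ht).1, hs, (hT t ht).2⟩
  dim_le := by
    rintro s ⟨-, t, ht, hs⟩
    exact (Finset.card_le_card hs).trans_eq (hT t ht).2
  star_finite v := (span_finite T).subset fun s hs => hs.1
  link_connected v x y hx hy := by
    rw [span_oneSkeleton] at hx hy
    exact hK.link_span_reachable hT hγ hx hy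
  link_degree v x := by
    refine (Set.encard_le_encard ?_).trans (hK.link_degree v x)
    rintro y ⟨h1, h2, h3, h4⟩
    exact ⟨h1, h2, h3, span_le hT h4⟩

/-- A curve is the whole boundary of a compact connected subsurface if and only if it is the
boundary modulo two of a patch. -/
theorem exists_subsurface_iff (hconn : K.IsConnected) {γ : Set (Sym2 V)} (hγ : IsCurve γ) (k : ℤ) :
    (∃ L : PreAbstractSimplicialComplex V, L ≤ K ∧ L.IsSurface ∧ L.faces.Finite ∧ L.IsConnected ∧
      L.boundaryEdges = γ ∧ L.eulerChar = k) ↔ ∃ T, K.IsPatch T ∧ bdry T = γ ∧ chi T = k := by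
  classical
  constructor
  · rintro ⟨L, hLK, hL, hfin, -, hb, hk⟩
    set T := hfin.toFinset.filter fun t => t.card = 3 with hT
    have hm : ∀ t, t ∈ T ↔ t ∈ L.faces ∧ t.card = 3 := fun t => by simp [hT]
    have hp : K.IsPatch T := fun t ht => ⟨hLK ((hm t).1 ht).1, ((hm t).1 ht).2⟩
    have he := eq_span hL hm
    rw [he] at hb hk
    exact ⟨T, hp, by rw [← hK.boundaryEdges_span hp, hb], by rw [← eulerChar_span hp, hk]⟩
  · rintro ⟨T, hT, rfl, rfl⟩
    refine ⟨span T, span_le hT, hK.isSurface_span hT hγ, span_finite T, ⟨?_, ?_⟩,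
      hK.boundaryEdges_span hT, eulerChar_span hT⟩
    · obtain ⟨⟨x, y⟩, he⟩ := hγ.nonempty
      obtain ⟨t, ht, hx, -⟩ := pairDegree_pos.1 (mem_bdry.1 he).2.pos
      exact ⟨t, ((mem_span_card_three hT).2 ht).1⟩
    · rintro x y ⟨-, t, ht, hx⟩ ⟨-, t', ht', hy⟩
      rw [span_oneSkeleton]
      exact (hK.isLinked hconn hT hγ).reachable (mem_verts.2 ⟨t, ht, hx (by simp)⟩)
        (mem_verts.2 ⟨t', ht', hy (by simp)⟩)

end IsSurface

theorem IsSimpleClosedCurve.isCurve {γ : Set (Sym2 V)} (h : K.IsSimpleClosedCurve γ) :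
    IsCurve γ := by
  obtain ⟨l, a, w, hw, -, rfl⟩ := h
  exact isCurve_of_isCycle hw

theorem IsSurface.boundsDisk_iff (hK : K.IsSurface) (hconn : K.IsConnected) {γ : Set (Sym2 V)}
    (hγ : K.IsSimpleClosedCurve γ) :
    K.BoundsDisk γ ↔ ∃ T, K.IsPatch T ∧ bdry T = γ ∧ chi T = 1 := by
  rw [← hK.exists_subsurface_iff hconn hγ.isCurve]
  exact and_iff_right hγ

theorem IsSurface.boundsMobiusBand_iff (hK : K.IsSurface) (hconn : K.IsConnected)
    {γ : Set (Sym2 V)} (hγ : K.IsSimpleClosedCurve γ) :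
    K.BoundsMobiusBand γ ↔ ∃ T, K.IsPatch T ∧ bdry T = γ ∧ chi T = 0 := by
  rw [← hK.exists_subsurface_iff hconn hγ.isCurve]
  exact and_iff_right hγ

end PreAbstractSimplicialComplex

namespace PreAbstractSimplicialComplex

variable {V : Type*} [DecidableEq V] {K : PreAbstractSimplicialComplex V}

/-! ### Homotopy of edge paths -/

/-- The elementary homotopy of edge paths which replaces two sides of a triangle by the third. -/
inductive PathMove (K : PreAbstractSimplicialComplex V) : List V → List V → Prop
  | contract (l : List V) (a b c : V) (r : List V) (h : ({a, b, c} : Finset V) ∈ K.faces) :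
      PathMove K (l ++ a :: b :: c :: r) (l ++ a :: c :: r)

/-- Homotopy of edge paths. -/
def PathHomotopic (K : PreAbstractSimplicialComplex V) : List V → List V → Prop :=
  Relation.EqvGen K.PathMove

namespace PathHomotopic

variable {l l' m : List V}

theorem refl (l : List V) : K.PathHomotopic l l := Relation.EqvGen.refl l

theorem symm (h : K.PathHomotopic l l') : K.PathHomotopic l' l := Relation.EqvGen.symm _ _ h

theorem trans (h : K.PathHomotopic l l') (h' : K.PathHomotopic l' m) : K.PathHomotopic l m :=
  Relation.EqvGen.trans _ _ _ h h'

theorem contract {a b c : V} (r : List V) (h : ({a, b, c} : Finset V) ∈ K.faces) :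
    K.PathHomotopic (a :: b :: c :: r) (a :: c :: r) :=
  Relation.EqvGen.rel _ _ (PathMove.contract [] a b c r h)

theorem append_left (p : List V) (h : K.PathHomotopic l l') :
    K.PathHomotopic (p ++ l) (p ++ l') := by
  induction h with
  | rel x y h =>
    obtain ⟨l, a, b, c, r, h⟩ := h
    rw [← List.append_assoc, ← List.append_assoc]
    exact Relation.EqvGen.rel _ _ (PathMove.contract _ a b c r h)
  | refl => exact refl _
  | symm _ _ _ ih => exact ih.symm
  | trans _ _ _ _ _ ih ih' => exact ih.trans ih'

theorem cons (a : V) (h : K.PathHomotopic l l') : K.PathHomotopic (a :: l) (a :: l') :=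
  append_left [a] h

theorem append_right (p : List V) (h : K.PathHomotopic l l') :
    K.PathHomotopic (l ++ p) (l' ++ p) := by
  induction h with
  | rel x y h =>
    obtain ⟨l, a, b, c, r, h⟩ := h
    simp only [List.append_assoc, List.cons_append]
    exact Relation.EqvGen.rel _ _ (PathMove.contract _ a b c _ h)
  | refl => exact refl _
  | symm _ _ _ ih => exact ih.symm
  | trans _ _ _ _ _ ih ih' => exact ih.trans ih'

end PathHomotopic

theorem homotopic_append_comm (l m : List V) : K.Homotopic (l ++ m) (m ++ l) := by
  induction l generalizing m with
  | nil => rw [List.nil_append, List.append_nil]; exact Relation.EqvGen.refl _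
  | cons a l ih =>
    refine Relation.EqvGen.trans _ _ _
      (Relation.EqvGen.rel _ _ (HomotopyMove.rotate a (l ++ m))) ?_
    have h := ih (m ++ [a])
    rwa [← List.append_assoc, List.append_assoc m] at h

/-- Homotopic edge paths, regarded as closed paths, are freely homotopic. -/
theorem PathHomotopic.homotopic {l l' : List V} (h : K.PathHomotopic l l') :
    K.Homotopic l l' := by
  induction h with
  | rel x y h =>
    obtain ⟨l, a, b, c, r, h⟩ := h
    refine Relation.EqvGen.trans _ _ _ (homotopic_append_comm _ _) ?_
    refine Relation.EqvGen.trans _ _ _ ?_ (homotopic_append_comm _ _)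
    exact Relation.EqvGen.rel _ _ (HomotopyMove.contract a b c _ h)
  | refl => exact Relation.EqvGen.refl _
  | symm _ _ _ ih => exact Relation.EqvGen.symm _ _ ih
  | trans _ _ _ _ _ ih ih' => exact Relation.EqvGen.trans _ _ _ ih ih'

theorem vertex_face {G : SimpleGraph V} (hG : G ≤ K.oneSkeleton) {u v : V} (h : G.Adj u v) :
    ({u, v} : Finset V) ∈ K.faces ∧ ({u} : Finset V) ∈ K.faces :=
  ⟨(hG h).2, face_mono (hG h).2 (by simp) (by simp)⟩

/-- In a forest, every walk is homotopic to a path. The last vertex is written twice, so that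
a walk which returns to its origin can be contracted by moves which keep three vertices in view. -/
theorem exists_path_homotopic {G : SimpleGraph V} (hG : G ≤ K.oneSkeleton) (hac : G.IsAcyclic)
    {u v : V} (w : G.Walk u v) :
    ∃ q : G.Path u v, K.PathHomotopic (w.support ++ [v]) (q.1.support ++ [v]) := by
  induction w with
  | nil => exact ⟨SimpleGraph.Path.nil, PathHomotopic.refl _⟩
  | @cons u v e h p ih =>
    obtain ⟨⟨q, hq⟩, hpq⟩ := ih
    have h1 : K.PathHomotopic ((SimpleGraph.Walk.cons h p).support ++ [e])
        (u :: (q.support ++ [e])) := by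
      rw [SimpleGraph.Walk.support_cons, List.cons_append]
      exact hpq.cons u
    by_cases hu : u ∈ q.support
    · cases q with
      | nil =>
        simp only [SimpleGraph.Walk.support_nil, List.mem_singleton] at hu
        exact absurd hu h.ne
      | @cons _ x _ h' q' =>
        have hx := hac.eq_snd_of_adj_start hq h.symm hu
        simp only [SimpleGraph.Walk.snd_cons] at hx
        subst hx
        refine ⟨⟨q', (SimpleGraph.Walk.cons_isPath_iff _ _ |>.1 hq).1⟩, h1.trans ?_⟩
        rw [SimpleGraph.Walk.support_cons]
        obtain ⟨f1, f2⟩ := vertex_face hG h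
        cases q' with
        | nil =>
          refine (PathHomotopic.contract _ ?_).trans (PathHomotopic.contract _ ?_)
          · rw [Finset.pair_comm, Finset.insert_idem]; exact f1
          · simpa using f2
        | @cons _ y _ h'' q'' =>
          obtain ⟨f3, f4⟩ := vertex_face hG h''
          simp only [SimpleGraph.Walk.support_cons, List.cons_append]
          refine (PathHomotopic.contract _ ?_).trans ?_
          · rw [Finset.pair_comm, Finset.insert_idem]; exact f1
          rw [← SimpleGraph.Walk.cons_tail_support q'']
          refine PathHomotopic.contract _ ?_
          simpa using f3
    · exact ⟨⟨SimpleGraph.Walk.cons h q, (SimpleGraph.Walk.cons_isPath_iff _ _).2 ⟨hq, hu⟩⟩,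
        by simpa using h1⟩

theorem pathHomotopic_of_isAcyclic {G : SimpleGraph V} (hG : G ≤ K.oneSkeleton)
    (hac : G.IsAcyclic) {u v : V} (w w' : G.Walk u v) :
    K.PathHomotopic (w.support ++ [v]) (w'.support ++ [v]) := by
  obtain ⟨q, hq⟩ := exists_path_homotopic hG hac w
  obtain ⟨q', hq'⟩ := exists_path_homotopic hG hac w'
  rw [(hac.subsingleton_path u v).elim q q'] at hq
  exact hq.trans hq'.symm

/-! ### Collapsing a patch -/

/-- If every non-empty part of a patch has a free side outside a set `B` of edges, then the
triangles can be removed one by one, each together with a free side. The graph that remains contains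
`B`, and every edge path can be pushed into it. -/
theorem exists_collapse {T : Finset (Finset V)} (hT : K.IsPatch T) {B : Set (Sym2 V)}
    (hfree : ∀ S ⊆ T, S.Nonempty → ∃ x y, x ≠ y ∧ s(x, y) ∉ B ∧ pairDegree S x y = 1)
    {G : SimpleGraph V} (hG : sides T ≤ G) (hGK : G ≤ K.oneSkeleton) (hfin : G.edgeSet.Finite) :
    ∃ G' ≤ G, (∀ e ∈ B, e ∈ G.edgeSet → e ∈ G'.edgeSet) ∧
      G'.edgeSet.ncard + T.card = G.edgeSet.ncard ∧
      ∀ u v (w : G.Walk u v), ∃ w' : G'.Walk u v,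
        K.PathHomotopic (w.support ++ [v]) (w'.support ++ [v]) := by
  induction hn : T.card generalizing T G with
  | zero =>
    exact ⟨G, le_rfl, fun e _ h => h, by simp, fun u v w => ⟨w, PathHomotopic.refl _⟩⟩
  | succ n ih =>
    have hne : T.Nonempty := Finset.card_pos.1 (by omega)
    obtain ⟨x, y, hxy, hB, hd⟩ := hfree T subset_rfl hne
    obtain ⟨t, ht⟩ := Finset.card_eq_one.1 hd
    have htm : t ∈ T.filter fun t => x ∈ t ∧ y ∈ t := ht ▸ Finset.mem_singleton_self t
    obtain ⟨htT, hxt, hyt⟩ := Finset.mem_filter.1 htm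
    obtain ⟨z, hzx, hzy, rfl⟩ := exists_third (hT t htT).2 hxy hxt hyt
    -- Remove the only triangle `xyz` at the free side `xy` along with that side.
    set G₁ := G.deleteEdges {s(x, y)} with hG₁
    have hle : G₁ ≤ G := SimpleGraph.deleteEdges_le _
    have hadj : ∀ a b, G₁.Adj a b ↔ G.Adj a b ∧ s(a, b) ≠ s(x, y) := fun a b => by
      rw [hG₁, SimpleGraph.deleteEdges_adj]; simp
    have hxyG : G.Adj x y := hG (sides_adj_of_mem htT hxt hyt hxy)
    have hs : sides (T.erase {x, y, z}) ≤ G₁ := by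
      intro a b hab
      refine (hadj a b).2 ⟨hG (sides_mono (Finset.erase_subset _ _) hab), fun he => ?_⟩
      obtain ⟨-, s, hs, has, hbs⟩ := hab
      have : s ∈ T.filter fun t => x ∈ t ∧ y ∈ t := by
        refine Finset.mem_filter.2 ⟨Finset.mem_of_mem_erase hs, ?_⟩
        rcases Sym2.eq_iff.1 he with ⟨rfl, rfl⟩ | ⟨rfl, rfl⟩
        exacts [⟨has, hbs⟩, ⟨hbs, has⟩]
      rw [ht, Finset.mem_singleton] at this
      exact Finset.ne_of_mem_erase hs this
    have hc : (T.erase {x, y, z}).card = n := by rw [Finset.card_erase_of_mem htT]; omega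
    obtain ⟨G', hG', hBG', hcard, hw⟩ := ih (hT.mono (Finset.erase_subset _ _))
      (fun S hS => hfree S (hS.trans (Finset.erase_subset _ _))) hs (hle.trans hGK)
      (hfin.subset (SimpleGraph.edgeSet_mono hle)) hc
    have he : G₁.edgeSet = G.edgeSet \ {s(x, y)} := SimpleGraph.edgeSet_deleteEdges _
    refine ⟨G', hG'.trans hle, fun e heB heG => hBG' e heB ?_, ?_, ?_⟩
    · rw [he]
      exact ⟨heG, fun h => hB (by rw [Set.mem_singleton_iff] at h; exact h ▸ heB)⟩
    · have h1 := Set.ncard_sdiff_singleton_add_one (s := G.edgeSet) (a := s(x, y)) hxyG hfin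
      rw [he] at hcard
      omega
    · have hface : ({x, z, y} : Finset V) ∈ K.faces := by
        rw [Finset.pair_comm]; exact (hT _ htT).1
      have hface' : ({y, z, x} : Finset V) ∈ K.faces := by
        convert hface using 1; ext; simp; tauto
      have hxz : G₁.Adj x z := (hadj x z).2
        ⟨hG (sides_adj_of_mem htT (by simp) (by simp) hzx.symm), by simp [hzy, hxy]⟩
      have hzy' : G₁.Adj z y := (hadj z y).2
        ⟨hG (sides_adj_of_mem htT (by simp) (by simp) hzy), by simp [hzx, hzy]⟩
      -- A walk avoids the removed side `xy` by a detour through `z`.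
      have step : ∀ {u v : V} (w : G.Walk u v), ∃ w' : G₁.Walk u v,
          K.PathHomotopic (w.support ++ [v]) (w'.support ++ [v]) := by
        intro u v w
        induction w with
        | nil => exact ⟨SimpleGraph.Walk.nil, PathHomotopic.refl _⟩
        | @cons u v e h p ih =>
          obtain ⟨p', hp⟩ := ih
          have h1 : K.PathHomotopic ((SimpleGraph.Walk.cons h p).support ++ [e])
            (u :: (p'.support ++ [e])) := by
            rw [SimpleGraph.Walk.support_cons, List.cons_append]
            exact hp.cons u
          by_cases huv : s(u, v) = s(x, y)
          · rcases Sym2.eq_iff.1 huv with ⟨rfl, rfl⟩ | ⟨rfl, rfl⟩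
            · refine ⟨SimpleGraph.Walk.cons hxz (SimpleGraph.Walk.cons hzy' p'), h1.trans ?_⟩
              rw [SimpleGraph.Walk.support_cons, SimpleGraph.Walk.support_cons,
                ← SimpleGraph.Walk.cons_tail_support p']
              exact (PathHomotopic.contract _ hface).symm
            · refine ⟨SimpleGraph.Walk.cons hzy'.symm (SimpleGraph.Walk.cons hxz.symm p'),
                h1.trans ?_⟩
              rw [SimpleGraph.Walk.support_cons, SimpleGraph.Walk.support_cons,
                ← SimpleGraph.Walk.cons_tail_support p']
              exact (PathHomotopic.contract _ hface').symm
          · exact ⟨SimpleGraph.Walk.cons ((hadj u v).2 ⟨h, huv⟩) p', by simpa using h1⟩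
      intro u v w
      obtain ⟨w₁, h₁⟩ := step w
      obtain ⟨w₂, h₂⟩ := hw u v w₁
      exact ⟨w₂, h₁.trans h₂⟩

/-- A connected graph has at most one vertex more than edges, and then it is a tree. -/
theorem card_le_ncard_edgeSet_add_one {G : SimpleGraph V} {X : Finset V} (hX : X.Nonempty)
    (hfin : G.edgeSet.Finite) (hsub : ∀ x y, G.Adj x y → x ∈ X)
    (hconn : ∀ x ∈ X, ∀ y ∈ X, G.Reachable x y) :
    X.card ≤ G.edgeSet.ncard + 1 ∧ (X.card = G.edgeSet.ncard + 1 → G.IsAcyclic) := by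
  have hsupp : ∀ {u v : V} (w : G.Walk u v), u ∈ X → ∀ x ∈ w.support, x ∈ (X : Set V) := by
    intro u v w
    induction w with
    | nil => intro hu x hx; rw [SimpleGraph.Walk.mem_support_nil_iff.1 hx]; exact hu
    | @cons u v e h p ih =>
      intro hu x hx
      rw [SimpleGraph.Walk.support_cons, List.mem_cons] at hx
      rcases hx with rfl | hx
      exacts [hu, ih (hsub v u h.symm) x hx]
  set H := G.induce (X : Set V) with hH
  have hHc : H.Connected := by
    have : Nonempty (X : Set V) := hX.to_subtype
    refine ⟨fun x y => ?_⟩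
    obtain ⟨w⟩ := hconn x x.2 y y.2
    exact ⟨w.induce (X : Set V) (hsupp w x.2)⟩
  have hinj := (SimpleGraph.Embedding.induce (G := G) (X : Set V)).mapEdgeSet.injective
  have : Finite G.edgeSet := hfin.to_subtype
  have h1 : Nat.card H.edgeSet ≤ G.edgeSet.ncard := by
    rw [← Nat.card_coe_set_eq]
    exact Nat.card_le_card_of_injective _ hinj
  have h2 := hHc.card_vert_le_card_edgeSet_add_one
  have h3 : Nat.card (X : Set V) = X.card := by simp
  refine ⟨by omega, fun h => ?_⟩
  have h4 : H.IsTree := SimpleGraph.isTree_iff_connected_and_card.2 ⟨hHc, by omega⟩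
  intro a w hw
  have ha : a ∈ X := hsub a _ (w.adj_snd hw.not_nil)
  refine h4.isAcyclic (w.induce (X : Set V) (hsupp w ha)) ?_
  rw [← SimpleGraph.Walk.isCycle_map_iff_of_injective (f :=
    (SimpleGraph.Embedding.induce (X : Set V)).toHom)
    Subtype.val_injective, SimpleGraph.Walk.map_induce]
  exact hw

theorem finite_sides (T : Finset (Finset V)) : (sides T).edgeSet.Finite := by
  refine (((verts T) ×ˢ (verts T)).image fun p => s(p.1, p.2)).finite_toSet.subset ?_
  rintro ⟨x, y⟩ ⟨-, t, ht, hx, hy⟩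
  simp only [Finset.coe_image, Set.mem_image, Finset.mem_coe, Finset.mem_product, Prod.exists]
  exact ⟨x, y, ⟨mem_verts.2 ⟨t, ht, hx⟩, mem_verts.2 ⟨t, ht, hy⟩⟩, rfl⟩

/-- The graph to which a connected patch collapses has `1 - χ` independent cycles. -/
theorem exists_connected_collapse {T : Finset (Finset V)} (hT : K.IsPatch T) (hne : T.Nonempty)
    (hl : IsLinked T) {B : Set (Sym2 V)}
    (hfree : ∀ S ⊆ T, S.Nonempty → ∃ x y, x ≠ y ∧ s(x, y) ∉ B ∧ pairDegree S x y = 1) :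
    ∃ G ≤ sides T, (∀ e ∈ B, e ∈ (sides T).edgeSet → e ∈ G.edgeSet) ∧ chi T ≤ 1 ∧
      (chi T = 1 → G.IsAcyclic) ∧ ∀ u v (w : (sides T).Walk u v), ∃ w' : G.Walk u v,
        K.PathHomotopic (w.support ++ [v]) (w'.support ++ [v]) := by
  obtain ⟨G, hG, hB, hcard, hw⟩ := exists_collapse hT hfree le_rfl hT.sides_le (finite_sides T)
  have hX : (verts T).Nonempty := by
    obtain ⟨t, ht⟩ := hne
    obtain ⟨x, hx⟩ := Finset.card_pos.1 (by rw [(hT t ht).2]; decide : 0 < t.card)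
    exact ⟨x, mem_verts.2 ⟨t, ht, hx⟩⟩
  obtain ⟨h1, h2⟩ := card_le_ncard_edgeSet_add_one (G := G) hX
    ((finite_sides T).subset (SimpleGraph.edgeSet_mono hG))
    (fun x y h => by obtain ⟨-, t, ht, hx, -⟩ := hG h; exact mem_verts.2 ⟨t, ht, hx⟩)
    (fun x hx y hy => by
      obtain ⟨w⟩ := hl.reachable hx hy
      obtain ⟨w', -⟩ := hw x y w
      exact ⟨w'⟩)
  have h3 : chi T = (verts T).card - G.edgeSet.ncard := by
    unfold chi
    rw [← hcard]; push_cast; ring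
  refine ⟨G, hG, hB, by omega, fun h => h2 (by omega), hw⟩

namespace IsSurface

variable (hK : K.IsSurface)
include hK

theorem exists_free {S : Finset (Finset V)} (hS : K.IsPatch S) {B : Set (Sym2 V)}
    (h : ¬ bdry S ⊆ B) : ∃ x y, x ≠ y ∧ s(x, y) ∉ B ∧ pairDegree S x y = 1 := by
  rw [Set.not_subset] at h
  obtain ⟨⟨x, y⟩, he, hB⟩ := h
  exact ⟨x, y, (mem_bdry.1 he).1, hB,
    (hK.odd_pairDegree_iff hS (mem_bdry.1 he).1).1 (mem_bdry.1 he).2⟩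

/-- A connected surface with boundary has Euler characteristic at most one. -/
theorem chi_le_one {T : Finset (Finset V)} (hT : K.IsPatch T) (hl : IsLinked T) (hne : T.Nonempty)
    (hb : ∀ S ⊆ T, S.Nonempty → (bdry S).Nonempty) : chi T ≤ 1 := by
  obtain ⟨G, -, -, h, -⟩ := exists_connected_collapse (B := ∅) hT hne hl fun S hS hSne =>
    hK.exists_free (hT.mono hS) fun h => (hb S hS hSne).ne_empty (Set.subset_empty_iff.1 h)
  exact h

/-- If a connected surface contains a closed curve, but no part of it has its boundary inside the
curve, then its Euler characteristic is at most zero. -/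
theorem chi_le_zero {T : Finset (Finset V)} (hT : K.IsPatch T) (hl : IsLinked T) (hne : T.Nonempty)
    {γ : Set (Sym2 V)} (hγ : K.IsSimpleClosedCurve γ) (hγT : γ ⊆ (sides T).edgeSet)
    (hb : ∀ S ⊆ T, S.Nonempty → ¬ bdry S ⊆ γ) : chi T ≤ 0 := by
  obtain ⟨G, -, hB, h, hac, -⟩ := exists_connected_collapse (B := γ) hT hne hl fun S hS hSne =>
    hK.exists_free (hT.mono hS) (hb S hS hSne)
  by_contra hcon
  obtain ⟨l, a, w, hw, -, rfl⟩ := hγ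
  have hG : ∀ e ∈ w.edges, e ∈ G.edgeSet := fun e he => hB e he (hγT he)
  exact hac (by omega) (w.transfer G hG) (hw.transfer hG)

/-- Edge paths with the same ends in a disk are homotopic. -/
theorem pathHomotopic_of_chi_eq_one {T : Finset (Finset V)} (hT : K.IsPatch T) (hl : IsLinked T)
    (hne : T.Nonempty) (hb : ∀ S ⊆ T, S.Nonempty → (bdry S).Nonempty) (hchi : chi T = 1) {u v : V}
    (w w' : (sides T).Walk u v) : K.PathHomotopic (w.support ++ [v]) (w'.support ++ [v]) := by
  obtain ⟨G, hG, -, -, hac, hw⟩ := exists_connected_collapse (B := ∅) hT hne hl fun S hS hSne =>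
    hK.exists_free (hT.mono hS) fun h => (hb S hS hSne).ne_empty (Set.subset_empty_iff.1 h)
  obtain ⟨p, hp⟩ := hw u v w
  obtain ⟨p', hp'⟩ := hw u v w'
  exact (hp.trans (pathHomotopic_of_isAcyclic (hG.trans hT.sides_le)
    (hac hchi) p p')).trans hp'.symm

end IsSurface

end PreAbstractSimplicialComplex

namespace PreAbstractSimplicialComplex

variable {V : Type*} [DecidableEq V] {K : PreAbstractSimplicialComplex V}

open scoped symmDiff

/-! ### Unions of patches and their Euler characteristics -/

theorem mem_bdry_congr {S T : Finset (Finset V)} {x : V}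
    (h : ∀ t, x ∈ t → (t ∈ S ↔ t ∈ T)) (y : V) :
    s(x, y) ∈ bdry S ↔ s(x, y) ∈ bdry T := by
  have : pairDegree S x y = pairDegree T x y := by
    unfold pairDegree
    congr 1
    ext t
    simp only [Finset.mem_filter]
    exact ⟨fun ht => ⟨(h t ht.2.1).1 ht.1, ht.2⟩, fun ht => ⟨(h t ht.2.1).2 ht.1, ht.2⟩⟩
  rw [mem_bdry, mem_bdry, this]

/-- Having no boundary is a local property. -/
theorem bdry_eq_empty_of_local {U : Finset (Finset V)}
    (h : ∀ x, ∃ T, (∀ t, x ∈ t → (t ∈ U ↔ t ∈ T)) ∧ x ∉ curveVerts (bdry T)) : bdry U = ∅ := by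
  rw [Set.eq_empty_iff_forall_notMem]
  rintro ⟨x, y⟩ hxy
  obtain ⟨T, hT, hn⟩ := h x
  exact hn ⟨y, (mem_bdry_congr hT y).1 hxy⟩

theorem bdry_union {S T : Finset (Finset V)} (h : Disjoint S T) :
    bdry (S ∪ T) = bdry S ∆ bdry T := by
  rw [← bdry_symmDiff]; congr 1; exact h.symmDiff_eq_sup.symm

theorem bdry_sdiff {S T : Finset (Finset V)} (h : T ⊆ S) :
    bdry (S \ T) = bdry S ∆ bdry T := by
  rw [← bdry_symmDiff, symmDiff_of_ge h]

theorem bdry_subset_edgeSet (T : Finset (Finset V)) : bdry T ⊆ (sides T).edgeSet := by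
  rintro ⟨x, y⟩ h
  obtain ⟨t, ht, hx, hy⟩ := pairDegree_pos.1 (mem_bdry.1 h).2.pos
  exact sides_adj_of_mem ht hx hy (mem_bdry.1 h).1

theorem bdry_finite (T : Finset (Finset V)) : (bdry T).Finite :=
  (finite_sides T).subset (bdry_subset_edgeSet T)

theorem ncard_symmDiff_add {α : Type*} {s t : Set α} (hs : s.Finite) (ht : t.Finite) :
    (s ∆ t).ncard + 2 * (s ∩ t).ncard = s.ncard + t.ncard := by
  have h1 : (s ∆ t).ncard = (s \ t).ncard + (t \ s).ncard :=
    Set.ncard_union_eq disjoint_sdiff_sdiff (hs.subset Set.sdiff_subset)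
      (ht.subset Set.sdiff_subset)
  have h2 := Set.ncard_inter_add_ncard_sdiff_eq_ncard s t hs
  have h3 := Set.ncard_inter_add_ncard_sdiff_eq_ncard t s ht
  rw [Set.inter_comm] at h3
  omega

theorem symmDiff_of_disjoint_curves {a b : Set (Sym2 V)}
    (h : ∀ x ∈ curveVerts a, x ∉ curveVerts b) : a ∆ b = a ∪ b := by
  have : Disjoint a b := by
    rw [Set.disjoint_left]
    rintro ⟨x, y⟩ h1 h2
    exact h x ⟨y, h1⟩ ⟨y, h2⟩
  exact this.symmDiff_eq_sup

theorem curveVerts_union {a b : Set (Sym2 V)} {x : V} :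
    x ∈ curveVerts (a ∪ b) ↔ x ∈ curveVerts a ∨ x ∈ curveVerts b := by
  constructor
  · rintro ⟨y, h | h⟩
    exacts [Or.inl ⟨y, h⟩, Or.inr ⟨y, h⟩]
  · rintro (⟨y, h⟩ | ⟨y, h⟩)
    exacts [⟨y, Or.inl h⟩, ⟨y, Or.inr h⟩]

theorem curveVerts_symmDiff {a b : Set (Sym2 V)} {x : V} (h : x ∈ curveVerts (a ∆ b)) :
    x ∈ curveVerts a ∨ x ∈ curveVerts b := by
  obtain ⟨y, h | h⟩ := h
  exacts [Or.inl ⟨y, h.1⟩, Or.inr ⟨y, h.1⟩]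

/-- A boundary inside the union of two disjoint curves contains the first or is contained in the
second. -/
theorem IsCurve.subset_bdry_or {a b : Set (Sym2 V)} (ha : IsCurve a)
    (hab : ∀ x ∈ curveVerts a, x ∉ curveVerts b) {U : Finset (Finset V)} (hU : K.IsPatch U)
    (h : bdry U ⊆ a ∪ b) : a ⊆ bdry U ∨ bdry U ⊆ b := by
  by_cases hn : ∃ e ∈ a, e ∈ bdry U
  · obtain ⟨e, he, heU⟩ := hn
    refine Or.inl (ha.subset_bdry hU (fun x hx y hxy => ?_) he heU)
    exact (h hxy).resolve_right fun hb => hab x hx ⟨y, hb⟩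
  · push Not at hn
    exact Or.inr fun e he => (h he).resolve_left fun ha => hn e ha he

/-- At the vertex `x`, the patch `T` contains all the triangles of `K`. -/
def IsFullAt (K : PreAbstractSimplicialComplex V) (T : Finset (Finset V)) (x : V) : Prop :=
  ∀ t ∈ K.faces, t.card = 3 → x ∈ t → t ∈ T

theorem IsSimpleClosedCurve.subset_edgeSet {γ : Set (Sym2 V)} (h : K.IsSimpleClosedCurve γ) :
    γ ⊆ K.oneSkeleton.edgeSet := by
  obtain ⟨l, a, w, -, -, rfl⟩ := h
  exact fun e he => w.edges_subset_edgeSet he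

namespace IsSurface

variable (hK : K.IsSurface)
include hK

theorem isFullAt {T : Finset (Finset V)} (hT : K.IsPatch T) {x : V} (hx : x ∉ curveVerts (bdry T))
    (hxT : x ∈ verts T) : K.IsFullAt T x := by
  obtain ⟨t, ht, hxt⟩ := mem_verts.1 hxT
  exact fun t' ht' hc hx' => hK.mem_of_vertex hT (fun y hy => hx ⟨y, hy⟩) ht hxt ht' hc hx'

theorem exists_triangle {x y : V} (h : K.oneSkeleton.Adj x y) :
    ∃ t ∈ K.faces, t.card = 3 ∧ x ∈ t ∧ y ∈ t := by
  obtain ⟨t, ht, hs, hc⟩ := hK.pure _ h.2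
  exact ⟨t, ht, hc, hs (by simp), hs (by simp)⟩

/-- Along a curve that avoids its boundary, a patch contains all the triangles or none. -/
theorem isFullAt_of_curve {γ : Set (Sym2 V)} (hγ : K.IsSimpleClosedCurve γ) {T : Finset (Finset V)}
    (hT : K.IsPatch T) (hd : ∀ x ∈ curveVerts γ, x ∉ curveVerts (bdry T)) {x : V}
    (hx : x ∈ curveVerts γ) (hxT : x ∈ verts T) : ∀ y ∈ curveVerts γ, K.IsFullAt T y := by
  intro y hy
  refine hK.isFullAt hT (hd y hy) ?_
  refine hγ.isCurve.conn {z | z ∈ verts T} (fun u v huv hu => ?_) x hx y hy hxT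
  obtain ⟨t, ht, hc, hut, hvt⟩ := hK.exists_triangle (hγ.subset_edgeSet huv)
  exact mem_verts.2 ⟨t, hK.isFullAt hT (hd u ⟨v, huv⟩) hu t ht hc hut, hvt⟩

theorem notMem_verts_of_curve {γ : Set (Sym2 V)} (hγ : K.IsSimpleClosedCurve γ)
    {T : Finset (Finset V)} (hT : K.IsPatch T) (hd : ∀ x ∈ curveVerts γ, x ∉ curveVerts (bdry T))
    {x : V} (hx : x ∈ curveVerts γ) {t : Finset V} (ht : t ∈ K.faces) (hc : t.card = 3)
    (hxt : x ∈ t) (htT : t ∉ T) : ∀ y ∈ curveVerts γ, y ∉ verts T :=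
  fun _ hy hyT => htT (hK.isFullAt_of_curve hγ hT hd hy hyT x hx t ht hc hxt)

/-- Disjoint patches have only boundary vertices in common. -/
theorem mem_curveVerts_of_mem_verts {S T : Finset (Finset V)} (hS : K.IsPatch S) (hT : K.IsPatch T)
    (hd : Disjoint S T) {x : V} (hxS : x ∈ verts S) (hxT : x ∈ verts T) :
    x ∈ curveVerts (bdry S) := by
  by_contra h
  obtain ⟨t, ht, hxt⟩ := mem_verts.1 hxT
  exact Finset.disjoint_left.1 hd (hK.isFullAt hS h hxS t (hT t ht).1 (hT t ht).2 hxt) ht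

theorem chi_union {S T : Finset (Finset V)} (hS : K.IsPatch S) (hT : K.IsPatch T)
    (hd : Disjoint S T) :
    chi (S ∪ T) = chi S + chi T - (verts S ∩ verts T).card + (bdry S ∩ bdry T).ncard := by
  have h1 := hK.two_mul_chi hS
  have h2 := hK.two_mul_chi hT
  have h3 := hK.two_mul_chi (hS.union hT)
  have h4 := ncard_symmDiff_add (bdry_finite S) (bdry_finite T)
  rw [bdry_union hd, Finset.card_union_of_disjoint hd] at h3
  have h5 : verts (S ∪ T) = verts S ∪ verts T := by
    ext x; simp only [mem_verts, Finset.mem_union, or_and_right, exists_or]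
  have h6 := Finset.card_union_add_card_inter (verts S) (verts T)
  rw [h5] at h3
  push_cast [← @Nat.cast_inj ℤ] at h4 h6 h3
  linarith

theorem chi_union_of_disjoint {S T : Finset (Finset V)} (hS : K.IsPatch S) (hT : K.IsPatch T)
    (hd : Disjoint S T) (h : ∀ x ∈ verts S, x ∉ verts T) : chi (S ∪ T) = chi S + chi T := by
  have h1 : verts S ∩ verts T = ∅ := Finset.disjoint_iff_inter_eq_empty.1
    (Finset.disjoint_left.2 h)
  have h2 : bdry S ∩ bdry T = ∅ := by
    rw [Set.eq_empty_iff_forall_notMem]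
    rintro ⟨x, y⟩ ⟨h1, h2⟩
    exact h x (mem_verts_of_mem_bdry h1 (Sym2.mem_mk_left _ _))
      (mem_verts_of_mem_bdry h2 (Sym2.mem_mk_left _ _))
  rw [hK.chi_union hS hT hd, h1, h2]
  simp

/-- The Euler characteristic is additive if two patches are glued along a closed curve. -/
theorem chi_union_of_curve {S T : Finset (Finset V)} (hS : K.IsPatch S) (hT : K.IsPatch T)
    (hd : Disjoint S T) (hγ : IsCurve (bdry S)) (h : bdry S ⊆ bdry T) :
    chi (S ∪ T) = chi S + chi T := by
  have h1 : ((verts S ∩ verts T : Finset V) : Set V) = curveVerts (bdry S) := by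
    ext x
    rw [Finset.mem_coe, Finset.mem_inter]
    constructor
    · exact fun h => hK.mem_curveVerts_of_mem_verts hS hT hd h.1 h.2
    · rintro ⟨y, hy⟩
      exact ⟨mem_verts_of_mem_bdry hy (Sym2.mem_mk_left _ _),
        mem_verts_of_mem_bdry (h hy) (Sym2.mem_mk_left _ _)⟩
  have h2 := hγ.card
  rw [← h1, Set.ncard_coe_finset] at h2
  rw [hK.chi_union hS hT hd, Set.inter_eq_left.2 h, h2]
  ring

/-- Two patches are disjoint if they are disjoint near their boundaries. -/
theorem inter_eq_empty (hconn : K.IsConnected) {A B : Finset (Finset V)} (hA : K.IsPatch A)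
    (hB : K.IsPatch B) (hne : (bdry A).Nonempty)
    (h : ∀ x, x ∈ curveVerts (bdry A) ∨ x ∈ curveVerts (bdry B) → x ∉ verts (A ∩ B)) :
    Disjoint A B := by
  rw [Finset.disjoint_iff_inter_eq_empty]
  by_contra hcon
  refine (hK.bdry_nonempty_of_subset hconn hA hne (Finset.inter_subset_left (s₂ := B))
    (Finset.nonempty_iff_ne_empty.2 hcon)).ne_empty (bdry_eq_empty_of_local fun x => ?_)
  by_cases hx : x ∈ verts (A ∩ B)
  · have h1 := mt (h x) (not_not.2 hx)
    rw [not_or] at h1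
    have hfull := hK.isFullAt hA h1.1 (verts_mono Finset.inter_subset_left hx)
    refine ⟨B, fun t hxt => ?_, h1.2⟩
    rw [Finset.mem_inter]
    exact ⟨fun h => h.2, fun h => ⟨hfull t (hB t h).1 (hB t h).2 hxt, h⟩⟩
  · refine ⟨∅, fun t hxt => ⟨fun ht => (hx (mem_verts.2 ⟨t, ht, hxt⟩)).elim, by simp⟩, ?_⟩
    rw [bdry_empty]; rintro ⟨y, ⟨⟩⟩

/-- A patch is contained in another one if this is so near their boundaries. -/
theorem subset_of_near (hconn : K.IsConnected) {A B : Finset (Finset V)} (hA : K.IsPatch A)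
    (hB : K.IsPatch B) (hne : (bdry A).Nonempty)
    (h : ∀ x, x ∈ curveVerts (bdry A) ∨ x ∈ curveVerts (bdry B) → x ∉ verts (A \ B)) :
    A ⊆ B := by
  rw [← Finset.sdiff_eq_empty_iff_subset]
  by_contra hcon
  refine (hK.bdry_nonempty_of_subset hconn hA hne (Finset.sdiff_subset (t := B))
    (Finset.nonempty_iff_ne_empty.2 hcon)).ne_empty (bdry_eq_empty_of_local fun x => ?_)
  by_cases hx : x ∈ verts (A \ B)
  · have h1 := mt (h x) (not_not.2 hx)
    rw [not_or] at h1
    refine ⟨A, fun t hxt => ?_, h1.1⟩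
    rw [Finset.mem_sdiff]
    refine ⟨fun h => h.1, fun ht => ⟨ht, fun htB => ?_⟩⟩
    obtain ⟨t', ht', hxt'⟩ := mem_verts.1 hx
    rw [Finset.mem_sdiff] at ht'
    exact ht'.2 (hK.isFullAt hB h1.2 (mem_verts.2 ⟨t, htB, hxt⟩) t' (hA t' ht'.1).1
      (hA t' ht'.1).2 hxt')
  · refine ⟨∅, fun t hxt => ⟨fun ht => (hx (mem_verts.2 ⟨t, ht, hxt⟩)).elim, by simp⟩, ?_⟩
    rw [bdry_empty]; rintro ⟨y, ⟨⟩⟩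

/-- A patch bounded by a single curve has Euler characteristic at most one. -/
theorem chi_le_one_of_curve (hconn : K.IsConnected) {T : Finset (Finset V)} (hT : K.IsPatch T)
    (hγ : IsCurve (bdry T)) : chi T ≤ 1 := by
  refine hK.chi_le_one hT (hK.isLinked hconn hT hγ) ?_
    fun S hS hSne => hK.bdry_nonempty_of_subset hconn hT hγ.nonempty hS hSne
  rw [Finset.nonempty_iff_ne_empty]
  rintro rfl
  exact hγ.nonempty.ne_empty bdry_empty

theorem nonempty_of_bdry {T : Finset (Finset V)} (h : (bdry T).Nonempty) : T.Nonempty := by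
  rw [Finset.nonempty_iff_ne_empty]
  rintro rfl
  exact h.ne_empty bdry_empty

/-- A curve in the interior of a disk bounds a disk, and the rest of the disk is an annulus. -/
theorem exists_inner_disk (hconn : K.IsConnected) {a b : Set (Sym2 V)} (ha : IsCurve a)
    (hb : K.IsSimpleClosedCurve b) (hab : ∀ x ∈ curveVerts a, x ∉ curveVerts b)
    {A : Finset (Finset V)} (hA : K.IsPatch A) (hAa : bdry A = a) (hchi : chi A = 1)
    (hbA : b ⊆ (sides A).edgeSet) :
    ∃ B ⊆ A, bdry B = b ∧ chi B = 1 ∧ chi (A \ B) = 0 := by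
  have hAb : (bdry A).Nonempty := hAa ▸ ha.nonempty
  have hbn := fun S (hS : S ⊆ A) hne => hK.bdry_nonempty_of_subset hconn hA hAb (S := S) hS hne
  -- Otherwise `b` is a closed curve that bounds nothing in the disk `A`.
  obtain ⟨S, hSA, hSne, hSb⟩ : ∃ S ⊆ A, S.Nonempty ∧ bdry S ⊆ b := by
    by_contra hcon
    push Not at hcon
    have := hK.chi_le_zero hA (hK.isLinked hconn hA (hAa ▸ ha)) (hK.nonempty_of_bdry hAb) hb hbA
      hcon
    omega
  have hS := hA.mono hSA
  have hSb := hb.isCurve.bdry_eq_of_subset hS hSb (hbn S hSA hSne)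
  set R := A \ S with hR
  have hRA : R ⊆ A := Finset.sdiff_subset
  have hRp := hA.mono hRA
  have hRb : bdry R = a ∪ b := by
    rw [hR, bdry_sdiff hSA, hAa, hSb, symmDiff_of_disjoint_curves hab]
  have hadd : chi A = chi S + chi R := by
    rw [← hK.chi_union_of_curve hS hRp Finset.disjoint_sdiff (hSb ▸ hb.isCurve)
      (by rw [hSb, hRb]; exact Set.subset_union_right), hR, Finset.union_sdiff_of_subset hSA]
  -- A second part of `A` bounded by `b` would form a closed surface with `S`.
  have hno : ∀ S' ⊆ R, S'.Nonempty → ¬ bdry S' ⊆ b := by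
    intro S' hS' hne hsub
    have h1 := hb.isCurve.bdry_eq_of_subset (hRp.mono hS') hsub (hbn S' (hS'.trans hRA) hne)
    have hd : Disjoint S S' := Finset.disjoint_of_subset_right hS' Finset.disjoint_sdiff
    refine (hbn (S ∪ S') (Finset.union_subset hSA (hS'.trans hRA))
      (hSne.mono Finset.subset_union_left)).ne_empty ?_
    rw [bdry_union hd, hSb, h1, symmDiff_self]; rfl
  have hlR : IsLinked R := by
    intro S₁ h₁ hne₁ hne₂
    by_contra hcon
    push Not at hcon
    have e₁ := (ha.subset_bdry_or hab (hRp.mono h₁) (hRb ▸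
      bdry_subset_of_no_common_vertex h₁ hcon)).resolve_right (hno S₁ h₁ hne₁)
    have e₂ := (ha.subset_bdry_or hab (hRp.mono Finset.sdiff_subset) (hRb ▸
      bdry_subset_of_no_common_vertex (S := R \ S₁) Finset.sdiff_subset (fun x hx hx' => by
        rw [Finset.sdiff_sdiff_eq_self h₁] at hx'
        exact hcon x hx' hx))).resolve_right (hno _ Finset.sdiff_subset hne₂)
    obtain ⟨⟨x, y⟩, he⟩ := ha.nonempty
    exact hcon x (mem_verts_of_mem_bdry (e₁ he) (Sym2.mem_mk_left _ _))
      (mem_verts_of_mem_bdry (e₂ he) (Sym2.mem_mk_left _ _))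
  -- As `chi S ≤ 1` and `chi R ≤ 0` add up to one, both are equalities.
  have hR0 : chi R ≤ 0 := by
    refine hK.chi_le_zero hRp hlR (hK.nonempty_of_bdry ?_) hb ?_ hno
    · rw [hRb]; exact ha.nonempty.mono Set.subset_union_left
    · exact Set.subset_union_right.trans (hRb ▸ bdry_subset_edgeSet R)
  have hS1 := hK.chi_le_one_of_curve hconn hS (hSb ▸ hb.isCurve)
  exact ⟨S, hSA, hSb, by omega, by change chi R = 0; omega⟩

/-- A surface of Euler characteristic two with two boundary curves consists of two disks. -/
theorem exists_disks_of_chi_eq_two (hconn : K.IsConnected) {a b : Set (Sym2 V)} (ha : IsCurve a)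
    (hb : IsCurve b) (hab : ∀ x ∈ curveVerts a, x ∉ curveVerts b) {S : Finset (Finset V)}
    (hS : K.IsPatch S) (hSb : bdry S = a ∪ b) (hchi : chi S = 2) :
    (∃ A, K.IsPatch A ∧ bdry A = a ∧ chi A = 1) ∧ ∃ B, K.IsPatch B ∧ bdry B = b ∧ chi B = 1 := by
  have hne : (bdry S).Nonempty := by rw [hSb]; exact ha.nonempty.mono Set.subset_union_left
  have hbn := fun S' (hS' : S' ⊆ S) hne' =>
    hK.bdry_nonempty_of_subset hconn hS hne (S := S') hS' hne'
  have hl : ¬ IsLinked S := fun hl => by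
    have := hK.chi_le_one hS hl (hK.nonempty_of_bdry hne) hbn
    omega
  unfold IsLinked at hl
  push Not at hl
  obtain ⟨S₁, h₁, hne₁, hne₂, hcon⟩ := hl
  have hcon' : ∀ x ∈ verts (S \ S₁), x ∉ verts S₁ := fun x hx hx' => hcon x hx' hx
  have b₁ : bdry S₁ ⊆ a ∪ b := hSb ▸ bdry_subset_of_no_common_vertex h₁ hcon
  have b₂ : bdry (S \ S₁) ⊆ a ∪ b := hSb ▸ bdry_subset_of_no_common_vertex Finset.sdiff_subset
    (fun x hx hx' => by
      rw [Finset.sdiff_sdiff_eq_self h₁] at hx'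
      exact hcon x hx' hx)
  have hba : ∀ x ∈ curveVerts b, x ∉ curveVerts a := fun x hx hx' => hab x hx' hx
  have p₂ : K.IsPatch (S \ S₁) := hS.mono Finset.sdiff_subset
  -- The surface is not connected, for otherwise `chi S ≤ 1`. Each of the two parts has one boundary
  -- curve, so that its Euler characteristic is at most one.
  have key : ∀ {U W : Finset (Finset V)}, K.IsPatch U → K.IsPatch W → bdry U ⊆ a ∪ b →
      bdry W ⊆ a ∪ b → (bdry W).Nonempty → (bdry U).Nonempty → (∀ x ∈ verts U, x ∉ verts W) →
      Disjoint U W → chi (U ∪ W) = 2 → a ⊆ bdry U →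
      (∃ A, K.IsPatch A ∧ bdry A = a ∧ chi A = 1) ∧ ∃ B, K.IsPatch B ∧ bdry B = b ∧ chi B = 1 := by
    intro U W hU hW hUb hWb hWn hUn hUW hd hc haU
    have hWsub : bdry W ⊆ b := (ha.subset_bdry_or hab hW hWb).resolve_left fun h => by
      obtain ⟨⟨x, y⟩, he⟩ := ha.nonempty
      exact hUW x (mem_verts_of_mem_bdry (haU he) (Sym2.mem_mk_left _ _))
        (mem_verts_of_mem_bdry (h he) (Sym2.mem_mk_left _ _))
    have hWe := hb.bdry_eq_of_subset hW hWsub hWn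
    have hUsub : bdry U ⊆ a := (hb.subset_bdry_or hba hU
      (by rw [Set.union_comm]; exact hUb)).resolve_left fun h => by
      obtain ⟨⟨x, y⟩, he⟩ := hb.nonempty
      exact hUW x (mem_verts_of_mem_bdry (h he) (Sym2.mem_mk_left _ _))
        (mem_verts_of_mem_bdry (hWe.symm ▸ he) (Sym2.mem_mk_left _ _))
    have hUe := hUsub.antisymm haU
    have c₁ := hK.chi_le_one_of_curve hconn hU (hUe ▸ ha)
    have c₂ := hK.chi_le_one_of_curve hconn hW (hWe ▸ hb)
    rw [hK.chi_union_of_disjoint hU hW hd hUW] at hc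
    exact ⟨⟨U, hU, hUe, by omega⟩, ⟨W, hW, hWe, by omega⟩⟩
  have hd : Disjoint S₁ (S \ S₁) := Finset.disjoint_sdiff
  have hu : S₁ ∪ S \ S₁ = S := Finset.union_sdiff_of_subset h₁
  rcases ha.subset_bdry_or hab (hS.mono h₁) b₁ with h | h
  · exact key (hS.mono h₁) p₂ b₁ b₂ (hbn _ Finset.sdiff_subset hne₂) (hbn _ h₁ hne₁) hcon hd
      (by rw [hu, hchi]) h
  · refine key p₂ (hS.mono h₁) b₂ b₁ (hbn _ h₁ hne₁) (hbn _ Finset.sdiff_subset hne₂) hcon' hd.symm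
      (by rw [Finset.union_comm, hu, hchi]) ?_
    refine (ha.subset_bdry_or hab p₂ b₂).resolve_right fun h' => ?_
    have e := hb.bdry_eq_of_subset (hS.mono h₁) h (hbn _ h₁ hne₁)
    have e' := hb.bdry_eq_of_subset p₂ h' (hbn _ Finset.sdiff_subset hne₂)
    obtain ⟨⟨x, y⟩, he⟩ := hb.nonempty
    exact hcon x (mem_verts_of_mem_bdry (e.symm ▸ he) (Sym2.mem_mk_left _ _))
      (mem_verts_of_mem_bdry (e'.symm ▸ he) (Sym2.mem_mk_left _ _))

end IsSurface

end PreAbstractSimplicialComplex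

namespace PreAbstractSimplicialComplex

variable {V : Type*} [DecidableEq V] {K : PreAbstractSimplicialComplex V}

open scoped symmDiff

/-! ### The square around a crossing -/

/-- The four triangles of a square with center `o` and corners `p`, `q`, `r`, `s`. -/
def star4 (o p q r s : V) : Finset (Finset V) := {{o, p, q}, {o, q, r}, {o, r, s}, {o, s, p}}

/-- The four sides of a square. -/
def sides4 (p q r s : V) : Set (Sym2 V) := {s(p, q), s(q, r), s(r, s), s(s, p)}

/-- A square in `K`, divided into four triangles by its diagonals. -/
structure IsSquare (K : PreAbstractSimplicialComplex V) (o p q r s : V) : Prop where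
  nodup : [o, p, q, r, s].Nodup
  face₁ : ({o, p, q} : Finset V) ∈ K.faces
  face₂ : ({o, q, r} : Finset V) ∈ K.faces
  face₃ : ({o, r, s} : Finset V) ∈ K.faces
  face₄ : ({o, s, p} : Finset V) ∈ K.faces

theorem star4_rotate (o p q r s : V) : star4 o q r s p = star4 o p q r s := by
  ext t; simp only [star4, Finset.mem_insert, Finset.mem_singleton]; tauto

theorem sides4_rotate (p q r s : V) : sides4 q r s p = sides4 p q r s := by
  ext e; simp only [sides4, Set.mem_insert_iff, Set.mem_singleton_iff]; tauto

namespace IsSquare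

variable {o p q r s : V}

theorem rotate (h : K.IsSquare o p q r s) : K.IsSquare o q r s p where
  nodup := by have := h.nodup; simp only [List.nodup_cons, List.mem_cons] at this ⊢; grind
  face₁ := h.face₂
  face₂ := h.face₃
  face₃ := h.face₄
  face₄ := h.face₁

theorem ne (h : K.IsSquare o p q r s) : o ≠ p ∧ o ≠ q ∧ o ≠ r ∧ o ≠ s ∧ p ≠ q ∧ p ≠ r ∧ p ≠ s ∧
    q ≠ r ∧ q ≠ s ∧ r ≠ s := by
  have := h.nodup
  simp only [List.nodup_cons, List.mem_cons, List.not_mem_nil, or_false, not_or] at this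
  tauto

theorem isPatch (h : K.IsSquare o p q r s) : K.IsPatch (star4 o p q r s) := by
  obtain ⟨h1, h2, h3, h4, h5, h6, h7, h8, h9, h10⟩ := h.ne
  intro t ht
  simp only [star4, Finset.mem_insert, Finset.mem_singleton] at ht
  rcases ht with rfl | rfl | rfl | rfl
  · exact ⟨h.face₁, Finset.card_eq_three.2 ⟨o, p, q, h1, h2, h5, rfl⟩⟩
  · exact ⟨h.face₂, Finset.card_eq_three.2 ⟨o, q, r, h2, h3, h8, rfl⟩⟩
  · exact ⟨h.face₃, Finset.card_eq_three.2 ⟨o, r, s, h3, h4, h10, rfl⟩⟩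
  · exact ⟨h.face₄, Finset.card_eq_three.2 ⟨o, s, p, h4, h1, h7.symm, rfl⟩⟩

theorem notMem (h : K.IsSquare o p q r s) : ({o, p, q} : Finset V) ≠ {o, q, r} ∧
    ({o, p, q} : Finset V) ≠ {o, r, s} ∧ ({o, p, q} : Finset V) ≠ {o, s, p} ∧
    ({o, q, r} : Finset V) ≠ {o, r, s} ∧ ({o, q, r} : Finset V) ≠ {o, s, p} ∧
    ({o, r, s} : Finset V) ≠ {o, s, p} := by
  obtain ⟨h1, h2, h3, h4, h5, h6, h7, h8, h9, h10⟩ := h.ne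
  simp only [ne_eq, Finset.ext_iff, Finset.mem_insert, Finset.mem_singleton, not_forall]
  refine ⟨⟨p, ?_⟩, ⟨p, ?_⟩, ⟨q, ?_⟩, ⟨q, ?_⟩, ⟨q, ?_⟩, ⟨r, ?_⟩⟩ <;> grind

theorem card_star4 (h : K.IsSquare o p q r s) : (star4 o p q r s).card = 4 := by
  obtain ⟨h1, h2, h3, h4, h5, h6⟩ := h.notMem
  unfold star4
  rw [Finset.card_insert_of_notMem, Finset.card_insert_of_notMem, Finset.card_insert_of_notMem,
    Finset.card_singleton] <;> simp_all

theorem pairDegree_star4 (h : K.IsSquare o p q r s) (x y : V) :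
    pairDegree (star4 o p q r s) x y =
      (if x ∈ ({o, p, q} : Finset V) ∧ y ∈ ({o, p, q} : Finset V) then 1 else 0) +
      ((if x ∈ ({o, q, r} : Finset V) ∧ y ∈ ({o, q, r} : Finset V) then 1 else 0) +
      ((if x ∈ ({o, r, s} : Finset V) ∧ y ∈ ({o, r, s} : Finset V) then 1 else 0) +
      (if x ∈ ({o, s, p} : Finset V) ∧ y ∈ ({o, s, p} : Finset V) then 1 else 0))) := by
  obtain ⟨h1, h2, h3, h4, h5, h6⟩ := h.notMem
  unfold pairDegree star4
  rw [Finset.card_filter, Finset.sum_insert, Finset.sum_insert, Finset.sum_insert,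
    Finset.sum_singleton] <;> simp_all

theorem bdry_star4 (h : K.IsSquare o p q r s) : bdry (star4 o p q r s) = sides4 p q r s := by
  obtain ⟨h1, h2, h3, h4, h5, h6, h7, h8, h9, h10⟩ := h.ne
  ext ⟨x, y⟩
  change s(x, y) ∈ _ ↔ s(x, y) ∈ _
  rw [mem_bdry, h.pairDegree_star4]
  simp only [sides4, Set.mem_insert_iff, Set.mem_singleton_iff, Sym2.eq_iff]
  by_cases hx : x ∈ [o, p, q, r, s]
  · by_cases hy : y ∈ [o, p, q, r, s]
    · simp only [List.mem_cons, List.not_mem_nil, or_false] at hx hy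
      rcases hx with rfl | rfl | rfl | rfl | rfl <;> rcases hy with rfl | rfl | rfl | rfl | rfl <;>
        simp [h1, h2, h3, h4, h5, h6, h7, h8, h9, h10, h1.symm, h2.symm, h3.symm, h4.symm, h5.symm,
          h6.symm, h7.symm, h8.symm, h9.symm, h10.symm]
    · simp only [List.mem_cons, List.not_mem_nil, or_false, not_or] at hy
      simp [hy]
  · simp only [List.mem_cons, List.not_mem_nil, or_false, not_or] at hx
    simp [hx]

theorem verts_star4 : verts (star4 o p q r s) = {o, p, q, r, s} := by
  ext x
  simp only [mem_verts, star4, Finset.mem_insert, Finset.mem_singleton, exists_eq_or_imp,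
    exists_eq_left]
  tauto

theorem center_notMem (h : K.IsSquare o p q r s) : o ∉ curveVerts (sides4 p q r s) := by
  obtain ⟨h1, h2, h3, h4, -⟩ := h.ne
  rintro ⟨y, hy⟩
  simp only [sides4, Set.mem_insert_iff, Set.mem_singleton_iff, Sym2.eq_iff] at hy
  tauto

theorem ncard_sides4 (h : K.IsSquare o p q r s) : (sides4 p q r s).ncard = 4 := by
  obtain ⟨h1, h2, h3, h4, h5, h6, h7, h8, h9, h10⟩ := h.ne
  unfold sides4
  rw [Set.ncard_insert_of_notMem, Set.ncard_insert_of_notMem, Set.ncard_insert_of_notMem,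
    Set.ncard_singleton] <;> simp <;> tauto

theorem chi_star4 (hK : K.IsSurface) (h : K.IsSquare o p q r s) :
    chi (star4 o p q r s) = 1 := by
  have h1 := hK.two_mul_chi h.isPatch
  have h2 : ({o, p, q, r, s} : Finset V).card = 5 := by
    have := List.toFinset_card_of_nodup h.nodup
    simpa using this
  rw [verts_star4, h2, h.card_star4, h.bdry_star4, h.ncard_sides4] at h1
  push_cast at h1
  omega

/-- A patch whose boundary avoids the center of a square contains the square, or no triangle at the
center. -/
theorem notMem_center (hK : K.IsSurface) (h : K.IsSquare o p q r s) {T : Finset (Finset V)}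
    (hT : K.IsPatch T) (ho : o ∉ curveVerts (bdry T)) {t : Finset V} (ht : t ∈ star4 o p q r s)
    (htT : t ∉ T) : o ∉ verts T := by
  intro hoT
  refine htT (hK.isFullAt hT ho hoT t (h.isPatch t ht).1 (h.isPatch t ht).2 ?_)
  simp only [star4, Finset.mem_insert, Finset.mem_singleton] at ht
  rcases ht with rfl | rfl | rfl | rfl <;> simp

theorem subset_of_mem (hK : K.IsSurface) (h : K.IsSquare o p q r s) {T : Finset (Finset V)}
    (hT : K.IsPatch T) (ho : o ∉ curveVerts (bdry T)) {t : Finset V} (ht : t ∈ star4 o p q r s)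
    (htT : t ∈ T) : star4 o p q r s ⊆ T := by
  intro t' ht'
  by_contra hn
  refine h.notMem_center hK hT ho ht' hn (mem_verts.2 ⟨t, htT, ?_⟩)
  simp only [star4, Finset.mem_insert, Finset.mem_singleton] at ht
  rcases ht with rfl | rfl | rfl | rfl <;> simp

theorem disjoint_of_center {T : Finset (Finset V)} (ho : o ∉ verts T) :
    Disjoint T (star4 o p q r s) := by
  rw [Finset.disjoint_left]
  intro t htT ht
  refine ho (mem_verts.2 ⟨t, htT, ?_⟩)
  simp only [star4, Finset.mem_insert, Finset.mem_singleton] at ht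
  rcases ht with rfl | rfl | rfl | rfl <;> simp

/-- Gluing a square along two opposite sides is the same as adding a band. -/
theorem chi_union_star4 (hK : K.IsSurface) (h : K.IsSquare o p q r s) {T : Finset (Finset V)}
    (hT : K.IsPatch T) (ho : o ∉ verts T) (h₁ : s(p, q) ∈ bdry T) (h₂ : s(r, s) ∈ bdry T)
    (h₃ : s(q, r) ∉ bdry T) (h₄ : s(s, p) ∉ bdry T) :
    chi (T ∪ star4 o p q r s) = chi T - 1 := by
  have e1 : verts T ∩ {o, p, q, r, s} = {p, q, r, s} := by
    ext x
    simp only [Finset.mem_inter, Finset.mem_insert, Finset.mem_singleton]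
    constructor
    · rintro ⟨hx, rfl | h⟩
      exacts [absurd hx ho, h]
    · intro hx
      refine ⟨?_, Or.inr hx⟩
      rcases hx with rfl | rfl | rfl | rfl
      exacts [mem_verts_of_mem_bdry h₁ (by simp), mem_verts_of_mem_bdry h₁ (by simp),
        mem_verts_of_mem_bdry h₂ (by simp), mem_verts_of_mem_bdry h₂ (by simp)]
  have e2 : ({p, q, r, s} : Finset V).card = 4 := by
    have := List.toFinset_card_of_nodup (List.nodup_cons.1 h.nodup).2
    simpa using this
  obtain ⟨-, -, -, -, h5, h6, h7, h8, h9, h10⟩ := h.ne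
  have e3 : bdry T ∩ sides4 p q r s = {s(p, q), s(r, s)} := by
    ext e
    simp only [sides4, Set.mem_inter_iff, Set.mem_insert_iff, Set.mem_singleton_iff]
    constructor
    · rintro ⟨he, rfl | rfl | rfl | rfl⟩
      exacts [Or.inl rfl, absurd he h₃, Or.inr rfl, absurd he h₄]
    · rintro (rfl | rfl)
      exacts [⟨h₁, Or.inl rfl⟩, ⟨h₂, by simp⟩]
  have e4 : ({s(p, q), s(r, s)} : Set (Sym2 V)).ncard = 2 := by
    refine Set.ncard_pair ?_
    simp; tauto
  rw [hK.chi_union hT h.isPatch (disjoint_of_center ho), h.chi_star4 hK, verts_star4, h.bdry_star4,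
    e1, e2, e3, e4]
  push_cast; ring

/-- Removing a square which meets the boundary in two opposite sides cuts a band. -/
theorem chi_sdiff_star4 (hK : K.IsSurface) (h : K.IsSquare o p q r s) {T : Finset (Finset V)}
    (hT : K.IsPatch T) (hsub : star4 o p q r s ⊆ T) (ho : o ∉ curveVerts (bdry T))
    (h₁ : s(p, q) ∈ bdry T) (h₂ : s(r, s) ∈ bdry T)
    (h₃ : s(q, r) ∉ bdry T) (h₄ : s(s, p) ∉ bdry T) :
    chi (T \ star4 o p q r s) = chi T + 1 := by
  have hb : bdry (T \ star4 o p q r s) = bdry T ∆ sides4 p q r s := by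
    rw [bdry_sdiff hsub, h.bdry_star4]
  have hp : K.IsPatch (T \ star4 o p q r s) := hT.mono Finset.sdiff_subset
  have m1 : ({o, p, q} : Finset V) ∈ star4 o p q r s := by simp [star4]
  have ho' : o ∉ verts (T \ star4 o p q r s) := by
    refine h.notMem_center hK hp (fun hc => ?_) m1 (by simp [m1])
    rw [hb] at hc
    rcases curveVerts_symmDiff hc with hc | hc
    exacts [ho hc, h.center_notMem hc]
  have := h.rotate.chi_union_star4 hK hp ho' (by rw [hb]; exact Or.inr ⟨by simp [sides4], h₃⟩)
    (by rw [hb]; exact Or.inr ⟨by simp [sides4], h₄⟩)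
    (by rw [hb]; rintro (h | h); exacts [h.2 (by simp [sides4]), h.2 h₂])
    (by rw [hb]; rintro (h | h); exacts [h.2 (by simp [sides4]), h.2 h₁])
  rw [star4_rotate o p q r s, Finset.sdiff_union_of_subset hsub] at this
  omega

end IsSquare

end PreAbstractSimplicialComplex

namespace PreAbstractSimplicialComplex

variable {V : Type*} [DecidableEq V] {K : PreAbstractSimplicialComplex V}

open scoped symmDiff

/-! ### Curves that differ by a square -/

/-- The curve `γ` bounds a patch of Euler characteristic `k`. -/
def Fills (K : PreAbstractSimplicialComplex V) (γ : Set (Sym2 V)) (k : ℤ) : Prop :=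
  ∃ T, K.IsPatch T ∧ bdry T = γ ∧ chi T = k

/-- The disjoint curves `a` and `b` run along two opposite sides of a square, and `c` is obtained
from them by replacing these sides by the other two. -/
structure IsFusion (K : PreAbstractSimplicialComplex V) (o p q r s : V) (a b c : Set (Sym2 V)) :
    Prop where
  square : K.IsSquare o p q r s
  left : K.IsSimpleClosedCurve a
  right : K.IsSimpleClosedCurve b
  total : K.IsSimpleClosedCurve c
  disjoint : ∀ x ∈ curveVerts a, x ∉ curveVerts b
  center_left : o ∉ curveVerts a
  center_right : o ∉ curveVerts b
  mem_left : s(p, q) ∈ a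
  mem_right : s(r, s) ∈ b
  eq : c = (a ∪ b) ∆ sides4 p q r s

/-- The curve `x` runs along two opposite sides of a square, and `y` is obtained from it by
replacing these sides by the other two. -/
structure IsTwist (K : PreAbstractSimplicialComplex V) (o p q r s : V) (x y : Set (Sym2 V)) :
    Prop where
  square : K.IsSquare o p q r s
  left : K.IsSimpleClosedCurve x
  right : K.IsSimpleClosedCurve y
  center : o ∉ curveVerts x
  mem₁ : s(p, q) ∈ x
  mem₂ : s(r, s) ∈ x
  notMem₁ : s(q, r) ∉ x
  notMem₂ : s(s, p) ∉ x
  eq : y = x ∆ sides4 p q r s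

namespace IsFusion

variable {o p q r s : V} {a b c : Set (Sym2 V)}

theorem symm (h : K.IsFusion o p q r s a b c) : K.IsFusion o r s p q b a c where
  square := h.square.rotate.rotate
  left := h.right
  right := h.left
  total := h.total
  disjoint := fun x hx hx' => h.disjoint x hx' hx
  center_left := h.center_right
  center_right := h.center_left
  mem_left := h.mem_right
  mem_right := h.mem_left
  eq := by rw [h.eq, Set.union_comm, sides4_rotate q r s p, sides4_rotate p q r s]

theorem union_eq (h : K.IsFusion o p q r s a b c) : a ∪ b = a ∆ b :=
  (symmDiff_of_disjoint_curves h.disjoint).symm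

theorem notMem₁ (h : K.IsFusion o p q r s a b c) : s(q, r) ∉ a ∪ b := by
  rintro (hc | hc)
  · exact h.disjoint r (IsCurve.right_mem_curveVerts hc) ⟨s, h.mem_right⟩
  · exact h.disjoint q (IsCurve.right_mem_curveVerts h.mem_left) ⟨r, hc⟩

theorem notMem₂ (h : K.IsFusion o p q r s a b c) : s(s, p) ∉ a ∪ b := by
  rintro (hc | hc)
  · exact h.disjoint s ⟨p, hc⟩ (IsCurve.right_mem_curveVerts h.mem_right)
  · exact h.disjoint p ⟨q, h.mem_left⟩ (IsCurve.right_mem_curveVerts hc)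

theorem mem_total (h : K.IsFusion o p q r s a b c) : s(q, r) ∈ c ∧ s(s, p) ∈ c ∧ s(p, q) ∉ c ∧
    s(r, s) ∉ c := by
  rw [h.eq]
  refine ⟨Or.inr ⟨by simp [sides4], h.notMem₁⟩, Or.inr ⟨by simp [sides4], h.notMem₂⟩, ?_, ?_⟩
  · rintro (hc | hc)
    exacts [hc.2 (by simp [sides4]), hc.2 (Or.inl h.mem_left)]
  · rintro (hc | hc)
    exacts [hc.2 (by simp [sides4]), hc.2 (Or.inr h.mem_right)]

theorem center_union (h : K.IsFusion o p q r s a b c) : o ∉ curveVerts (a ∪ b) := by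
  rw [curveVerts_union]
  rintro (hc | hc)
  exacts [h.center_left hc, h.center_right hc]

theorem center_total (h : K.IsFusion o p q r s a b c) : o ∉ curveVerts c := by
  rw [h.eq]
  intro hc
  rcases curveVerts_symmDiff hc with hc | hc
  exacts [h.center_union hc, h.square.center_notMem hc]

theorem mem₁ : ({o, p, q} : Finset V) ∈ star4 o p q r s := by simp [star4]

theorem mem₂ : ({o, r, s} : Finset V) ∈ star4 o p q r s := by simp [star4]

variable (hK : K.IsSurface) (hconn : K.IsConnected)
include hK

/-- Removing the square from a patch bounded by `a` and `b`. -/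
theorem chi_sdiff (h : K.IsFusion o p q r s a b c) {S : Finset (Finset V)} (hS : K.IsPatch S)
    (hb : bdry S = a ∪ b) (hsub : star4 o p q r s ⊆ S) :
    chi (S \ star4 o p q r s) = chi S + 1 :=
  h.square.chi_sdiff_star4 hK hS hsub (by rw [hb]; exact h.center_union)
    (by rw [hb]; exact Or.inl h.mem_left) (by rw [hb]; exact Or.inr h.mem_right)
    (by rw [hb]; exact h.notMem₁) (by rw [hb]; exact h.notMem₂)

/-- Adding the square to a patch bounded by `a` and `b`. -/
theorem chi_union (h : K.IsFusion o p q r s a b c) {S : Finset (Finset V)} (hS : K.IsPatch S)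
    (hb : bdry S = a ∪ b) (ho : o ∉ verts S) :
    chi (S ∪ star4 o p q r s) = chi S - 1 :=
  h.square.chi_union_star4 hK hS ho
    (by rw [hb]; exact Or.inl h.mem_left) (by rw [hb]; exact Or.inr h.mem_right)
    (by rw [hb]; exact h.notMem₁) (by rw [hb]; exact h.notMem₂)

include hconn

/-- If `a` bounds a disk which contains the square, then `b` bounds a smaller disk, and the annulus
between `a` and `b` is cut by the square into a disk bounded by `c`. -/
theorem fills_of_mem (h : K.IsFusion o p q r s a b c) {A : Finset (Finset V)} (hA : K.IsPatch A)
    (hAa : bdry A = a) (hchi : chi A = 1) (hQ : ({o, p, q} : Finset V) ∈ A) :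
    K.Fills b 1 ∧ K.Fills c 1 := by
  have hsub := h.square.subset_of_mem hK hA (by rw [hAa]; exact h.center_left) mem₁ hQ
  have hrA : r ∈ verts A := mem_verts.2 ⟨_, hsub mem₂, by simp⟩
  have hba : ∀ x ∈ curveVerts b, x ∉ curveVerts (bdry A) := fun x hx hx' =>
    h.disjoint x (hAa ▸ hx') hx
  have hfull := hK.isFullAt_of_curve h.right hA hba ⟨s, h.mem_right⟩ hrA
  have hbs : b ⊆ (sides A).edgeSet := by
    rintro ⟨x, y⟩ hxy
    have hadj : K.oneSkeleton.Adj x y := h.right.subset_edgeSet hxy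
    obtain ⟨t, ht, hc, hx, hy⟩ := hK.exists_triangle hadj
    exact sides_adj_of_mem (hfull x ⟨y, hxy⟩ t ht hc hx) hx hy hadj.1
  obtain ⟨B, hBA, hBb, hB1, hR⟩ := hK.exists_inner_disk hconn h.left.isCurve h.right h.disjoint hA
    hAa hchi hbs
  have hB := hA.mono hBA
  have hQB : ({o, p, q} : Finset V) ∉ B := by
    -- otherwise both triangles at the boundary edge `pq` of `A` would belong to `A`
    intro hQB
    have hpb : s(p, q) ∉ bdry B := fun hc =>
      h.disjoint p ⟨q, h.mem_left⟩ (hBb ▸ ⟨q, hc⟩)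
    have hpq : p ≠ q := h.square.ne.2.2.2.2.1
    have h1 : 0 < pairDegree B p q := pairDegree_pos.2 ⟨_, hQB, by simp, by simp⟩
    have h2 : ¬ Odd (pairDegree B p q) := fun ho => hpb (mem_bdry.2 ⟨hpq, ho⟩)
    have h3 : pairDegree A p q = 1 := (hK.odd_pairDegree_iff hA hpq).1
      (mem_bdry.1 (hAa.symm ▸ h.mem_left : s(p, q) ∈ bdry A)).2
    have h4 := pairDegree_mono hBA p q
    have h5 : pairDegree B p q = 1 := by omega
    exact h2 (h5 ▸ odd_one)
  have hoB : o ∉ verts B := h.square.notMem_center hK hB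
    (by rw [hBb]; exact h.center_right) mem₁ hQB
  have hsubR : star4 o p q r s ⊆ A \ B := by
    intro t ht
    exact Finset.mem_sdiff.2 ⟨hsub ht,
      fun hc => Finset.disjoint_left.1 (IsSquare.disjoint_of_center hoB) hc ht⟩
  have hRb : bdry (A \ B) = a ∪ b := by rw [bdry_sdiff hBA, hAa, hBb, h.union_eq]
  have hRp := hA.mono (Finset.sdiff_subset (t := B))
  refine ⟨⟨B, hB, hBb, hB1⟩, (A \ B) \ star4 o p q r s, hRp.mono Finset.sdiff_subset, ?_, ?_⟩
  · rw [bdry_sdiff hsubR, hRb, h.square.bdry_star4, ← h.eq]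
  · rw [h.chi_sdiff hK hRp hRb hsubR, hR]; rfl

/-- If `a` bounds a disk `A` which does not contain the square, then `A` together with the square is
a disk that lies on one side of `b`, and adding it to a surface bounded by `b`, or removing it from
one, does not change the Euler characteristic. -/
theorem chi_of_notMem (h : K.IsFusion o p q r s a b c) {A B : Finset (Finset V)}
    (hA : K.IsPatch A) (hAa : bdry A = a) (hchi : chi A = 1) (hQ : ({o, p, q} : Finset V) ∉ A)
    (hB : K.IsPatch B) (hBb : bdry B = b) : chi (A ∆ B ∆ star4 o p q r s) = chi B := by
  have hoA : o ∉ verts A := h.square.notMem_center hK hA (by rw [hAa]; exact h.center_left) mem₁ hQ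
  have hQ' : ({o, r, s} : Finset V) ∉ A := fun hc => hoA (mem_verts.2 ⟨_, hc, by simp⟩)
  have hAne : (bdry A).Nonempty := hAa ▸ h.left.isCurve.nonempty
  have hAfar : ∀ x ∈ curveVerts b, x ∉ verts A :=
    hK.notMem_verts_of_curve h.right hA (fun x hx hx' => h.disjoint x (hAa ▸ hx') hx)
      ⟨s, h.mem_right⟩ h.square.face₃ (h.square.isPatch _ mem₂).2 (by simp) hQ'
  have hdB : ∀ x ∈ curveVerts a, x ∉ curveVerts (bdry B) := fun x hx hx' =>
    h.disjoint x hx (hBb ▸ hx')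
  by_cases hQB : ({o, p, q} : Finset V) ∈ B
  · have hsub := h.square.subset_of_mem hK hB (by rw [hBb]; exact h.center_right) mem₁ hQB
    have hfull := hK.isFullAt_of_curve h.left hB hdB ⟨q, h.mem_left⟩
      (mem_verts.2 ⟨_, hQB, by simp⟩)
    have hAB : A ⊆ B := by
      refine hK.subset_of_near hconn hA hB hAne fun x hx hx' => ?_
      rw [hAa, hBb] at hx
      obtain ⟨t, ht, hxt⟩ := mem_verts.1 hx'
      obtain ⟨htA, htB⟩ := Finset.mem_sdiff.1 ht
      rcases hx with hx | hx
      · exact htB (hfull x hx t (hA t htA).1 (hA t htA).2 hxt)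
      · exact hAfar x hx (mem_verts.2 ⟨t, htA, hxt⟩)
    have hRb : bdry (B \ A) = a ∪ b := by
      rw [bdry_sdiff hAB, hAa, hBb, symmDiff_comm, h.union_eq]
    have hRp := hB.mono (Finset.sdiff_subset (t := A))
    have hsubR : star4 o p q r s ⊆ B \ A := fun t ht => Finset.mem_sdiff.2 ⟨hsub ht,
      fun hc => Finset.disjoint_left.1 (IsSquare.disjoint_of_center hoA) hc ht⟩
    have e1 := hK.chi_union_of_curve hA hRp Finset.disjoint_sdiff (hAa ▸ h.left.isCurve)
      (by rw [hAa, hRb]; exact Set.subset_union_left)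
    rw [Finset.union_sdiff_of_subset hAB, hchi] at e1
    have e2 : A ∆ B ∆ star4 o p q r s = (B \ A) \ star4 o p q r s := by
      rw [symmDiff_of_le hAB, symmDiff_of_ge hsubR]
    rw [e2, h.chi_sdiff hK hRp hRb hsubR, e1]; ring
  · have hBfar : ∀ x ∈ curveVerts a, x ∉ verts B :=
      hK.notMem_verts_of_curve h.left hB hdB ⟨q, h.mem_left⟩ h.square.face₁
        (h.square.isPatch _ mem₁).2 (by simp) hQB
    have hoB : o ∉ verts B :=
      h.square.notMem_center hK hB (by rw [hBb]; exact h.center_right) mem₁ hQB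
    have hd : Disjoint A B := by
      refine hK.inter_eq_empty hconn hA hB hAne fun x hx hx' => ?_
      rw [hAa, hBb] at hx
      rcases hx with hx | hx
      · exact hBfar x hx (verts_mono Finset.inter_subset_right hx')
      · exact hAfar x hx (verts_mono Finset.inter_subset_left hx')
    have hAB := hA.union hB
    have hSb : bdry (A ∪ B) = a ∪ b := by rw [bdry_union hd, hAa, hBb, h.union_eq]
    have hoS : o ∉ verts (A ∪ B) := by
      intro hc
      obtain ⟨t, ht, hot⟩ := mem_verts.1 hc
      rcases Finset.mem_union.1 ht with ht | ht
      exacts [hoA (mem_verts.2 ⟨t, ht, hot⟩), hoB (mem_verts.2 ⟨t, ht, hot⟩)]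
    have e1 := hK.chi_union_of_disjoint hA hB hd fun x hx hx' =>
      hBfar x (hAa ▸ hK.mem_curveVerts_of_mem_verts hA hB hd hx hx') hx'
    have e2 : A ∆ B ∆ star4 o p q r s = (A ∪ B) ∪ star4 o p q r s := by
      rw [hd.symmDiff_eq_sup]
      exact (IsSquare.disjoint_of_center hoS).symmDiff_eq_sup
    rw [e2, h.chi_union hK hAB hSb hoS, e1, hchi]; ring

/-- If `a` bounds a disk, then `b` and `c` bound the same kinds of surfaces. -/
theorem fills_of_left (h : K.IsFusion o p q r s a b c) (ha : K.Fills a 1) :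
    (K.Fills b 1 ∧ K.Fills c 1) ∨ ∀ k, K.Fills b k ↔ K.Fills c k := by
  obtain ⟨A, hA, hAa, hchi⟩ := ha
  by_cases hQ : ({o, p, q} : Finset V) ∈ A
  · exact Or.inl (h.fills_of_mem hK hconn hA hAa hchi hQ)
  · right
    intro k
    constructor
    · rintro ⟨B, hB, hBb, rfl⟩
      refine ⟨A ∆ B ∆ star4 o p q r s, (hA.symmDiff hB).symmDiff h.square.isPatch, ?_,
        h.chi_of_notMem hK hconn hA hAa hchi hQ hB hBb⟩
      rw [bdry_symmDiff, bdry_symmDiff, hAa, hBb, h.square.bdry_star4, h.eq, h.union_eq]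
    · rintro ⟨T, hT, hTc, rfl⟩
      have hB : K.IsPatch (A ∆ T ∆ star4 o p q r s) :=
        (hA.symmDiff hT).symmDiff h.square.isPatch
      have hBb : bdry (A ∆ T ∆ star4 o p q r s) = b := by
        rw [bdry_symmDiff, bdry_symmDiff, hAa, hTc, h.square.bdry_star4, h.eq, h.union_eq,
          symmDiff_assoc, symmDiff_symmDiff_cancel_right, symmDiff_symmDiff_cancel_left]
      have e := h.chi_of_notMem hK hconn hA hAa hchi hQ hB hBb
      have e' : A ∆ (A ∆ T ∆ star4 o p q r s) ∆ star4 o p q r s = T := by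
        rw [symmDiff_assoc, symmDiff_symmDiff_cancel_right, symmDiff_symmDiff_cancel_left]
      rw [e'] at e
      exact ⟨_, hB, hBb, e.symm⟩

/-- If `a` and `b` bound an annulus `S` which contains the square, then a surface bounded by `a`
turns into a surface of the same Euler characteristic bounded by `b` when `S` is added to it, or
removed from it. -/
theorem fills_of_annulus (h : K.IsFusion o p q r s a b c) {S : Finset (Finset V)}
    (hS : K.IsPatch S) (hSb : bdry S = a ∪ b) (hchi : chi S = 0) (hsub : star4 o p q r s ⊆ S)
    {k : ℤ} (ha : K.Fills a k) : K.Fills b k := by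
  obtain ⟨A, hA, hAa, rfl⟩ := ha
  have hBp : K.IsPatch (A ∆ S) := hA.symmDiff hS
  have hBb : bdry (A ∆ S) = b := by
    rw [bdry_symmDiff, hAa, hSb, h.union_eq, symmDiff_symmDiff_cancel_left]
  refine ⟨A ∆ S, hBp, hBb, ?_⟩
  have hdB : ∀ x ∈ curveVerts a, x ∉ curveVerts (bdry (A ∆ S)) := fun x hx hx' =>
    h.disjoint x hx (hBb ▸ hx')
  have hdA : ∀ x ∈ curveVerts b, x ∉ curveVerts (bdry A) := fun x hx hx' =>
    h.disjoint x (hAa ▸ hx') hx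
  by_cases hQ : ({o, p, q} : Finset V) ∈ A
  · have hsubA := h.square.subset_of_mem hK hA (by rw [hAa]; exact h.center_left) mem₁ hQ
    have hfull := hK.isFullAt_of_curve h.right hA hdA ⟨s, h.mem_right⟩
      (mem_verts.2 ⟨_, hsubA mem₂, by simp⟩)
    have hBfar := hK.notMem_verts_of_curve h.left hBp hdB ⟨q, h.mem_left⟩ h.square.face₁
        (h.square.isPatch _ mem₁).2 (by simp) (fun hc => by
          rcases Finset.mem_symmDiff.1 hc with hc | hc
          exacts [hc.2 (hsub mem₁), hc.2 hQ])
    have hSA : S ⊆ A := by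
      refine hK.subset_of_near hconn hS hA ?_ fun x hx hx' => ?_
      · rw [hSb]; exact h.left.isCurve.nonempty.mono Set.subset_union_left
      rw [hAa, hSb, curveVerts_union] at hx
      obtain ⟨t, ht, hxt⟩ := mem_verts.1 hx'
      obtain ⟨htS, htA⟩ := Finset.mem_sdiff.1 ht
      have hx : x ∈ curveVerts a ∨ x ∈ curveVerts b := by tauto
      rcases hx with hx | hx
      · exact hBfar x hx (mem_verts.2 ⟨t, Finset.mem_symmDiff.2 (Or.inr ⟨htS, htA⟩), hxt⟩)
      · exact htA (hfull x hx t (hS t htS).1 (hS t htS).2 hxt)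
    rw [symmDiff_of_ge hSA] at hBb hBp ⊢
    have e1 := hK.chi_union_of_curve hBp hS Finset.sdiff_disjoint (hBb ▸ h.right.isCurve)
      (by rw [hBb, hSb]; exact Set.subset_union_right)
    rw [Finset.sdiff_union_of_subset hSA] at e1
    omega
  · have hoA : o ∉ verts A :=
      h.square.notMem_center hK hA (by rw [hAa]; exact h.center_left) mem₁ hQ
    have hQ' : ({o, r, s} : Finset V) ∉ A := fun hc => hoA (mem_verts.2 ⟨_, hc, by simp⟩)
    have hAfar := hK.notMem_verts_of_curve h.right hA hdA ⟨s, h.mem_right⟩ h.square.face₃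
      (h.square.isPatch _ mem₂).2 (by simp) hQ'
    have hfull := hK.isFullAt_of_curve h.left hBp hdB ⟨q, h.mem_left⟩
      (mem_verts.2 ⟨_, Finset.mem_symmDiff.2 (Or.inr ⟨hsub mem₁, hQ⟩), by simp⟩)
    have hd : Disjoint A S := by
      refine hK.inter_eq_empty hconn hA hS (hAa ▸ h.left.isCurve.nonempty) fun x hx hx' => ?_
      rw [hAa, hSb, curveVerts_union] at hx
      obtain ⟨t, ht, hxt⟩ := mem_verts.1 hx'
      obtain ⟨htA, htS⟩ := Finset.mem_inter.1 ht
      have hx : x ∈ curveVerts a ∨ x ∈ curveVerts b := by tauto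
      rcases hx with hx | hx
      · rcases Finset.mem_symmDiff.1 (hfull x hx t (hA t htA).1 (hA t htA).2 hxt) with hc | hc
        exacts [hc.2 htS, hc.2 htA]
      · exact hAfar x hx (mem_verts.2 ⟨t, htA, hxt⟩)
    rw [hd.symmDiff_eq_sup]
    have e1 := hK.chi_union_of_curve hA hS hd (hAa ▸ h.left.isCurve)
      (by rw [hAa, hSb]; exact Set.subset_union_left)
    exact e1.trans (by rw [hchi, add_zero])

/-- If `c` bounds a disk, then `a` and `b` bound the same kinds of surfaces. -/
theorem fills_of_total (h : K.IsFusion o p q r s a b c) (hc : K.Fills c 1) :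
    (K.Fills a 1 ∧ K.Fills b 1) ∨ ∀ k, K.Fills a k ↔ K.Fills b k := by
  obtain ⟨T, hT, hTc, hchi⟩ := hc
  have ho : o ∉ curveVerts (bdry T) := by rw [hTc]; exact h.center_total
  obtain ⟨m1, m2, m3, m4⟩ := h.mem_total
  have hu : c ∆ sides4 p q r s = a ∪ b := by rw [h.eq, symmDiff_symmDiff_cancel_right]
  by_cases hQ : ({o, p, q} : Finset V) ∈ T
  · -- Removing the square from the disk leaves two disks.
    left
    have hsub := h.square.subset_of_mem hK hT ho mem₁ hQ
    have hr := h.square.rotate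
    have e1 := hr.chi_sdiff_star4 hK hT (by rw [star4_rotate o p q r s]; exact hsub) ho
      (by rw [hTc]; exact m1) (by rw [hTc]; exact m2) (by rw [hTc]; exact m4)
      (by rw [hTc]; exact m3)
    rw [star4_rotate o p q r s, hchi] at e1
    exact hK.exists_disks_of_chi_eq_two hconn h.left.isCurve h.right.isCurve h.disjoint
      (hT.mono Finset.sdiff_subset)
      (by rw [bdry_sdiff hsub, hTc, h.square.bdry_star4, hu]) e1
  · -- Together with the square, the disk is an annulus between `a` and `b`.
    right
    have hoT := h.square.notMem_center hK hT ho mem₁ hQ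
    have hd : Disjoint T (star4 o p q r s) := IsSquare.disjoint_of_center hoT
    have e1 := h.square.rotate.chi_union_star4 hK hT hoT
      (by rw [hTc]; exact m1) (by rw [hTc]; exact m2) (by rw [hTc]; exact m4)
      (by rw [hTc]; exact m3)
    rw [star4_rotate o p q r s, hchi] at e1
    have hS := hT.union h.square.isPatch
    have hSb : bdry (T ∪ star4 o p q r s) = a ∪ b := by
      rw [bdry_union hd, hTc, h.square.bdry_star4, hu]
    intro k
    refine ⟨h.fills_of_annulus hK hconn hS hSb e1 Finset.subset_union_right, ?_⟩
    refine h.symm.fills_of_annulus hK hconn hS (by rw [hSb, Set.union_comm]) e1 ?_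
    rw [star4_rotate o q r s p, star4_rotate o p q r s]
    exact Finset.subset_union_right

end IsFusion

namespace IsTwist

variable {o p q r s : V} {x y : Set (Sym2 V)} (hK : K.IsSurface) (hconn : K.IsConnected)

theorem symm (h : K.IsTwist o p q r s x y) : K.IsTwist o q r s p y x where
  square := h.square.rotate
  left := h.right
  right := h.left
  center := by
    rw [h.eq]
    intro hc
    rcases curveVerts_symmDiff hc with hc | hc
    exacts [h.center hc, h.square.center_notMem hc]
  mem₁ := by rw [h.eq]; exact Or.inr ⟨by simp [sides4], h.notMem₁⟩
  mem₂ := by rw [h.eq]; exact Or.inr ⟨by simp [sides4], h.notMem₂⟩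
  notMem₁ := by
    rw [h.eq]; rintro (hc | hc)
    exacts [hc.2 (by simp [sides4]), hc.2 h.mem₂]
  notMem₂ := by
    rw [h.eq]; rintro (hc | hc)
    exacts [hc.2 (by simp [sides4]), hc.2 h.mem₁]
  eq := by rw [h.eq, sides4_rotate p q r s, symmDiff_symmDiff_cancel_right]

include hK hconn

/-- A disk bounded by `x` does not contain the square, and together with it forms a Möbius band. -/
theorem notMem_of_disk (h : K.IsTwist o p q r s x y) {T : Finset (Finset V)} (hT : K.IsPatch T)
    (hTx : bdry T = x) (hchi : chi T = 1) : o ∉ verts T ∧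
      bdry (T ∪ star4 o p q r s) = y ∧ chi (T ∪ star4 o p q r s) = 0 := by
  have ho : o ∉ curveVerts (bdry T) := by rw [hTx]; exact h.center
  have hQ : ({o, p, q} : Finset V) ∉ T := by
    -- otherwise the rest of the disk is bounded by the single curve `y` and has characteristic two
    intro hQ
    have hsub := h.square.subset_of_mem hK hT ho IsFusion.mem₁ hQ
    have e1 := h.square.chi_sdiff_star4 hK hT hsub ho (by rw [hTx]; exact h.mem₁)
      (by rw [hTx]; exact h.mem₂) (by rw [hTx]; exact h.notMem₁) (by rw [hTx]; exact h.notMem₂)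
    have e2 := hK.chi_le_one_of_curve hconn (hT.mono (Finset.sdiff_subset (t := star4 o p q r s)))
      (by rw [bdry_sdiff hsub, hTx, h.square.bdry_star4, ← h.eq]; exact h.right.isCurve)
    omega
  have hoT := h.square.notMem_center hK hT ho IsFusion.mem₁ hQ
  refine ⟨hoT, ?_, ?_⟩
  · rw [bdry_union (IsSquare.disjoint_of_center hoT), hTx, h.square.bdry_star4, h.eq]
  · rw [h.square.chi_union_star4 hK hT hoT (by rw [hTx]; exact h.mem₁)
      (by rw [hTx]; exact h.mem₂) (by rw [hTx]; exact h.notMem₁) (by rw [hTx]; exact h.notMem₂),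
      hchi]; rfl

theorem fills_zero (h : K.IsTwist o p q r s x y) (hx : K.Fills x 1) : K.Fills y 0 := by
  obtain ⟨T, hT, hTx, hchi⟩ := hx
  obtain ⟨-, h1, h2⟩ := h.notMem_of_disk hK hconn hT hTx hchi
  exact ⟨_, hT.union h.square.isPatch, h1, h2⟩

/-- If both `x` and `y` bound disks, then the surface consists of a Möbius band and a disk. -/
theorem isProjectivePlane (h : K.IsTwist o p q r s x y) (hx : K.Fills x 1) (hy : K.Fills y 1) :
    K.IsProjectivePlane := by
  obtain ⟨T, hT, hTx, hchi⟩ := hx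
  obtain ⟨hoT, hMb, hM⟩ := h.notMem_of_disk hK hconn hT hTx hchi
  obtain ⟨T', hT', hTy, hchi'⟩ := hy
  obtain ⟨hoT', -⟩ := h.symm.notMem_of_disk hK hconn hT' hTy hchi'
  set M := T ∪ star4 o p q r s with hMdef
  have hMp : K.IsPatch M := hT.union h.square.isPatch
  have hUp : K.IsPatch (M ∆ T') := hMp.symmDiff hT'
  have hUb : bdry (M ∆ T') = ∅ := by
    rw [bdry_symmDiff, hMb, hTy, symmDiff_self]; rfl
  have hm : ({o, p, q} : Finset V) ∈ M ∆ T' := Finset.mem_symmDiff.2 (Or.inl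
    ⟨Finset.mem_union_right _ IsFusion.mem₁, fun hc => hoT' (mem_verts.2 ⟨_, hc, by simp⟩)⟩)
  -- The Möbius band and the second disk have the same boundary, so they are complementary.
  have hall : ∀ t, t ∈ M ∆ T' ↔ t ∈ K.faces ∧ t.card = 3 := fun t =>
    ⟨fun ht => hUp t ht, fun ht => hK.mem_of_bdry_eq_empty hconn hUp hUb ⟨_, hm⟩ ht.1 ht.2⟩
  have hd : Disjoint M T' := by
    rw [Finset.disjoint_left]
    intro t h1 h2
    rcases Finset.mem_symmDiff.1 ((hall t).2 (hMp t h1)) with hc | hc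
    exacts [hc.2 h2, hc.2 h1]
  have hspan := eq_span hK hall
  have e1 : chi (M ∆ T') = 1 := by
    rw [hd.symmDiff_eq_sup]
    have := hK.chi_union_of_curve hMp hT' hd (by rw [hMb]; exact h.right.isCurve)
      (by rw [hMb, hTy])
    exact this.trans (by rw [hM, hchi']; rfl)
  refine ⟨hK, ?_, hconn, ?_, ?_⟩
  · rw [hspan]; exact span_finite _
  · rw [hspan, hK.boundaryEdges_span hUp, hUb]
  · rw [hspan, eulerChar_span hUp, e1]

end IsTwist

end PreAbstractSimplicialComplex

namespace PreAbstractSimplicialComplex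

variable {V : Type*} [DecidableEq V] {K : PreAbstractSimplicialComplex V}

open scoped symmDiff

/-! ### Homotopies of curves that differ by a square -/

theorem IsSquare.reflect {o p q r s : V} (h : K.IsSquare o p q r s) : K.IsSquare o q p s r where
  nodup := by have := h.nodup; simp only [List.nodup_cons, List.mem_cons] at this ⊢; grind
  face₁ := by rw [Finset.pair_comm]; exact h.face₁
  face₂ := by rw [Finset.pair_comm]; exact h.face₄
  face₃ := by rw [Finset.pair_comm]; exact h.face₃
  face₄ := by rw [Finset.pair_comm]; exact h.face₂

/-- Three sides of a square are homotopic to the fourth. -/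
theorem IsSquare.pathHomotopic {o p q r s : V} (h : K.IsSquare o p q r s) (m : List V) :
    K.PathHomotopic (r :: q :: p :: s :: m) (r :: s :: m) := by
  have f1 : ({r, o, q} : Finset V) ∈ K.faces := by convert h.face₂ using 1; ext; simp; tauto
  have f2 : ({o, q, p} : Finset V) ∈ K.faces := by convert h.face₁ using 1; ext; simp; tauto
  have f3 : ({o, p, s} : Finset V) ∈ K.faces := by convert h.face₄ using 1; ext; simp; tauto
  have f4 : ({r, o, s} : Finset V) ∈ K.faces := by convert h.face₃ using 1; ext; simp; tauto
  exact (PathHomotopic.contract _ f1).symm.trans (((PathHomotopic.contract _ f2).cons r).trans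
    (((PathHomotopic.contract _ f3).cons r).trans (PathHomotopic.contract _ f4)))

theorem IsSquare.adj {o p q r s : V} (h : K.IsSquare o p q r s) : K.oneSkeleton.Adj p q :=
  ⟨h.ne.2.2.2.2.1, face_mono h.face₁ (by simp) (by simp)⟩

theorem support_eq_dropLast {G : SimpleGraph V} {u v : V} (w : G.Walk u v) :
    w.support = w.support.dropLast ++ [v] := by
  conv_lhs => rw [← List.dropLast_append_getLast w.support_ne_nil]
  simp

/-- Two disjoint arcs whose ends are the corners of a square. -/
structure IsArcPair (o p q r s : V) (α : K.oneSkeleton.Walk q p) (β : K.oneSkeleton.Walk s r) :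
    Prop where
  square : K.IsSquare o p q r s
  left : α.IsPath
  right : β.IsPath
  disjoint : ∀ x ∈ α.support, x ∉ β.support
  center_left : o ∉ α.support
  center_right : o ∉ β.support
  notMem_left : s(p, q) ∉ α.edges
  notMem_right : s(r, s) ∉ β.edges

/-- The closed curve formed by an arc and the edge which joins its ends. -/
def closing {G : SimpleGraph V} {u v : V} (α : G.Walk u v) : Set (Sym2 V) :=
  insert s(v, u) {e | e ∈ α.edges}

/-- The closed curve formed by two arcs and the edges which join the end of each to the origin of
the other. -/
def joining {G : SimpleGraph V} {p q r s : V} (α : G.Walk q p) (β : G.Walk s r) :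
    Set (Sym2 V) :=
  {s(q, r), s(s, p)} ∪ ({e | e ∈ α.edges} ∪ {e | e ∈ β.edges})

namespace IsArcPair

variable {o p q r s : V} {α : K.oneSkeleton.Walk q p} {β : K.oneSkeleton.Walk s r}

theorem symm (h : IsArcPair o p q r s α β) : IsArcPair o r s p q β α where
  square := h.square.rotate.rotate
  left := h.right
  right := h.left
  disjoint := fun x hx hx' => h.disjoint x hx' hx
  center_left := h.center_right
  center_right := h.center_left
  notMem_left := h.notMem_right
  notMem_right := h.notMem_left

theorem traces_left (h : IsArcPair o p q r s α β) : K.Traces α.support (closing α) := by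
  refine ⟨p, SimpleGraph.Walk.cons h.square.adj α,
    (SimpleGraph.Walk.cons_isCycle_iff _ _).2 ⟨h.left, h.notMem_left⟩, rfl, ?_⟩
  ext e
  simp [closing]

theorem traces_right (h : IsArcPair o p q r s α β) : K.Traces β.support (closing β) :=
  h.symm.traces_left

theorem traces_total (h : IsArcPair o p q r s α β) :
    K.Traces (α.support ++ β.support) (joining α β) := by
  have a1 : K.oneSkeleton.Adj r q := h.square.rotate.adj.symm
  have a2 : K.oneSkeleton.Adj p s := h.square.rotate.rotate.rotate.adj.symm
  have hs : (α.append (SimpleGraph.Walk.cons a2 β)).support = α.support ++ β.support := by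
    rw [SimpleGraph.Walk.support_append, SimpleGraph.Walk.support_cons, List.tail_cons]
  refine ⟨r, SimpleGraph.Walk.cons a1 (α.append (SimpleGraph.Walk.cons a2 β)),
    (SimpleGraph.Walk.cons_isCycle_iff _ _).2 ⟨?_, ?_⟩, ?_, ?_⟩
  · rw [SimpleGraph.Walk.isPath_def, hs]
    exact List.Nodup.append h.left.support_nodup h.right.support_nodup
      fun x hx hx' => h.disjoint x hx hx'
  · rw [SimpleGraph.Walk.edges_append, SimpleGraph.Walk.edges_cons, List.mem_append, List.mem_cons]
    obtain ⟨-, -, -, -, -, h6, -, h8, h9, h10⟩ := h.square.ne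
    rintro (hc | hc | hc)
    · exact h.disjoint r (α.fst_mem_support_of_mem_edges hc) β.end_mem_support
    · rcases Sym2.eq_iff.1 hc with ⟨h, -⟩ | ⟨h, -⟩
      exacts [h6 h.symm, h10 h]
    · exact h.disjoint q α.start_mem_support (β.snd_mem_support_of_mem_edges hc)
  · rw [SimpleGraph.Walk.support_cons, List.tail_cons, hs]
  · ext e
    simp only [joining, SimpleGraph.Walk.edges_cons, SimpleGraph.Walk.edges_append, List.mem_cons,
      List.mem_append, Set.mem_union, Set.mem_insert_iff, Set.mem_singleton_iff, Set.mem_ofPred_eq,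
      Sym2.eq_swap (a := r), Sym2.eq_swap (a := p)]
    tauto

theorem mem_support_of_mem_curveVerts {G : SimpleGraph V} {u v x : V} {w : G.Walk u v}
    (h : x ∈ curveVerts (closing w)) : x ∈ w.support := by
  obtain ⟨y, hy | hy⟩ := h
  · rcases Sym2.eq_iff.1 hy with ⟨rfl, -⟩ | ⟨rfl, -⟩
    exacts [w.end_mem_support, w.start_mem_support]
  · exact w.fst_mem_support_of_mem_edges hy

theorem isFusion (h : IsArcPair o p q r s α β) :
    K.IsFusion o p q r s (closing α) (closing β) (joining α β) where
  square := h.square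
  left := ⟨_, h.traces_left⟩
  right := ⟨_, h.traces_right⟩
  total := ⟨_, h.traces_total⟩
  disjoint := fun x hx hx' => h.disjoint x (mem_support_of_mem_curveVerts hx)
    (mem_support_of_mem_curveVerts hx')
  center_left := fun hx => h.center_left (mem_support_of_mem_curveVerts hx)
  center_right := fun hx => h.center_right (mem_support_of_mem_curveVerts hx)
  mem_left := Or.inl rfl
  mem_right := Or.inl rfl
  eq := by
    obtain ⟨-, -, -, -, h5, h6, h7, h8, h9, h10⟩ := h.square.ne
    have n1 : s(q, r) ∉ α.edges := fun hc =>
      h.disjoint r (α.snd_mem_support_of_mem_edges hc) β.end_mem_support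
    have n2 : s(s, p) ∉ α.edges := fun hc =>
      h.disjoint s (α.fst_mem_support_of_mem_edges hc) β.start_mem_support
    have n3 : s(r, s) ∉ α.edges := fun hc =>
      h.disjoint s (α.snd_mem_support_of_mem_edges hc) β.start_mem_support
    have n4 : s(q, r) ∉ β.edges := fun hc =>
      h.disjoint q α.start_mem_support (β.fst_mem_support_of_mem_edges hc)
    have n5 : s(s, p) ∉ β.edges := fun hc =>
      h.disjoint p α.end_mem_support (β.snd_mem_support_of_mem_edges hc)
    have n6 : s(p, q) ∉ β.edges := fun hc =>
      h.disjoint q α.start_mem_support (β.snd_mem_support_of_mem_edges hc)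
    have n7 := h.notMem_left
    have n8 := h.notMem_right
    have d1 : s(p, q) ≠ s(q, r) := by simp; tauto
    have d2 : s(p, q) ≠ s(s, p) := by simp; tauto
    have d3 : s(r, s) ≠ s(q, r) := by simp; tauto
    have d4 : s(r, s) ≠ s(s, p) := by simp; tauto
    ext e
    simp only [joining, closing, sides4, Set.mem_symmDiff, Set.mem_union, Set.mem_insert_iff,
      Set.mem_singleton_iff, Set.mem_ofPred_eq]
    by_cases e1 : e = s(p, q)
    · subst e1; tauto
    by_cases e2 : e = s(r, s)
    · subst e2; tauto
    by_cases e3 : e = s(q, r)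
    · subst e3; tauto
    by_cases e4 : e = s(s, p)
    · subst e4; tauto
    tauto

variable (hK : K.IsSurface) (hconn : K.IsConnected)

theorem _root_.SimpleGraph.Walk.exists_support_eq {G : SimpleGraph V} {u v : V} (w : G.Walk u v)
    (h : u ≠ v) : ∃ m, w.support = u :: (m ++ [v]) := by
  cases w with
  | nil => exact absurd rfl h
  | cons h' w =>
    exact ⟨w.support.dropLast, by rw [SimpleGraph.Walk.support_cons, ← support_eq_dropLast w]⟩

include hK hconn

theorem pathHomotopic_of_fills {γ : Set (Sym2 V)} (hγ : IsCurve γ) (hf : K.Fills γ 1) {u v : V}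
    (w w' : K.oneSkeleton.Walk u v) (hw : ∀ e ∈ w.edges, e ∈ γ) (hw' : ∀ e ∈ w'.edges, e ∈ γ) :
    K.PathHomotopic (w.support ++ [v]) (w'.support ++ [v]) := by
  obtain ⟨T, hT, rfl, hchi⟩ := hf
  have h := hK.pathHomotopic_of_chi_eq_one hT (hK.isLinked hconn hT hγ)
    (hK.nonempty_of_bdry hγ.nonempty)
    (fun S hS hne => hK.bdry_nonempty_of_subset hconn hT hγ.nonempty hS hne) hchi
    (w.transfer (sides T) fun e he => bdry_subset_edgeSet T (hw e he))
    (w'.transfer (sides T) fun e he => bdry_subset_edgeSet T (hw' e he))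
  rwa [SimpleGraph.Walk.support_transfer, SimpleGraph.Walk.support_transfer] at h

/-- If the first of the two closed arcs bounds a disk, then it can be pulled across the square. -/
theorem homotopic_of_left (h : IsArcPair o p q r s α β) (ha : K.Fills (closing α) 1) :
    K.Homotopic (α.support ++ β.support) β.support := by
  obtain ⟨-, -, -, -, h5, -, -, -, -, h10⟩ := h.square.ne
  have f1 : ({p, s} : Finset V) ∈ K.faces := (h.square.rotate.rotate.rotate.adj.symm).2
  -- In the disk, `α` is homotopic to the edge `qp`. This turns the joined curve into `β` with the
  -- other three sides of the square in place of `rs`.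
  have e1 : K.PathHomotopic (α.support ++ [p]) [q, p, p] :=
    pathHomotopic_of_fills hK hconn h.isFusion.left.isCurve ha α
      (SimpleGraph.Walk.cons h.square.adj.symm SimpleGraph.Walk.nil) (fun e he => Or.inr he)
      (fun e he => by
        simp only [SimpleGraph.Walk.edges_cons, SimpleGraph.Walk.edges_nil,
          List.mem_singleton] at he
        exact Or.inl (he.trans Sym2.eq_swap))
  obtain ⟨m, hm⟩ := β.exists_support_eq h10.symm
  rw [hm]
  have e2 : K.PathHomotopic (α.support ++ p :: s :: (m ++ [r]))
      (α.support ++ s :: (m ++ [r])) := by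
    rw [support_eq_dropLast α, List.append_assoc, List.append_assoc]
    exact (PathHomotopic.contract _ (by simpa using f1)).append_left _
  have e3 := e1.append_right (s :: (m ++ [r]))
  rw [List.append_assoc] at e3
  have e4 : K.PathHomotopic (q :: p :: p :: s :: (m ++ [r])) (q :: p :: s :: (m ++ [r])) :=
    (PathHomotopic.contract _ (by simpa using f1)).cons q
  refine Relation.EqvGen.trans _ _ _ (e2.symm.trans (e3.trans e4)).homotopic ?_
  refine Relation.EqvGen.trans _ _ _ (homotopic_append_comm (q :: p :: s :: m) [r]) ?_
  refine Relation.EqvGen.trans _ _ _ (h.square.pathHomotopic m).homotopic ?_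
  exact homotopic_append_comm [r] (s :: m)

theorem homotopic_double {p q : V} (m : List V) (h : ({p, q} : Finset V) ∈ K.faces) :
    K.Homotopic (q :: (m ++ [p, p])) (q :: (m ++ [p])) := by
  refine Relation.EqvGen.trans _ _ _ (homotopic_append_comm (q :: m) [p, p]) ?_
  refine Relation.EqvGen.trans _ _ _
    (PathHomotopic.contract (a := p) (b := p) (c := q) m (by simpa using h)).homotopic ?_
  exact homotopic_append_comm [p] (q :: m)

/-- If the curve formed by both arcs bounds a disk, then each arc can be pushed to the other
one. -/
theorem homotopic_of_total (h : IsArcPair o p q r s α β) (hc : K.Fills (joining α β) 1) :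
    K.Homotopic α.support β.support := by
  obtain ⟨-, -, -, -, h5, -, -, -, -, h10⟩ := h.square.ne
  have a1 : K.oneSkeleton.Adj q r := h.square.rotate.adj
  have a2 : K.oneSkeleton.Adj s p := h.square.rotate.rotate.rotate.adj
  -- In the disk, `α` is homotopic to the way around through `r` and `s` along the reverse of `β`.
  have e1 := pathHomotopic_of_fills hK hconn h.isFusion.total.isCurve hc α
    (SimpleGraph.Walk.cons a1 (β.reverse.append (SimpleGraph.Walk.cons a2 SimpleGraph.Walk.nil)))
    (fun e he => Or.inr (Or.inl he)) (fun e he => by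
      simp only [SimpleGraph.Walk.edges_cons, SimpleGraph.Walk.edges_append,
        SimpleGraph.Walk.edges_reverse, List.mem_cons, List.mem_append, List.mem_reverse,
        SimpleGraph.Walk.edges_nil, List.not_mem_nil, or_false] at he
      rcases he with he | he | he
      exacts [Or.inl (Or.inl he), Or.inr (Or.inr he), Or.inl (Or.inr he)])
  obtain ⟨m, hm⟩ := α.exists_support_eq h5.symm
  obtain ⟨m', hm'⟩ := β.reverse.exists_support_eq h10
  have hr : K.Homotopic β.support β.reverse.support := by
    rw [SimpleGraph.Walk.support_reverse]
    exact Relation.EqvGen.rel _ _ (HomotopyMove.reverse _)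
  refine Relation.EqvGen.trans _ _ _ ?_ (Relation.EqvGen.symm _ _ hr)
  rw [SimpleGraph.Walk.support_cons, SimpleGraph.Walk.support_append, SimpleGraph.Walk.support_cons,
    List.tail_cons, SimpleGraph.Walk.support_nil, hm, hm'] at e1
  rw [hm, hm']
  have f1 : ({p, q} : Finset V) ∈ K.faces := h.square.adj.2
  have d1 := homotopic_double hK hconn m f1
  have d2 := homotopic_double hK hconn (r :: (m' ++ [s])) f1
  simp only [List.cons_append, List.append_assoc, List.nil_append] at e1 d1 d2
  refine Relation.EqvGen.trans _ _ _ (Relation.EqvGen.symm _ _ d1) ?_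
  refine Relation.EqvGen.trans _ _ _ e1.homotopic ?_
  refine Relation.EqvGen.trans _ _ _ d2 ?_
  refine Relation.EqvGen.trans _ _ _
    (by
      have e := homotopic_append_comm (K := K) (q :: r :: m') [s, p]
      simp only [List.cons_append, List.nil_append] at e
      exact e) ?_
  refine Relation.EqvGen.trans _ _ _ (h.square.reflect.pathHomotopic m').homotopic ?_
  exact homotopic_append_comm [s] (r :: m')

end IsArcPair

end PreAbstractSimplicialComplex

namespace PreAbstractSimplicialComplex

variable {V : Type*} [DecidableEq V] {K : PreAbstractSimplicialComplex V}

/-! ### The color of a circle -/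

open scoped Classical in
/-- The color of a simple closed curve: whether it bounds a disk, or bounds a Möbius band but
no disk, or else its homotopy class. The value at a set of edges which is no simple closed curve is
irrelevant. -/
noncomputable def color (K : PreAbstractSimplicialComplex V) (γ : Set (Sym2 V)) :
    CircleColor K.CurveClass :=
  if K.BoundsDisk γ then .disk
  else if h : K.IsSimpleClosedCurve γ ∧ ¬ K.BoundsDisk γ ∧ ¬ K.BoundsMobiusBand γ then
    .essential (Quot.mk _ ⟨γ, h⟩)
  else .mobius

theorem color_of_disk {γ : Set (Sym2 V)} (h : K.BoundsDisk γ) : K.color γ = .disk := if_pos h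

theorem color_of_mobius {γ : Set (Sym2 V)} (h : ¬ K.BoundsDisk γ) (h' : K.BoundsMobiusBand γ) :
    K.color γ = .mobius := by
  unfold color
  rw [if_neg h, dif_neg fun hc => hc.2.2 h']

theorem color_of_unbounding {γ : Set (Sym2 V)}
    (h : K.IsSimpleClosedCurve γ ∧ ¬ K.BoundsDisk γ ∧ ¬ K.BoundsMobiusBand γ) :
    K.color γ = .essential (Quot.mk _ ⟨γ, h⟩) := by
  unfold color
  rw [if_neg h.2.1, dif_pos h]

theorem color_eq_disk_iff {γ : Set (Sym2 V)} : K.color γ = .disk ↔ K.BoundsDisk γ := by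
  refine ⟨fun h => ?_, color_of_disk⟩
  by_contra hn
  unfold color at h
  rw [if_neg hn] at h
  split_ifs at h

theorem color_congr {γ δ : Set (Sym2 V)} (h₁ : K.BoundsDisk γ ↔ K.BoundsDisk δ)
    (h₂ : K.BoundsMobiusBand γ ↔ K.BoundsMobiusBand δ)
    (h : ∃ l m, K.Traces l γ ∧ K.Traces m δ ∧ K.Homotopic l m) : K.color γ = K.color δ := by
  by_cases hd : K.BoundsDisk γ
  · rw [color_of_disk hd, color_of_disk (h₁.1 hd)]
  by_cases hm : K.BoundsMobiusBand γ
  · rw [color_of_mobius hd hm, color_of_mobius (mt h₁.2 hd) (h₂.1 hm)]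
  obtain ⟨l, m, hl, hm', hh⟩ := h
  rw [color_of_unbounding ⟨⟨l, hl⟩, hd, hm⟩,
    color_of_unbounding ⟨⟨m, hm'⟩, mt h₁.2 hd, mt h₂.2 hm⟩]
  congr 1
  exact Quot.sound ⟨l, m, hl, hm', hh⟩

theorem joining_comm {G : SimpleGraph V} {p q r s : V} (α : G.Walk q p) (β : G.Walk s r) :
    joining β α = joining α β := by
  unfold joining
  rw [Set.pair_comm, Set.union_comm {e | e ∈ β.edges}]

variable (hK : K.IsSurface) (hconn : K.IsConnected)
include hK hconn

theorem color_congr_of_fills {γ δ : Set (Sym2 V)} (hγ : K.IsSimpleClosedCurve γ)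
    (hδ : K.IsSimpleClosedCurve δ) (h₁ : ∀ k, K.Fills γ k ↔ K.Fills δ k)
    (h : ∃ l m, K.Traces l γ ∧ K.Traces m δ ∧ K.Homotopic l m) : K.color γ = K.color δ := by
  refine color_congr ?_ ?_ h
  · rw [hK.boundsDisk_iff hconn hγ, hK.boundsDisk_iff hconn hδ]; exact h₁ 1
  · rw [hK.boundsMobiusBand_iff hconn hγ, hK.boundsMobiusBand_iff hconn hδ]; exact h₁ 0

theorem color_eq_disk_iff_fills {γ : Set (Sym2 V)} (hγ : K.IsSimpleClosedCurve γ) :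
    K.color γ = .disk ↔ K.Fills γ 1 :=
  color_eq_disk_iff.trans (hK.boundsDisk_iff hconn hγ)

variable {o p q r s : V}

theorem IsArcPair.color_left {α : K.oneSkeleton.Walk q p} {β : K.oneSkeleton.Walk s r}
    (h : IsArcPair o p q r s α β) (ha : K.color (closing α) = .disk) :
    K.color (closing β) = K.color (joining α β) := by
  have hf := h.isFusion
  rw [color_eq_disk_iff_fills hK hconn hf.left] at ha
  rcases hf.fills_of_left hK hconn ha with ⟨h1, h2⟩ | h1
  · rw [(color_eq_disk_iff_fills hK hconn hf.right).2 h1,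
      (color_eq_disk_iff_fills hK hconn hf.total).2 h2]
  · exact color_congr_of_fills hK hconn hf.right hf.total h1 ⟨_, _, h.traces_right, h.traces_total,
      Relation.EqvGen.symm _ _ (h.homotopic_of_left hK hconn ha)⟩

theorem IsArcPair.triple {α : K.oneSkeleton.Walk q p} {β : K.oneSkeleton.Walk s r}
    (h : IsArcPair o p q r s α β) :
    CircleColor.Triple (K.color (closing α)) (K.color (closing β)) (K.color (joining α β)) := by
  have hf := h.isFusion
  refine ⟨fun ha => h.color_left hK hconn ha, fun hb => ?_, fun hc => ?_⟩
  · rw [← joining_comm]; exact h.symm.color_left hK hconn hb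
  · rw [color_eq_disk_iff_fills hK hconn hf.total] at hc
    rcases hf.fills_of_total hK hconn hc with ⟨h1, h2⟩ | h1
    · rw [(color_eq_disk_iff_fills hK hconn hf.left).2 h1,
        (color_eq_disk_iff_fills hK hconn hf.right).2 h2]
    · exact color_congr_of_fills hK hconn hf.left hf.right h1 ⟨_, _, h.traces_left, h.traces_right,
        h.homotopic_of_total hK hconn hc⟩

theorem IsTwist.color {x y : Set (Sym2 V)} (h : K.IsTwist o p q r s x y)
    (hx : K.color x = .disk) :
    K.color y = .mobius ∨ (K.color y = .disk ∧ K.IsProjectivePlane) := by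
  rw [color_eq_disk_iff_fills hK hconn h.left] at hx
  by_cases hy : K.Fills y 1
  · exact Or.inr ⟨(color_eq_disk_iff_fills hK hconn h.right).2 hy,
      h.isProjectivePlane hK hconn hx hy⟩
  · left
    refine color_of_mobius ?_ ((hK.boundsMobiusBand_iff hconn h.right).2
      (h.fills_zero hK hconn hx))
    rwa [hK.boundsDisk_iff hconn h.right]

end PreAbstractSimplicialComplex

namespace SimpleGraph

variable {V : Type*} [DecidableEq V]

open PreAbstractSimplicialComplex

/-! ### Cycles in graphs of degree two -/

/-- The sets of edges of the cycles in `G`. -/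
def cycleSets (G : SimpleGraph V) : Set (Set (Sym2 V)) :=
  {γ | ∃ (a : V) (w : G.Walk a a), w.IsCycle ∧ γ = {e | e ∈ w.edges}}

variable {G H X : SimpleGraph V} {γ δ : Set (Sym2 V)}

theorem isCurve_of_mem_cycleSets (h : γ ∈ G.cycleSets) : IsCurve γ := by
  obtain ⟨a, w, hw, rfl⟩ := h
  exact isCurve_of_isCycle hw

theorem subset_of_mem_cycleSets (h : γ ∈ G.cycleSets) : γ ⊆ G.edgeSet := by
  obtain ⟨a, w, -, rfl⟩ := h
  exact fun e he => w.edges_subset_edgeSet he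

theorem mem_cycleSets_of_subset (h : γ ∈ G.cycleSets) (hs : γ ⊆ H.edgeSet) : γ ∈ H.cycleSets := by
  obtain ⟨a, w, hw, rfl⟩ := h
  have hs : ∀ e ∈ w.edges, e ∈ H.edgeSet := hs
  exact ⟨a, w.transfer H hs, hw.transfer hs, by rw [Walk.edges_transfer]⟩

theorem isSimpleClosedCurve_of_mem_cycleSets {K : PreAbstractSimplicialComplex V}
    (hG : G ≤ K.oneSkeleton) (h : γ ∈ G.cycleSets) : K.IsSimpleClosedCurve γ := by
  obtain ⟨a, w, hw, rfl⟩ := mem_cycleSets_of_subset h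
    ((subset_of_mem_cycleSets h).trans (edgeSet_mono hG))
  exact ⟨_, a, w, hw, rfl, rfl⟩

/-- Every vertex has no neighbor, or exactly two. -/
def IsTwoRegular (G : SimpleGraph V) : Prop :=
  ∀ x y, G.Adj x y → ∃ z, z ≠ y ∧ ∀ u, G.Adj x u ↔ u = y ∨ u = z

namespace IsTwoRegular

variable (hX : X.IsTwoRegular)
include hX

/-- A cycle uses up all the edges at its vertices. -/
theorem mem_of_adj (h : γ ∈ X.cycleSets) {x y : V} (hx : x ∈ curveVerts γ) (hxy : X.Adj x y) :
    s(x, y) ∈ γ := by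
  obtain ⟨u, hu⟩ := hx
  have hs := subset_of_mem_cycleSets h
  obtain ⟨z, hz, hn⟩ := hX x u (hs hu)
  obtain ⟨z', hz', hn'⟩ := (isCurve_of_mem_cycleSets h).nbr x u hu
  have : z' = z := ((hn z').1 (hs ((hn' z').2 (Or.inr rfl)))).resolve_left hz'
  subst this
  exact (hn' y).2 ((hn y).1 hxy)

theorem mem_curveVerts_of_reachable (h : γ ∈ X.cycleSets) {x y : V} (hx : x ∈ curveVerts γ)
    (hxy : X.Reachable x y) : y ∈ curveVerts γ := by
  obtain ⟨w⟩ := hxy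
  induction w with
  | nil => exact hx
  | cons hadj _ ih => exact ih (IsCurve.right_mem_curveVerts (hX.mem_of_adj h hx hadj))

/-- An edge lies in at most one cycle. -/
theorem eq_of_mem (h : γ ∈ X.cycleSets) (h' : δ ∈ X.cycleSets) {e : Sym2 V} (he : e ∈ γ)
    (he' : e ∈ δ) : γ = δ := by
  have key : ∀ {γ δ : Set (Sym2 V)}, γ ∈ X.cycleSets → δ ∈ X.cycleSets → e ∈ γ → e ∈ δ →
      γ ⊆ δ := by
    intro γ δ h h' he he'
    induction e with | _ a b
    rintro ⟨x, y⟩ hxy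
    have hx : x ∈ curveVerts δ := (isCurve_of_mem_cycleSets h).conn (curveVerts δ)
      (fun u v huv hu => IsCurve.right_mem_curveVerts
        (hX.mem_of_adj h' hu (subset_of_mem_cycleSets h huv))) a ⟨b, he⟩ x ⟨y, hxy⟩ ⟨b, he'⟩
    exact hX.mem_of_adj h' hx (subset_of_mem_cycleSets h hxy)
  exact (key h h' he he').antisymm (key h' h he' he)

end IsTwoRegular

/-! ### Joining four ends -/

/-- A finite graph in which the distinct vertices `p`, `q`, `r`, `s` have one neighbor and every
other vertex has none or two, and which does not contain the sides of the square `pqrs`. -/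
structure IsTangle (H : SimpleGraph V) (p q r s : V) : Prop where
  finite : H.edgeSet.Finite
  nodup : [p, q, r, s].Nodup
  ends : ∀ x ∈ [p, q, r, s], ∃ z, ∀ y, H.Adj x y ↔ y = z
  others : ∀ x ∉ [p, q, r, s], ∀ y, H.Adj x y → ∃ z, z ≠ y ∧ ∀ u, H.Adj x u ↔ u = y ∨ u = z
  notAdj₁ : ¬ H.Adj p q
  notAdj₂ : ¬ H.Adj q r
  notAdj₃ : ¬ H.Adj r s
  notAdj₄ : ¬ H.Adj s p

/-- The graph `H` together with the edges `pq` and `rs`. -/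
def addTwo (H : SimpleGraph V) (p q r s : V) : SimpleGraph V :=
  fromEdgeSet (H.edgeSet ∪ {s(p, q), s(r, s)})

namespace IsTangle

variable {p q r s : V}

theorem rotate (h : H.IsTangle p q r s) : H.IsTangle q r s p where
  finite := h.finite
  nodup := by have := h.nodup; simp only [List.nodup_cons, List.mem_cons] at this ⊢; grind
  ends x hx := h.ends x (by simp only [List.mem_cons] at hx ⊢; tauto)
  others x hx := h.others x (by simp only [List.mem_cons] at hx ⊢; tauto)
  notAdj₁ := h.notAdj₂
  notAdj₂ := h.notAdj₃
  notAdj₃ := h.notAdj₄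
  notAdj₄ := h.notAdj₁

theorem ne (h : H.IsTangle p q r s) : p ≠ q ∧ p ≠ r ∧ p ≠ s ∧ q ≠ r ∧ q ≠ s ∧ r ≠ s := by
  have := h.nodup
  simp only [List.nodup_cons, List.mem_cons, List.not_mem_nil, or_false, not_or] at this
  tauto

theorem mem_edgeSet_addTwo (h : H.IsTangle p q r s) {e : Sym2 V} :
    e ∈ (H.addTwo p q r s).edgeSet ↔ e ∈ H.edgeSet ∨ e = s(p, q) ∨ e = s(r, s) := by
  obtain ⟨h1, -, -, -, -, h6⟩ := h.ne
  unfold addTwo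
  rw [edgeSet_fromEdgeSet]
  constructor
  · rintro ⟨h, -⟩; exact h
  · refine fun he => ⟨he, fun hd => ?_⟩
    rcases he with he | rfl | rfl
    · exact H.not_isDiag_of_mem_edgeSet he hd
    · exact h1 (Sym2.mk_isDiag_iff.1 hd)
    · exact h6 (Sym2.mk_isDiag_iff.1 hd)

theorem le_addTwo (h : H.IsTangle p q r s) : H ≤ H.addTwo p q r s :=
  edgeSet_subset_edgeSet.1 fun _ he => h.mem_edgeSet_addTwo.2 (Or.inl he)

theorem addTwo_adj (h : H.IsTangle p q r s) {x y : V} :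
    (H.addTwo p q r s).Adj x y ↔ H.Adj x y ∨ s(x, y) = s(p, q) ∨ s(x, y) = s(r, s) := by
  rw [← mem_edgeSet, h.mem_edgeSet_addTwo, mem_edgeSet]

theorem addTwo_comm : H.addTwo r s p q = H.addTwo p q r s := by
  unfold addTwo; rw [Set.pair_comm]

theorem isTwoRegular (h : H.IsTangle p q r s) : (H.addTwo p q r s).IsTwoRegular := by
  obtain ⟨h1, h2, h3, h4, h5, h6⟩ := h.ne
  -- an end `x` of `H` with the additional neighbor `x'`
  have key : ∀ x x', (∃ z, ∀ y, H.Adj x y ↔ y = z) → ¬ H.Adj x x' →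
      (∀ y, (H.addTwo p q r s).Adj x y ↔ H.Adj x y ∨ y = x') →
      ∀ y, (H.addTwo p q r s).Adj x y → ∃ z, z ≠ y ∧
        ∀ u, (H.addTwo p q r s).Adj x u ↔ u = y ∨ u = z := by
    rintro x x' ⟨z, hz⟩ hn hadj y hy
    have hzx : z ≠ x' := fun e => hn ((hz x').2 e.symm)
    rcases (hadj y).1 hy with hy | rfl
    · obtain rfl := (hz y).1 hy
      exact ⟨x', hzx.symm, fun u => by rw [hadj, hz]⟩
    · exact ⟨z, hzx, fun u => by rw [hadj, hz, or_comm]⟩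
  intro x y hxy
  by_cases hx : x ∈ [p, q, r, s]
  · have hends := h.ends x hx
    simp only [List.mem_cons, List.not_mem_nil, or_false] at hx
    rcases hx with rfl | rfl | rfl | rfl
    · refine key x q hends h.notAdj₁ (fun y => ?_) y hxy
      rw [h.addTwo_adj, Sym2.eq_iff, Sym2.eq_iff]
      tauto
    · refine key x p hends (fun hc => h.notAdj₁ hc.symm) (fun y => ?_) y hxy
      rw [h.addTwo_adj, Sym2.eq_iff, Sym2.eq_iff]
      tauto
    · refine key x s hends h.notAdj₃ (fun y => ?_) y hxy
      rw [h.addTwo_adj, Sym2.eq_iff, Sym2.eq_iff]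
      tauto
    · refine key x r hends (fun hc => h.notAdj₃ hc.symm) (fun y => ?_) y hxy
      rw [h.addTwo_adj, Sym2.eq_iff, Sym2.eq_iff]
      tauto
  · have hx' := hx
    simp only [List.mem_cons, List.not_mem_nil, or_false, not_or] at hx'
    have hadj : ∀ u, (H.addTwo p q r s).Adj x u ↔ H.Adj x u := fun u => by
      rw [h.addTwo_adj, Sym2.eq_iff, Sym2.eq_iff]
      tauto
    obtain ⟨z, hz, hn⟩ := h.others x hx y ((hadj y).1 hxy)
    exact ⟨z, hz, fun u => (hadj u).trans (hn u)⟩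

/-- By the handshaking lemma, the component of an end contains another end. -/
theorem exists_reachable (h : H.IsTangle p q r s) {x : V} (hx : x ∈ [p, q, r, s]) :
    ∃ y ∈ [p, q, r, s], y ≠ x ∧ H.Reachable x y := by
  classical
  set S : Set V := {y | H.Reachable x y} with hS
  have hfin : S.Finite := by
    refine ((Set.finite_singleton x).union
      (h.finite.biUnion fun e _ => e.toFinset.finite_toSet)).subset ?_
    intro y hy
    by_cases hyx : y = x
    · exact Or.inl hyx
    · right
      have hy : H.Reachable x y := hy
      obtain ⟨w⟩ := hy.symm
      cases w with
      | nil => exact absurd rfl hyx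
      | @cons _ v _ hadj w =>
        rw [Set.mem_iUnion₂]
        exact ⟨s(y, v), hadj, by simp⟩
  have : Fintype S := hfin.fintype
  have hdeg : ∀ y : S, (H.induce S).degree y = (H.neighborSet y).ncard := by
    intro y
    rw [← card_neighborSet_eq_degree, ← Nat.card_eq_fintype_card, Nat.card_coe_set_eq,
      ← Set.ncard_image_of_injective
      ((H.induce S).neighborSet y) Subtype.val_injective]
    congr 1
    ext z
    simp only [Set.mem_image, mem_neighborSet, comap_adj, Function.Embedding.subtype_apply]
    constructor
    · rintro ⟨z, hz, rfl⟩; exact hz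
    · intro hz
      exact ⟨⟨z, y.2.trans hz.reachable⟩, hz, rfl⟩
  -- The vertices of odd degree are the ends.
  have hodd : ∀ y : S, Odd ((H.induce S).degree y) ↔ y.1 ∈ [p, q, r, s] := by
    intro y
    rw [hdeg]
    constructor
    · intro hy
      by_contra hn
      obtain ⟨z, hz⟩ := (Set.ncard_pos (Set.finite_of_ncard_ne_zero hy.pos.ne')).1 hy.pos
      obtain ⟨z', hz', hu⟩ := h.others y.1 hn z hz
      have : H.neighborSet y.1 = {z, z'} := Set.ext fun u => hu u
      rw [this, Set.ncard_pair hz'.symm] at hy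
      exact absurd hy (by decide)
    · intro hy
      obtain ⟨z, hz⟩ := h.ends y.1 hy
      have : H.neighborSet y.1 = {z} := Set.ext fun u => hz u
      rw [this, Set.ncard_singleton]
      exact odd_one
  obtain ⟨y, hy, hy'⟩ := (H.induce S).exists_ne_odd_degree_of_exists_odd_degree
    ⟨x, Reachable.refl x⟩ ((hodd _).2 hx)
  exact ⟨y, (hodd y).1 hy', fun e => hy (Subtype.ext e), y.2⟩

/-- The edge `pq` closes up an arc from `q` to `p`. -/
theorem closing_mem (h : H.IsTangle p q r s) {α : H.Walk q p} (hα : α.IsPath) :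
    closing α ∈ (H.addTwo p q r s).cycleSets := by
  have hadj : (H.addTwo p q r s).Adj p q := h.addTwo_adj.2 (Or.inr (Or.inl rfl))
  refine ⟨p, Walk.cons hadj (α.mapLe h.le_addTwo), (Walk.cons_isCycle_iff _ _).2
    ⟨Walk.isPath_mapLe _ |>.2 hα, fun hc => ?_⟩, ?_⟩
  · rw [Walk.edges_mapLe_eq_edges] at hc
    exact h.notAdj₁ (α.edges_subset_edgeSet hc)
  · ext e
    simp [closing]

/-- If `p` and `q` are joined by an arc, then so are `r` and `s`, by another one. -/
theorem exists_arcs (h : H.IsTangle p q r s) (hqp : H.Reachable q p) :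
    ∃ (α : H.Walk q p) (β : H.Walk s r), α.IsPath ∧ β.IsPath ∧ ∀ x ∈ α.support, x ∉ β.support := by
  obtain ⟨α, hα⟩ := hqp.exists_isPath
  obtain ⟨h1, h2, h3, h4, h5, h6⟩ := h.ne
  have hγ := h.closing_mem hα
  have hmem : ∀ x ∈ α.support, x ∈ curveVerts (closing α) := by
    intro x hx
    rw [Walk.mem_support_iff_exists_mem_edges] at hx
    rcases hx with rfl | ⟨e, he, hxe⟩
    · exact ⟨q, Or.inl rfl⟩
    · exact IsCurve.mem_curveVerts_of_mem (γ := closing α) (Or.inr he) hxe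
  -- The closed arc is a cycle of the graph with the edges `pq` and `rs`, in which it is a whole
  -- component, and it does not contain `rs`.
  have hs : s ∉ curveVerts (closing α) := by
    intro hc
    have : s(s, r) ∈ closing α := h.isTwoRegular.mem_of_adj hγ hc
      (h.addTwo_adj.2 (Or.inr (Or.inr Sym2.eq_swap)))
    rcases this with hc | hc
    · rcases Sym2.eq_iff.1 hc with ⟨e, -⟩ | ⟨e, -⟩
      exacts [h3 e.symm, h5 e.symm]
    · exact h.notAdj₃ (α.edges_subset_edgeSet hc).symm
  obtain ⟨y, hy, hys, hr⟩ := h.exists_reachable (x := s) (by simp)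
  have hno : ∀ x ∈ α.support, ¬ H.Reachable s x := fun x hx hc =>
    hs (h.isTwoRegular.mem_curveVerts_of_reachable hγ (hmem x hx) (hc.symm.mono h.le_addTwo))
  simp only [List.mem_cons, List.not_mem_nil, or_false] at hy
  rcases hy with rfl | rfl | rfl | rfl
  · exact absurd hr (hno _ α.end_mem_support)
  · exact absurd hr (hno _ α.start_mem_support)
  · obtain ⟨β, hβ⟩ := hr.exists_isPath
    exact ⟨α, β, hα, hβ, fun x hx hx' => hno x hx (β.takeUntil x hx').reachable⟩
  · exact absurd rfl hys

/-- The four ends are joined in pairs, in one of three ways. -/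
theorem trichotomy (h : H.IsTangle p q r s) :
    (∃ (α : H.Walk q p) (β : H.Walk s r), α.IsPath ∧ β.IsPath ∧ ∀ x ∈ α.support, x ∉ β.support) ∨
    (∃ (α : H.Walk p s) (β : H.Walk r q), α.IsPath ∧ β.IsPath ∧ ∀ x ∈ α.support, x ∉ β.support) ∨
    (∃ (α : H.Walk p r) (β : H.Walk q s), α.IsPath ∧ β.IsPath ∧ ∀ x ∈ α.support,
      x ∉ β.support) := by
  by_cases h1 : H.Reachable q p
  · exact Or.inl (h.exists_arcs h1)
  by_cases h2 : H.Reachable p s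
  · exact Or.inr (Or.inl (h.rotate.rotate.rotate.exists_arcs h2))
  have h3 : H.Reachable p r := by
    obtain ⟨y, hy, hyp, hr⟩ := h.exists_reachable (x := p) (by simp)
    simp only [List.mem_cons, List.not_mem_nil, or_false] at hy
    rcases hy with rfl | rfl | rfl | rfl
    exacts [absurd rfl hyp, absurd hr.symm h1, hr, absurd hr h2]
  have h4 : H.Reachable q s := by
    obtain ⟨y, hy, hyp, hr⟩ := h.exists_reachable (x := q) (by simp)
    simp only [List.mem_cons, List.not_mem_nil, or_false] at hy
    rcases hy with rfl | rfl | rfl | rfl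
    exacts [absurd hr h1, absurd rfl hyp, absurd (hr.trans h3.symm) h1, hr]
  obtain ⟨α, hα⟩ := h3.exists_isPath
  obtain ⟨β, hβ⟩ := h4.exists_isPath
  refine Or.inr (Or.inr ⟨α, β, hα, hβ, fun x hx hx' => h1 ?_⟩)
  exact (β.takeUntil x hx').reachable.trans (α.takeUntil x hx).reachable.symm

end IsTangle

end SimpleGraph

namespace SimpleGraph

variable {V : Type*} [DecidableEq V]

open PreAbstractSimplicialComplex

open scoped symmDiff

variable {H X : SimpleGraph V}

/-! ### The change of the circles at a crossing -/

theorem joining_mem_cycleSets {p q r s : V} (hHX : H ≤ X) {α : H.Walk q p} {β : H.Walk s r}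
    (hα : α.IsPath) (hβ : β.IsPath) (hd : ∀ x ∈ α.support, x ∉ β.support) (hrs : r ≠ s)
    (h₁ : X.Adj q r) (h₂ : X.Adj p s) : joining α β ∈ X.cycleSets := by
  have hs : ((α.mapLe hHX).append (Walk.cons h₂ (β.mapLe hHX))).support =
      α.support ++ β.support := by
    rw [Walk.support_append, Walk.support_cons, List.tail_cons, Walk.support_mapLe_eq_support,
      Walk.support_mapLe_eq_support]
  refine ⟨r, Walk.cons h₁.symm ((α.mapLe hHX).append (Walk.cons h₂ (β.mapLe hHX))),
    (Walk.cons_isCycle_iff _ _).2 ⟨?_, ?_⟩, ?_⟩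
  · rw [Walk.isPath_def, hs]
    exact List.Nodup.append hα.support_nodup hβ.support_nodup fun x hx hx' => hd x hx hx'
  · rw [Walk.edges_append, Walk.edges_cons, List.mem_append, List.mem_cons,
      Walk.edges_mapLe_eq_edges, Walk.edges_mapLe_eq_edges]
    rintro (hc | hc | hc)
    · exact hd r (α.fst_mem_support_of_mem_edges hc) β.end_mem_support
    · rcases Sym2.eq_iff.1 hc with ⟨h, -⟩ | ⟨h, -⟩
      · subst h; exact hd _ α.end_mem_support β.end_mem_support
      · exact hrs h
    · exact hd q α.start_mem_support (β.snd_mem_support_of_mem_edges hc)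
  · ext e
    simp only [joining, Walk.edges_cons, Walk.edges_append, List.mem_cons,
      List.mem_append, Set.mem_union, Set.mem_insert_iff, Set.mem_singleton_iff, Set.mem_ofPred_eq,
      Sym2.eq_swap (a := r), Sym2.eq_swap (a := p), Walk.edges_mapLe_eq_edges]
    tauto

namespace IsTangle

variable {p q r s : V}

theorem notMem_iff (h : H.IsTangle p q r s) {γ : Set (Sym2 V)}
    (hγ : γ ∈ (H.addTwo p q r s).cycleSets) :
    γ ∉ (H.addTwo q r s p).cycleSets ↔ s(p, q) ∈ γ ∨ s(r, s) ∈ γ := by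
  obtain ⟨h1, h2, h3, h4, h5, h6⟩ := h.ne
  constructor
  · intro hn
    by_contra hcon
    rw [not_or] at hcon
    refine hn (mem_cycleSets_of_subset hγ fun e he => edgeSet_mono h.rotate.le_addTwo ?_)
    rcases h.mem_edgeSet_addTwo.1 (subset_of_mem_cycleSets hγ he) with h | rfl | rfl
    exacts [h, absurd he hcon.1, absurd he hcon.2]
  · rintro (hc | hc) hn
    · rcases h.rotate.addTwo_adj.1 (subset_of_mem_cycleSets hn hc) with hc | hc | hc
      · exact h.notAdj₁ hc
      · rcases Sym2.eq_iff.1 hc with ⟨e, -⟩ | ⟨e, -⟩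
        exacts [h1 e, h2 e]
      · rcases Sym2.eq_iff.1 hc with ⟨e, -⟩ | ⟨-, e⟩
        exacts [h3 e, h5 e]
    · rcases h.rotate.addTwo_adj.1 (subset_of_mem_cycleSets hn hc) with hc | hc | hc
      · exact h.notAdj₃ hc
      · rcases Sym2.eq_iff.1 hc with ⟨e, -⟩ | ⟨-, e⟩
        exacts [h4 e.symm, h5 e.symm]
      · rcases Sym2.eq_iff.1 hc with ⟨e, -⟩ | ⟨e, -⟩
        exacts [h6 e, h2 e.symm]

section Merge

variable {α : H.Walk q p} {β : H.Walk s r} (h : H.IsTangle p q r s) (hα : α.IsPath)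
  (hβ : β.IsPath) (hd : ∀ x ∈ α.support, x ∉ β.support)
include h hα hβ hd

theorem merge_right : closing β ∈ (H.addTwo p q r s).cycleSets := by
  have := h.rotate.rotate.closing_mem hβ
  rwa [addTwo_comm] at this

theorem merge_total : joining α β ∈ (H.addTwo q r s p).cycleSets :=
  joining_mem_cycleSets h.rotate.le_addTwo hα hβ hd h.ne.2.2.2.2.2
    (h.rotate.addTwo_adj.2 (Or.inr (Or.inl rfl)))
    (h.rotate.addTwo_adj.2 (Or.inr (Or.inr Sym2.eq_swap)))

theorem merge_before (γ : Set (Sym2 V)) :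
    γ ∈ (H.addTwo p q r s).cycleSets ∧ γ ∉ (H.addTwo q r s p).cycleSets ↔
      γ = closing α ∨ γ = closing β := by
  have e1 := h.closing_mem hα
  have e2 := merge_right h hα hβ hd
  constructor
  · rintro ⟨h1, h2⟩
    rcases (h.notMem_iff h1).1 h2 with hc | hc
    · exact Or.inl (h.isTwoRegular.eq_of_mem h1 e1 hc (Or.inl rfl))
    · exact Or.inr (h.isTwoRegular.eq_of_mem h1 e2 hc (Or.inl rfl))
  · rintro (rfl | rfl)
    · exact ⟨e1, (h.notMem_iff e1).2 (Or.inl (Or.inl rfl))⟩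
    · exact ⟨e2, (h.notMem_iff e2).2 (Or.inr (Or.inl rfl))⟩

theorem merge_after (γ : Set (Sym2 V)) :
    γ ∈ (H.addTwo q r s p).cycleSets ∧ γ ∉ (H.addTwo p q r s).cycleSets ↔
      γ = joining α β := by
  have e1 := merge_total h hα hβ hd
  have e2 : H.addTwo r s p q = H.addTwo p q r s := addTwo_comm
  rw [← e2]
  constructor
  · rintro ⟨h1, h2⟩
    rcases (h.rotate.notMem_iff h1).1 h2 with hc | hc
    · exact h.rotate.isTwoRegular.eq_of_mem h1 e1 hc (Or.inl (Or.inl rfl))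
    · exact h.rotate.isTwoRegular.eq_of_mem h1 e1 hc (Or.inl (Or.inr rfl))
  · rintro rfl
    exact ⟨e1, (h.rotate.notMem_iff e1).2 (Or.inl (Or.inl (Or.inl rfl)))⟩

theorem closing_ne : closing α ≠ closing β := fun e =>
  hd q α.start_mem_support (IsArcPair.mem_support_of_mem_curveVerts
    (e ▸ IsCurve.right_mem_curveVerts (Or.inl rfl : s(p, q) ∈ closing α)))

theorem isArcPair {K : PreAbstractSimplicialComplex V} (hH : H ≤ K.oneSkeleton) {o : V}
    (sq : K.IsSquare o p q r s) (ho : ∀ x, ¬ H.Adj o x) :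
    IsArcPair o p q r s (α.mapLe hH) (β.mapLe hH) := by
  have key : ∀ {u v : V} (w : H.Walk u v), o ≠ u → o ∉ w.support := by
    intro u v w hne hc
    cases (w.takeUntil o hc).reverse with
    | nil => exact hne rfl
    | cons hadj _ => exact ho _ hadj
  refine ⟨sq, Walk.isPath_mapLe _ |>.2 hα, Walk.isPath_mapLe _ |>.2 hβ, ?_, ?_, ?_, ?_, ?_⟩ <;>
    simp only [Walk.support_mapLe_eq_support, Walk.edges_mapLe_eq_edges]
  · exact hd
  · exact key α sq.ne.2.1
  · exact key β sq.ne.2.2.2.1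
  · exact fun hc => h.notAdj₁ (α.edges_subset_edgeSet hc)
  · exact fun hc => h.notAdj₃ (β.edges_subset_edgeSet hc)

end Merge

theorem joining_reverse {G : SimpleGraph V} {p q r s : V} (α : G.Walk p r) (β : G.Walk q s)
    (e : Sym2 V) : e ∈ joining α β.reverse ↔
      (e = s(p, q) ∨ e = s(r, s)) ∨ (e ∈ α.edges ∨ e ∈ β.edges) := by
  simp only [joining, Set.mem_union, Set.mem_insert_iff, Set.mem_singleton_iff, Set.mem_ofPred_eq,
    Walk.edges_reverse, List.mem_reverse, Sym2.eq_swap (a := s)]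

section Flip

variable {α : H.Walk p r} {β : H.Walk q s} (h : H.IsTangle p q r s) (hα : α.IsPath)
  (hβ : β.IsPath) (hd : ∀ x ∈ α.support, x ∉ β.support)
include h hα hβ hd

theorem flip_left : joining α β.reverse ∈ (H.addTwo p q r s).cycleSets :=
  joining_mem_cycleSets h.le_addTwo hα hβ.reverse (by simpa using hd) h.ne.2.2.2.2.1
    (h.addTwo_adj.2 (Or.inr (Or.inl rfl)))
    (h.addTwo_adj.2 (Or.inr (Or.inr rfl)))

theorem flip_before (γ : Set (Sym2 V)) :
    γ ∈ (H.addTwo p q r s).cycleSets ∧ γ ∉ (H.addTwo q r s p).cycleSets ↔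
      γ = joining α β.reverse := by
  have e1 := flip_left h hα hβ hd
  constructor
  · rintro ⟨h1, h2⟩
    rcases (h.notMem_iff h1).1 h2 with hc | hc
    · exact h.isTwoRegular.eq_of_mem h1 e1 hc ((joining_reverse _ _ _).2 (by simp))
    · exact h.isTwoRegular.eq_of_mem h1 e1 hc ((joining_reverse _ _ _).2 (by simp))
  · rintro rfl
    exact ⟨e1, (h.notMem_iff e1).2 (Or.inl ((joining_reverse _ _ _).2 (by simp)))⟩

theorem isTwist {K : PreAbstractSimplicialComplex V} (hH : H ≤ K.oneSkeleton) {o : V}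
    (sq : K.IsSquare o p q r s) (ho : ∀ x, ¬ H.Adj o x) :
    K.IsTwist o p q r s (joining α β.reverse) (joining β α.reverse.reverse) := by
  have e1 := flip_left h hα hβ hd
  have e2 := flip_left h.rotate hβ hα.reverse (by simpa using fun x hx hx' => hd x hx' hx)
  have le1 : H.addTwo p q r s ≤ K.oneSkeleton := by
    intro x y hxy
    rcases h.addTwo_adj.1 hxy with hc | hc | hc
    · exact hH hc
    · rw [← mem_edgeSet, hc]; exact sq.adj
    · rw [← mem_edgeSet, hc]; exact sq.rotate.rotate.adj
  have le2 : H.addTwo q r s p ≤ K.oneSkeleton := by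
    intro x y hxy
    rcases h.rotate.addTwo_adj.1 hxy with hc | hc | hc
    · exact hH hc
    · rw [← mem_edgeSet, hc]; exact sq.rotate.adj
    · rw [← mem_edgeSet, hc]; exact sq.rotate.rotate.rotate.adj
  obtain ⟨h1, h2, h3, h4, h5, h6⟩ := h.ne
  have d1 : s(p, q) ≠ s(q, r) := by simp; tauto
  have d2 : s(p, q) ≠ s(s, p) := by simp; tauto
  have d3 : s(r, s) ≠ s(q, r) := by simp; tauto
  have d4 : s(r, s) ≠ s(s, p) := by simp; tauto
  have n : ∀ {e : Sym2 V}, e ∈ α.edges ∨ e ∈ β.edges → e ∈ H.edgeSet := fun he =>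
    he.elim (fun he => α.edges_subset_edgeSet he) fun he => β.edges_subset_edgeSet he
  refine ⟨sq, isSimpleClosedCurve_of_mem_cycleSets le1 e1,
    isSimpleClosedCurve_of_mem_cycleSets le2 e2, ?_, ?_, ?_, ?_, ?_, ?_⟩
  · rintro ⟨y, hy⟩
    obtain ⟨o1, o2, o3, o4, -⟩ := sq.ne
    rcases h.addTwo_adj.1 (subset_of_mem_cycleSets e1 hy) with hc | hc | hc
    · exact ho _ hc
    · rcases Sym2.eq_iff.1 hc with ⟨e, -⟩ | ⟨e, -⟩
      exacts [o1 e, o2 e]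
    · rcases Sym2.eq_iff.1 hc with ⟨e, -⟩ | ⟨e, -⟩
      exacts [o3 e, o4 e]
  · exact (joining_reverse _ _ _).2 (by simp)
  · exact (joining_reverse _ _ _).2 (by simp)
  · intro hc
    rcases (joining_reverse _ _ _).1 hc with (hc | hc) | hc
    exacts [d1 hc.symm, d3 hc.symm, h.notAdj₂ (n hc)]
  · intro hc
    rcases (joining_reverse _ _ _).1 hc with (hc | hc) | hc
    exacts [d2 hc.symm, d4 hc.symm, h.notAdj₄ (n hc)]
  · ext e
    rw [Set.mem_symmDiff, joining_reverse, joining_reverse, Walk.edges_reverse, List.mem_reverse]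
    simp only [sides4, Set.mem_insert_iff, Set.mem_singleton_iff]
    have n1 : ¬ (s(p, q) ∈ α.edges ∨ s(p, q) ∈ β.edges) := fun hc => h.notAdj₁ (n hc)
    have n2 : ¬ (s(q, r) ∈ α.edges ∨ s(q, r) ∈ β.edges) := fun hc => h.notAdj₂ (n hc)
    have n3 : ¬ (s(r, s) ∈ α.edges ∨ s(r, s) ∈ β.edges) := fun hc => h.notAdj₃ (n hc)
    have n4 : ¬ (s(s, p) ∈ α.edges ∨ s(s, p) ∈ β.edges) := fun hc => h.notAdj₄ (n hc)
    by_cases c1 : e = s(p, q)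
    · subst c1; tauto
    by_cases c2 : e = s(r, s)
    · subst c2; tauto
    by_cases c3 : e = s(q, r)
    · subst c3; tauto
    by_cases c4 : e = s(s, p)
    · subst c4; tauto
    tauto

end Flip

/-- After the crossing is smoothed, each of the two new edges lies in a circle. -/
theorem exists_mem_cycleSets (h : H.IsTangle p q r s) {e : Sym2 V}
    (he : e = s(p, q) ∨ e = s(r, s)) : ∃ γ ∈ (H.addTwo p q r s).cycleSets, e ∈ γ := by
  rcases h.trichotomy with ⟨α, β, hα, hβ, hd⟩ | ⟨α, β, hα, hβ, hd⟩ | ⟨α, β, hα, hβ, hd⟩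
  · rcases he with rfl | rfl
    · exact ⟨_, h.closing_mem hα, Or.inl rfl⟩
    · exact ⟨_, merge_right h hα hβ hd, Or.inl rfl⟩
  · have e1 := merge_total h.rotate.rotate.rotate hα hβ hd
    refine ⟨_, e1, Or.inl ?_⟩
    exact he
  · exact ⟨_, flip_left h hα hβ hd, (joining_reverse _ _ _).2 (Or.inl he)⟩

open ColoredCircles in
/-- The circles before and after a crossing is smoothed in the other way form a transition of
colored circles. -/
theorem transition [DecidableEq (Set (Sym2 V))] (h : H.IsTangle p q r s)
    {K : PreAbstractSimplicialComplex V} (hK : K.IsSurface) (hconn : K.IsConnected)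
    (hH : H ≤ K.oneSkeleton) {o : V} (sq : K.IsSquare o p q r s) (ho : ∀ x, ¬ H.Adj o x)
    {A B : Finset (Set (Sym2 V))} (hA : ∀ γ, γ ∈ A ↔ γ ∈ (H.addTwo p q r s).cycleSets)
    (hB : ∀ γ, γ ∈ B ↔ γ ∈ (H.addTwo q r s p).cycleSets) :
    Transition K.color K.IsProjectivePlane A B := by
  rcases h.trichotomy with ⟨α, β, hα, hβ, hd⟩ | ⟨α, β, hα, hβ, hd⟩ | ⟨α, β, hα, hβ, hd⟩
  · refine .merge (closing α) (closing β) (joining α β) (closing_ne h hα hβ hd) ?_ ?_ ?_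
    · ext γ
      rw [Finset.mem_sdiff, hA, hB, merge_before h hα hβ hd]
      simp
    · ext γ
      rw [Finset.mem_sdiff, hA, hB, merge_after h hα hβ hd]
      simp
    · have := (isArcPair h hα hβ hd hH sq ho).triple hK hconn
      simpa [closing, joining] using this
  · have h' := h.rotate.rotate.rotate
    have e : H.addTwo q r s p = H.addTwo s p q r := addTwo_comm
    refine .split (joining α β) (closing α) (closing β) (closing_ne h' hα hβ hd) ?_ ?_ ?_
    · ext γ
      rw [Finset.mem_sdiff, hA, hB, e, merge_after h' hα hβ hd]
      simp
    · ext γ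
      rw [Finset.mem_sdiff, hA, hB, e, merge_before h' hα hβ hd]
      simp
    · have := (isArcPair h' hα hβ hd hH sq.rotate.rotate.rotate ho).triple hK hconn
      simpa [closing, joining] using this
  · have e : H.addTwo r s p q = H.addTwo p q r s := addTwo_comm
    refine .flip (joining α β.reverse) (joining β α.reverse.reverse) ?_ ?_ ?_
    · ext γ
      rw [Finset.mem_sdiff, hA, hB, flip_before h hα hβ hd]
      simp
    · ext γ
      rw [Finset.mem_sdiff, hA, hB, ← e, flip_before h.rotate hβ hα.reverse
        (by simpa using fun x hx hx' => hd x hx' hx)]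
      simp
    · exact (isTwist h hα hβ hd hH sq ho).color hK hconn

end IsTangle

end SimpleGraph

namespace LinkDiagram

open PreAbstractSimplicialComplex SimpleGraph

variable {V : Type*} [DecidableEq V] {F : PreAbstractSimplicialComplex V} {n : ℕ}
  (D : LinkDiagram F n)

/-! ### The circles of a link diagram -/

/-- The edges of the diagram away from the crossings. -/
def farEdges : Set (Sym2 V) := {e | e ∈ D.graph.edgeSet ∧ ∀ i, D.center i ∉ e}

/-- The result of smoothing all the crossings but `v`, with the square around `v` removed. -/
def smoothingOff (m : Fin n → ℤˣ) (v : Fin n) : SimpleGraph V :=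
  fromEdgeSet (D.farEdges ∪ ⋃ i ∈ ({v}ᶜ : Set (Fin n)), D.smoothingArcs i (m i))

variable {D} {m m' : Fin n → ℤˣ} {v w : Fin n} {e : Sym2 V} {γ : Set (Sym2 V)}

theorem corner_eq_iff {i j : Fin n} {k l : Fin 4} :
    D.corner i k = D.corner j l ↔ i = j ∧ k = l := by
  constructor
  · intro h
    have := @D.corner_injective (i, k) (j, l) h
    simpa using this
  · rintro ⟨rfl, rfl⟩; rfl

theorem exists_of_mem_smoothingArcs {i : Fin n} {ε : ℤˣ} (h : e ∈ D.smoothingArcs i ε) :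
    ∃ k, e = s(D.corner i k, D.corner i (k + 1)) := by
  unfold smoothingArcs at h
  split_ifs at h <;> rcases h with h | h
  exacts [⟨1, h⟩, ⟨3, h⟩, ⟨0, h⟩, ⟨2, h⟩]

theorem eq_of_mem_smoothingArcs {i j : Fin n} {ε ε' : ℤˣ} (h : e ∈ D.smoothingArcs i ε)
    (h' : e ∈ D.smoothingArcs j ε') : i = j ∧ ε = ε' := by
  have hij : i = j := by
    obtain ⟨k, rfl⟩ := exists_of_mem_smoothingArcs h
    obtain ⟨l, hl⟩ := exists_of_mem_smoothingArcs h'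
    rcases Sym2.eq_iff.1 hl with ⟨h, -⟩ | ⟨h, -⟩ <;> exact (corner_eq_iff.1 h).1
  refine ⟨hij, ?_⟩
  subst hij
  have key : ∀ {e}, e ∈ D.smoothingArcs i 1 → e ∉ D.smoothingArcs i (-1) := by
    intro e h h'
    unfold smoothingArcs at h h'
    rw [if_pos rfl] at h
    rw [if_neg (by decide)] at h'
    rcases h with rfl | rfl <;> rcases h' with h' | h' <;>
      simp [corner_eq_iff] at h'
  rcases Int.units_eq_one_or ε with rfl | rfl <;> rcases Int.units_eq_one_or ε' with rfl | rfl
  exacts [rfl, absurd h' (key h), absurd h (key h'), rfl]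

theorem notMem_farEdges {i : Fin n} {ε : ℤˣ} (h : e ∈ D.smoothingArcs i ε) : e ∉ D.farEdges := by
  obtain ⟨k, rfl⟩ := exists_of_mem_smoothingArcs h
  exact fun hc => D.not_adj_corner i k hc.1

theorem not_isDiag_of_mem_smoothingArcs {i : Fin n} {ε : ℤˣ} (h : e ∈ D.smoothingArcs i ε) :
    ¬ e.IsDiag := by
  obtain ⟨k, rfl⟩ := exists_of_mem_smoothingArcs h
  rw [Sym2.mk_isDiag_iff, corner_eq_iff]
  have : ∀ k : Fin 4, k ≠ k + 1 := by decide
  exact fun hc => this k hc.2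

theorem mem_edgeSet_smoothing :
    e ∈ (D.smoothing m).edgeSet ↔ e ∈ D.farEdges ∨ ∃ i, e ∈ D.smoothingArcs i (m i) := by
  unfold smoothing
  rw [edgeSet_fromEdgeSet, Set.mem_sdiff, Set.mem_union, Set.mem_iUnion]
  refine ⟨fun h => h.1, fun h => ⟨h, fun hd => ?_⟩⟩
  rcases h with h | ⟨i, h⟩
  · exact D.graph.not_isDiag_of_mem_edgeSet h.1 hd
  · exact not_isDiag_of_mem_smoothingArcs h hd

theorem mem_edgeSet_smoothingOff : e ∈ (D.smoothingOff m v).edgeSet ↔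
    e ∈ D.farEdges ∨ ∃ i, i ≠ v ∧ e ∈ D.smoothingArcs i (m i) := by
  unfold smoothingOff
  rw [edgeSet_fromEdgeSet, Set.mem_sdiff, Set.mem_union, Set.mem_iUnion₂]
  simp only [Set.mem_compl_iff, Set.mem_singleton_iff, exists_prop]
  refine ⟨fun h => h.1, fun h => ⟨h, fun hd => ?_⟩⟩
  rcases h with h | ⟨i, -, h⟩
  · exact D.graph.not_isDiag_of_mem_edgeSet h.1 hd
  · exact not_isDiag_of_mem_smoothingArcs h hd

theorem smoothingOff_congr (h : ∀ u, u ≠ v → m u = m' u) :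
    D.smoothingOff m v = D.smoothingOff m' v := by
  rw [← edgeSet_inj]
  ext e
  rw [mem_edgeSet_smoothingOff, mem_edgeSet_smoothingOff]
  refine or_congr Iff.rfl (exists_congr fun i => and_congr_right fun hi => ?_)
  rw [h i hi]

/-- Each corner of a crossing has one further neighbor in the diagram. -/
theorem exists_far_neighbor (i : Fin n) (k : Fin 4) :
    ∃ z, ∀ y, s(D.corner i k, y) ∈ D.farEdges ↔ y = z := by
  have hc : D.graph.Adj (D.corner i k) (D.center i) := ((D.adj_center i _).2 ⟨k, rfl⟩).symm
  have hx : D.corner i k ∉ Set.range D.center := by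
    rintro ⟨j, hj⟩; exact D.corner_ne_center i k j hj.symm
  rcases D.degree _ hx with h | h
  · have : D.center i ∈ D.graph.neighborSet (D.corner i k) := hc
    rw [h] at this
    exact absurd this (Set.notMem_empty _)
  obtain ⟨z, hz, hn⟩ : ∃ z, z ≠ D.center i ∧ ∀ y, D.graph.Adj (D.corner i k) y ↔
      y = D.center i ∨ y = z := by
    obtain ⟨a, b, hab, hN⟩ := Set.encard_eq_two.1 h
    have hN' : ∀ y, D.graph.Adj (D.corner i k) y ↔ y = a ∨ y = b := fun y => by
      rw [← mem_neighborSet, hN]; simp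
    rcases (hN' _).1 hc with e | e
    · exact ⟨b, fun e' => hab (by rw [← e, e']), fun y => by rw [e]; exact hN' y⟩
    · exact ⟨a, fun e' => hab (by rw [← e, e']), fun y => by rw [e, or_comm]; exact hN' y⟩
  refine ⟨z, fun y => ⟨fun h => ?_, ?_⟩⟩
  · rcases (hn y).1 h.1 with rfl | rfl
    · exact absurd (Sym2.mem_mk_right _ _) (h.2 i)
    · rfl
  · rintro rfl
    refine ⟨(hn y).2 (Or.inr rfl), fun j hj => ?_⟩
    rcases Sym2.mem_iff.1 hj with hj | rfl
    · exact D.corner_ne_center i k j hj.symm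
    · obtain ⟨l, hl⟩ := (D.adj_center j _).1 ((hn _).2 (Or.inr rfl)).symm
      exact hz (by rw [(corner_eq_iff.1 hl).1])

/-- Each corner of a smoothed crossing is joined to one neighboring corner. -/
theorem exists_partner (i : Fin n) (k : Fin 4) (ε : ℤˣ) :
    ∃ l, (l = k + 1 ∨ k = l + 1) ∧
      ∀ y, s(D.corner i k, y) ∈ D.smoothingArcs i ε ↔ y = D.corner i l := by
  unfold smoothingArcs
  split_ifs
  · fin_cases k
    · exact ⟨3, by decide, fun y => by simp [corner_eq_iff]⟩
    · exact ⟨2, by decide, fun y => by simp [corner_eq_iff]⟩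
    · exact ⟨1, by decide, fun y => by simp [corner_eq_iff]⟩
    · exact ⟨0, by decide, fun y => by simp [corner_eq_iff]⟩
  · fin_cases k
    · exact ⟨1, by decide, fun y => by simp [corner_eq_iff]⟩
    · exact ⟨0, by decide, fun y => by simp [corner_eq_iff]⟩
    · exact ⟨3, by decide, fun y => by simp [corner_eq_iff]⟩
    · exact ⟨2, by decide, fun y => by simp [corner_eq_iff]⟩

theorem corner_mem_smoothingArcs {i j : Fin n} {k : Fin 4} {ε : ℤˣ} {y : V}
    (h : s(D.corner i k, y) ∈ D.smoothingArcs j ε) : j = i := by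
  obtain ⟨l, hl⟩ := exists_of_mem_smoothingArcs h
  rcases Sym2.eq_iff.1 hl with ⟨h, -⟩ | ⟨h, -⟩ <;> exact (corner_eq_iff.1 h).1.symm

theorem mem_corners_iff {i : Fin n} {x : V} :
    x ∈ [D.corner i 0, D.corner i 1, D.corner i 2, D.corner i 3] ↔ ∃ k, x = D.corner i k := by
  simp only [List.mem_cons, List.not_mem_nil, or_false]
  constructor
  · rintro (h | h | h | h)
    exacts [⟨0, h⟩, ⟨1, h⟩, ⟨2, h⟩, ⟨3, h⟩]
  · rintro ⟨k, rfl⟩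
    fin_cases k <;> simp

variable (D) in
/-- Without the crossing `v`, the smoothed diagram consists of circles and of two arcs whose ends
are the corners of `v`. -/
theorem isTangle (m : Fin n → ℤˣ) (v : Fin n) : (D.smoothingOff m v).IsTangle
    (D.corner v 0) (D.corner v 1) (D.corner v 2) (D.corner v 3) := by
  have hadj : ∀ x y, (D.smoothingOff m v).Adj x y ↔
      s(x, y) ∈ D.farEdges ∨ ∃ i, i ≠ v ∧ s(x, y) ∈ D.smoothingArcs i (m i) :=
    fun x y => by rw [← mem_edgeSet, mem_edgeSet_smoothingOff]
  have hnot : ∀ k, ¬ (D.smoothingOff m v).Adj (D.corner v k) (D.corner v (k + 1)) := by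
    intro k hc
    rcases (hadj _ _).1 hc with hc | ⟨i, hi, hc⟩
    · exact D.not_adj_corner v k hc.1
    · exact hi (corner_mem_smoothingArcs hc)
  refine ⟨?_, ?_, ?_, ?_, hnot 0, hnot 1, hnot 2, hnot 3⟩
  · have : (D.smoothingOff m v).edgeSet ⊆ D.farEdges ∪ ⋃ i, D.smoothingArcs i (m i) := by
      intro e he
      rcases mem_edgeSet_smoothingOff.1 he with h | ⟨i, -, h⟩
      exacts [Or.inl h, Or.inr (Set.mem_iUnion.2 ⟨i, h⟩)]
    refine (Set.Finite.union (D.finite.subset fun e he => he.1)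
      (Set.finite_iUnion fun i => ?_)).subset this
    unfold smoothingArcs
    split_ifs <;> exact Set.toFinite _
  · simp [corner_eq_iff]
  · intro x hx
    obtain ⟨k, rfl⟩ := mem_corners_iff.1 hx
    obtain ⟨z, hz⟩ := D.exists_far_neighbor v k
    refine ⟨z, fun y => ?_⟩
    rw [hadj, ← hz]
    refine or_iff_left ?_
    rintro ⟨i, hi, hc⟩
    exact hi (corner_mem_smoothingArcs hc)
  · intro x hx y hxy
    -- A corner of another crossing has one neighbor in the diagram and another one along an arc of
    -- the smoothing. At any other vertex, the graph agrees with the diagram.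
    by_cases hcor : ∃ i k, x = D.corner i k
    · obtain ⟨i, k, rfl⟩ := hcor
      have hiv : i ≠ v := by
        rintro rfl; exact hx (mem_corners_iff.2 ⟨k, rfl⟩)
      obtain ⟨z, hz⟩ := D.exists_far_neighbor i k
      obtain ⟨l, hl, hp⟩ := D.exists_partner i k (m i)
      have hN : ∀ u, (D.smoothingOff m v).Adj (D.corner i k) u ↔ u = z ∨ u = D.corner i l := by
        intro u
        rw [hadj, hz, ← hp]
        refine or_congr Iff.rfl ⟨?_, fun h => ⟨i, hiv, h⟩⟩
        rintro ⟨j, -, hj⟩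
        obtain rfl := corner_mem_smoothingArcs hj
        exact hj
      have hne : z ≠ D.corner i l := by
        intro hc
        have hfar := ((hz _).2 hc.symm).1
        rcases hl with rfl | rfl
        · exact D.not_adj_corner i k hfar
        · exact D.not_adj_corner i l hfar.symm
      rcases (hN y).1 hxy with rfl | rfl
      · exact ⟨_, hne.symm, hN⟩
      · exact ⟨z, hne, fun u => (hN u).trans or_comm⟩
    · push Not at hcor
      have hN : ∀ u, (D.smoothingOff m v).Adj x u ↔ s(x, u) ∈ D.farEdges := by
        intro u
        rw [hadj]
        refine or_iff_left ?_
        rintro ⟨i, -, hc⟩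
        obtain ⟨l, hl⟩ := exists_of_mem_smoothingArcs hc
        rcases Sym2.eq_iff.1 hl with ⟨h, -⟩ | ⟨h, -⟩ <;> exact hcor _ _ h
      have hfar := (hN y).1 hxy
      have hxc : x ∉ Set.range D.center := by
        rintro ⟨j, rfl⟩; exact hfar.2 j (Sym2.mem_mk_left _ _)
      have hN' : ∀ u, (D.smoothingOff m v).Adj x u ↔ D.graph.Adj x u := by
        intro u
        rw [hN]
        refine ⟨fun h => h.1, fun h => ⟨h, fun j hj => ?_⟩⟩
        rcases Sym2.mem_iff.1 hj with rfl | rfl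
        · exact hxc ⟨j, rfl⟩
        · obtain ⟨l, hl⟩ := (D.adj_center j x).1 h.symm
          exact hcor j l hl
      rcases D.degree x hxc with h | h
      · have : y ∈ D.graph.neighborSet x := (hN' y).1 hxy
        rw [h] at this
        exact absurd this (Set.notMem_empty _)
      · obtain ⟨a, b, hab, hE⟩ := Set.encard_eq_two.1 h
        have hE' : ∀ u, (D.smoothingOff m v).Adj x u ↔ u = a ∨ u = b := fun u => by
          rw [hN', ← mem_neighborSet, hE]; simp
        rcases (hE' y).1 hxy with rfl | rfl
        · exact ⟨b, hab.symm, hE'⟩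
        · exact ⟨a, hab, fun u => (hE' u).trans or_comm⟩

theorem smoothing_eq_of_pos (h : m v = 1) : D.smoothing m =
    (D.smoothingOff m v).addTwo (D.corner v 1) (D.corner v 2) (D.corner v 3) (D.corner v 0) := by
  rw [← edgeSet_inj]
  ext e
  rw [(D.isTangle m v).rotate.mem_edgeSet_addTwo, mem_edgeSet_smoothing, mem_edgeSet_smoothingOff,
    or_assoc]
  refine or_congr Iff.rfl ⟨?_, ?_⟩
  · rintro ⟨i, hi⟩
    by_cases hiv : i = v
    · subst hiv
      unfold smoothingArcs at hi
      rw [if_pos h] at hi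
      exact Or.inr hi
    · exact Or.inl ⟨i, hiv, hi⟩
  · rintro (⟨i, -, hi⟩ | hi)
    · exact ⟨i, hi⟩
    · refine ⟨v, ?_⟩
      unfold smoothingArcs
      rw [if_pos h]
      exact hi

theorem smoothing_eq_of_neg (h : m v = -1) : D.smoothing m =
    (D.smoothingOff m v).addTwo (D.corner v 0) (D.corner v 1) (D.corner v 2) (D.corner v 3) := by
  have h' : m v ≠ 1 := by rw [h]; decide
  rw [← edgeSet_inj]
  ext e
  rw [(D.isTangle m v).mem_edgeSet_addTwo, mem_edgeSet_smoothing, mem_edgeSet_smoothingOff,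
    or_assoc]
  refine or_congr Iff.rfl ⟨?_, ?_⟩
  · rintro ⟨i, hi⟩
    by_cases hiv : i = v
    · subst hiv
      unfold smoothingArcs at hi
      rw [if_neg h'] at hi
      exact Or.inr hi
    · exact Or.inl ⟨i, hiv, hi⟩
  · rintro (⟨i, -, hi⟩ | hi)
    · exact ⟨i, hi⟩
    · refine ⟨v, ?_⟩
      unfold smoothingArcs
      rw [if_neg h']
      exact hi

theorem circles_eq (m : Fin n → ℤˣ) : D.circles m = (D.smoothing m).cycleSets := rfl

theorem isTwoRegular_smoothing (m : Fin n → ℤˣ) (v : Fin n) : (D.smoothing m).IsTwoRegular := by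
  rcases Int.units_eq_one_or (m v) with h | h
  · rw [smoothing_eq_of_pos h]; exact (D.isTangle m v).rotate.isTwoRegular
  · rw [smoothing_eq_of_neg h]; exact (D.isTangle m v).isTwoRegular

theorem isSquare (v : Fin n) : F.IsSquare (D.center v) (D.corner v 0) (D.corner v 1)
    (D.corner v 2) (D.corner v 3) where
  nodup := by
    have h : ∀ k, D.center v ≠ D.corner v k := fun k => (D.corner_ne_center v k v).symm
    simp [corner_eq_iff, h]
  face₁ := D.star v 0
  face₂ := D.star v 1
  face₃ := D.star v 2
  face₄ := D.star v 3

theorem smoothing_le (m : Fin n → ℤˣ) : D.smoothing m ≤ F.oneSkeleton := by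
  rw [← edgeSet_subset_edgeSet]
  intro e he
  rcases mem_edgeSet_smoothing.1 he with h | ⟨i, h⟩
  · exact edgeSet_mono D.graph_le h.1
  · obtain ⟨k, rfl⟩ := exists_of_mem_smoothingArcs h
    refine ⟨fun hc => not_isDiag_of_mem_smoothingArcs h (Sym2.mk_isDiag_iff.2 hc), ?_⟩
    exact face_mono (D.star i k) (by simp) (by simp)

theorem smoothingOff_le_smoothing : D.smoothingOff m v ≤ D.smoothing m := by
  rw [← edgeSet_subset_edgeSet]
  intro e he
  rcases mem_edgeSet_smoothingOff.1 he with h | ⟨i, -, h⟩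
  exacts [mem_edgeSet_smoothing.2 (Or.inl h), mem_edgeSet_smoothing.2 (Or.inr ⟨i, h⟩)]

theorem not_adj_center (v : Fin n) (x : V) : ¬ (D.smoothingOff m v).Adj (D.center v) x := by
  intro hc
  rw [← mem_edgeSet, mem_edgeSet_smoothingOff] at hc
  rcases hc with h | ⟨i, -, h⟩
  · exact h.2 v (Sym2.mem_mk_left _ _)
  · obtain ⟨k, hk⟩ := exists_of_mem_smoothingArcs h
    rcases Sym2.eq_iff.1 hk with ⟨h, -⟩ | ⟨h, -⟩ <;> exact D.corner_ne_center _ _ _ h.symm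

/-- The circles obtained by smoothing the crossings according to `m`, as a finite set. -/
noncomputable def circleFinset (D : LinkDiagram F n) (m : Fin n → ℤˣ) : Finset (Set (Sym2 V)) :=
  (D.finite_circles m).toFinset

theorem mem_circleFinset : γ ∈ D.circleFinset m ↔ γ ∈ D.circles m := by
  simp [circleFinset]

/-- The markers `m` and `m'` differ only in the crossing `v`, where the marker changes from positive
to negative. -/
structure IsChange (v : Fin n) (m m' : Fin n → ℤˣ) : Prop where
  pos : m v = 1
  neg : m' v = -1
  eq : ∀ u, u ≠ v → m u = m' u

open ColoredCircles in
theorem IsChange.transition [DecidableEq (Set (Sym2 V))] (hF : F.IsSurface) (hconn : F.IsConnected)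
    (h : IsChange v m m') :
    Transition F.color F.IsProjectivePlane (D.circleFinset m) (D.circleFinset m') := by
  refine (D.isTangle m v).rotate.transition hF hconn
    (smoothingOff_le_smoothing.trans (smoothing_le m)) (isSquare v).rotate (not_adj_center v)
    (fun γ => ?_) (fun γ => ?_)
  · rw [mem_circleFinset, circles_eq, smoothing_eq_of_pos h.pos]
  · rw [mem_circleFinset, circles_eq, smoothing_eq_of_neg h.neg, smoothingOff_congr h.eq,
      IsTangle.addTwo_comm]

/-- Some part of the curve `γ` is an arc of the smoothed crossing `v`. -/
def Meets (D : LinkDiagram F n) (m : Fin n → ℤˣ) (v : Fin n) (γ : Set (Sym2 V)) : Prop :=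
  ∃ e ∈ γ, e ∈ D.smoothingArcs v (m v)

theorem notMem_circles_iff (hm : ∀ u, u ≠ v → m u = m' u) (hv : m v ≠ m' v)
    (hγ : γ ∈ D.circles m) : γ ∉ D.circles m' ↔ D.Meets m v γ := by
  constructor
  · intro hn
    by_contra hcon
    refine hn (mem_cycleSets_of_subset hγ fun e he => ?_)
    rcases mem_edgeSet_smoothing.1 (subset_of_mem_cycleSets hγ he) with h | ⟨i, h⟩
    · exact mem_edgeSet_smoothing.2 (Or.inl h)
    · have hi : i ≠ v := by rintro rfl; exact hcon ⟨e, he, h⟩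
      exact mem_edgeSet_smoothing.2 (Or.inr ⟨i, hm i hi ▸ h⟩)
  · rintro ⟨e, he, hev⟩ hn
    rcases mem_edgeSet_smoothing.1 (subset_of_mem_cycleSets hn he) with h | ⟨i, h⟩
    · exact notMem_farEdges hev h
    · obtain ⟨rfl, h'⟩ := eq_of_mem_smoothingArcs hev h
      exact hv h'

theorem exists_circle_of_mem_smoothingArcs (h : e ∈ D.smoothingArcs v (m v)) :
    ∃ γ ∈ D.circles m, e ∈ γ := by
  rw [circles_eq]
  unfold smoothingArcs at h
  rcases Int.units_eq_one_or (m v) with hm | hm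
  · rw [if_pos hm] at h
    rw [smoothing_eq_of_pos hm]
    exact (D.isTangle m v).rotate.exists_mem_cycleSets h
  · rw [if_neg (by rw [hm]; decide)] at h
    rw [smoothing_eq_of_neg hm]
    exact (D.isTangle m v).exists_mem_cycleSets h

/-- If the circles of `m` that meet `v` are changed, then some circle which meets `w` still
meets `v`: otherwise the circle through the arc at `w` would not be affected by the change. -/
theorem exists_meets (hm : ∀ u, u ≠ v → m u = m' u) (hv : m v ≠ m' v) (hvw : w ≠ v)
    (h : ∃ γ ∈ D.circles m, D.Meets m v γ ∧ D.Meets m w γ) :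
    ∃ γ ∈ D.circles m', D.Meets m' v γ ∧ D.Meets m' w γ := by
  obtain ⟨γ, hγ, hγv, e, he, hew⟩ := h
  obtain ⟨δ, hδ, heδ⟩ := exists_circle_of_mem_smoothingArcs (m := m') (v := w) (hm w hvw ▸ hew)
  refine ⟨δ, hδ, ?_, e, heδ, hm w hvw ▸ hew⟩
  by_contra hcon
  rw [← notMem_circles_iff (fun u hu => (hm u hu).symm) hv.symm hδ, not_not] at hcon
  have := (isTwoRegular_smoothing m v).eq_of_mem hγ hcon he heδ
  subst this
  exact (notMem_circles_iff hm hv hγ).2 hγv hδ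

open ColoredCircles in
/-- The four sets of circles in the square of the changes at two crossings. -/
theorem square [DecidableEq (Set (Sym2 V))] (hF : F.IsSurface) (hconn : F.IsConnected)
    (hvw : v ≠ w) {m₁ m₂ m₃ : Fin n → ℤˣ} (h₁ : IsChange v m m₁) (h₂ : IsChange w m m₂)
    (h₃ : IsChange w m₁ m₃) (h₄ : IsChange v m₂ m₃) :
    Square F.color F.IsProjectivePlane (D.circleFinset m) (D.circleFinset m₁) (D.circleFinset m₂)
      (D.circleFinset m₃) := by
  have ne : ∀ {u : Fin n} {k k' : Fin n → ℤˣ}, IsChange u k k' → k u ≠ k' u := fun h => by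
    rw [h.pos, h.neg]; decide
  -- a circle lies in none of the neighboring sets if it meets both crossings
  have near : ∀ {k k' k'' : Fin n → ℤˣ}, (∀ u, u ≠ v → k u = k' u) → k v ≠ k' v →
      (∀ u, u ≠ w → k u = k'' u) → k w ≠ k'' w →
      ((D.circleFinset k \ (D.circleFinset k' ∪ D.circleFinset k'')).Nonempty ↔
        ∃ γ ∈ D.circles k, D.Meets k v γ ∧ D.Meets k w γ) := by
    intro k k' k'' a1 a2 a3 a4
    unfold Finset.Nonempty
    refine exists_congr fun γ => ?_
    rw [Finset.mem_sdiff, Finset.mem_union, mem_circleFinset, mem_circleFinset, mem_circleFinset,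
      not_or]
    refine and_congr_right fun hγ => ?_
    rw [notMem_circles_iff a1 a2 hγ, notMem_circles_iff a3 a4 hγ]
  have s1 : ∀ {u : Fin n} {k k' : Fin n → ℤˣ}, IsChange u k k' → ∀ i, i ≠ u → k' i = k i :=
    fun h i hi => (h.eq i hi).symm
  have n0 := near h₁.eq (ne h₁) h₂.eq (ne h₂)
  have n1 := near (s1 h₁) (ne h₁).symm h₃.eq (ne h₃)
  have n2 := near h₄.eq (ne h₄) (s1 h₂) (ne h₂).symm
  have n3 := near (s1 h₄) (ne h₄).symm (s1 h₃) (ne h₃).symm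
  have e1 : (∃ γ ∈ D.circles m, D.Meets m v γ ∧ D.Meets m w γ) ↔
      ∃ γ ∈ D.circles m₁, D.Meets m₁ v γ ∧ D.Meets m₁ w γ :=
    ⟨exists_meets h₁.eq (ne h₁) hvw.symm, exists_meets (s1 h₁) (ne h₁).symm hvw.symm⟩
  have swap : ∀ k : Fin n → ℤˣ, (∃ γ ∈ D.circles k, D.Meets k v γ ∧ D.Meets k w γ) ↔
      ∃ γ ∈ D.circles k, D.Meets k w γ ∧ D.Meets k v γ := fun k => by
    simp only [and_comm]
  have e2 : (∃ γ ∈ D.circles m, D.Meets m v γ ∧ D.Meets m w γ) ↔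
      ∃ γ ∈ D.circles m₂, D.Meets m₂ v γ ∧ D.Meets m₂ w γ := by
    rw [swap, swap]
    exact ⟨exists_meets h₂.eq (ne h₂) hvw, exists_meets (s1 h₂) (ne h₂).symm hvw⟩
  have e3 : (∃ γ ∈ D.circles m₁, D.Meets m₁ v γ ∧ D.Meets m₁ w γ) ↔
      ∃ γ ∈ D.circles m₃, D.Meets m₃ v γ ∧ D.Meets m₃ w γ := by
    rw [swap, swap]
    exact ⟨exists_meets h₃.eq (ne h₃) hvw, exists_meets (s1 h₃) (ne h₃).symm hvw⟩
  refine ⟨h₁.transition hF hconn, h₂.transition hF hconn, h₃.transition hF hconn,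
    h₄.transition hF hconn, ?_, ?_, ?_, ?_⟩
  · intro γ
    simp only [mem_circleFinset]
    -- An arc that lies in the smoothings of two opposite states comes from a crossing at which they
    -- agree, and there the other two states have the same marker.
    have key : ∀ {k k' k₀ k₀' : Fin n → ℤˣ}, (∀ i, k i = k' i → k₀ i = k i ∧ k₀' i = k i) →
        γ ∈ D.circles k → γ ∈ D.circles k' → γ ∈ D.circles k₀ ∧ γ ∈ D.circles k₀' := by
      intro k k' k₀ k₀' hk hγ hγ'
      have : ∀ e ∈ γ, e ∈ (D.smoothing k₀).edgeSet ∧ e ∈ (D.smoothing k₀').edgeSet := by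
        intro e he
        rw [mem_edgeSet_smoothing, mem_edgeSet_smoothing]
        rcases mem_edgeSet_smoothing.1 (subset_of_mem_cycleSets hγ he) with h | ⟨i, h⟩
        · exact ⟨Or.inl h, Or.inl h⟩
        rcases mem_edgeSet_smoothing.1 (subset_of_mem_cycleSets hγ' he) with h' | ⟨j, h'⟩
        · exact ⟨Or.inl h', Or.inl h'⟩
        obtain ⟨rfl, hij⟩ := eq_of_mem_smoothingArcs h h'
        obtain ⟨a1, a2⟩ := hk i hij
        exact ⟨Or.inr ⟨i, a1 ▸ h⟩, Or.inr ⟨i, a2 ▸ h⟩⟩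
      exact ⟨mem_cycleSets_of_subset hγ fun e he => (this e he).1,
        mem_cycleSets_of_subset hγ fun e he => (this e he).2⟩
    constructor
    · rintro ⟨h, h'⟩
      refine key (fun i hi => ?_) h h'
      have iv : i ≠ v := by
        rintro rfl; rw [h₁.pos, h₄.neg] at hi; exact absurd hi (by decide)
      have iw : i ≠ w := by
        rintro rfl; rw [h₂.pos, h₃.neg] at hi; exact absurd hi (by decide)
      exact ⟨(h₁.eq i iv).symm, (h₂.eq i iw).symm⟩
    · rintro ⟨h, h'⟩
      refine key (fun i hi => ?_) h h'
      have iv : i ≠ v := by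
        rintro rfl; rw [h₁.neg, h₄.pos] at hi; exact absurd hi (by decide)
      have iw : i ≠ w := by
        rintro rfl; rw [h₂.neg, h₃.pos] at hi; exact absurd hi (by decide)
      exact ⟨h₁.eq i iv, (h₃.eq i iw).symm⟩
  · rw [n0, n1, e1]
  · rw [n0, Finset.union_comm, n2, e2]
  · rw [n0, Finset.union_comm, n3, e1, e3]

end LinkDiagram

namespace LinkDiagram

open PreAbstractSimplicialComplex

variable {V : Type*} [DecidableEq V] {F : PreAbstractSimplicialComplex V} {n : ℕ}
  {D : LinkDiagram F n}

/-! ### Incidence of enhanced states -/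

namespace EnhancedState

open scoped Classical in
/-- The signs of the circles of `S`, extended by `1` to all sets of edges. -/
noncomputable def signFun (S : D.EnhancedState) (γ : Set (Sym2 V)) : ℤˣ :=
  if h : γ ∈ D.circles S.marker then S.sign ⟨γ, h⟩ else 1

theorem signFun_of_mem (S : D.EnhancedState) {γ : Set (Sym2 V)} (h : γ ∈ D.circles S.marker) :
    S.signFun γ = S.sign ⟨γ, h⟩ := dif_pos h

theorem signFun_of_notMem (S : D.EnhancedState) {γ : Set (Sym2 V)} (h : γ ∉ D.circles S.marker) :
    S.signFun γ = 1 := dif_neg h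

theorem ext_signFun {S T : D.EnhancedState} (h : S.marker = T.marker)
    (h' : S.signFun = T.signFun) : S = T := by
  have key : ∀ (m : Fin n → ℤˣ) (σ τ : D.circles m → ℤˣ),
      signFun (D := D) (Sigma.mk m σ) = signFun (D := D) (Sigma.mk m τ) → σ = τ := by
    intro m σ τ e
    funext γ
    exact (signFun_of_mem (D := D) (Sigma.mk m σ) γ.2).symm.trans
      ((congrFun e γ.1).trans (signFun_of_mem (D := D) (Sigma.mk m τ) γ.2))
  cases S with
  | mk m σ =>
    cases T with
    | mk m' τ =>
      have e : m = m' := h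
      subst e
      exact congrArg (Sigma.mk m) (key m σ τ h')

/-- The finite set of the circles of `S`. -/
noncomputable def circleSet (S : D.EnhancedState) : Finset (Set (Sym2 V)) :=
  D.circleFinset S.marker

theorem sum_circle (S : D.EnhancedState) {M : Type*} [AddCommMonoid M]
    (f : Set (Sym2 V) → M) : ∑ γ : S.Circle, f γ.1 = ∑ γ ∈ S.circleSet, f γ :=
  (Finset.sum_subtype S.circleSet (fun _ => mem_circleFinset) f).symm

theorem isSimpleClosedCurve (S : D.EnhancedState) {γ : Set (Sym2 V)}
    (h : γ ∈ D.circles S.marker) : F.IsSimpleClosedCurve γ :=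
  SimpleGraph.isSimpleClosedCurve_of_mem_cycleSets (smoothing_le S.marker) h

open ColoredCircles

theorem weight_apply {C Γ : Type*} (κ : Γ → CircleColor C) (P : Finset Γ) (f : Γ → ℤˣ)
    (k : CircleColor C) [∀ x, Decidable (κ x = k)] :
    weight κ P f k = ∑ x ∈ P, if κ x = k then (f x : ℤ) else 0 := by
  classical
  unfold weight
  rw [Finsupp.finsetSum_apply]
  refine Finset.sum_congr rfl fun x _ => ?_
  rw [Finsupp.single_apply]

/-- The signs of the circles of `S`, sorted by color. -/
noncomputable def colorWeight (S : D.EnhancedState) : CircleColor F.CurveClass →₀ ℤ :=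
  weight F.color S.circleSet S.signFun

theorem τ_eq (S : D.EnhancedState) : S.τ = S.colorWeight .disk := by
  classical
  unfold colorWeight τ
  rw [weight_apply, ← sum_circle]
  refine Finset.sum_congr rfl fun γ _ => ?_
  rw [signFun_of_mem S γ.2]
  exact if_congr color_eq_disk_iff.symm rfl rfl

theorem color_eq_mobius_iff {γ : Set (Sym2 V)} (h : F.IsSimpleClosedCurve γ) :
    F.color γ = .mobius ↔ F.BoundsMobiusBand γ ∧ ¬ F.BoundsDisk γ := by
  constructor
  · intro hc
    have hd : ¬ F.BoundsDisk γ := fun hd => by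
      rw [color_of_disk hd] at hc; exact absurd hc (by simp)
    refine ⟨?_, hd⟩
    by_contra hm
    rw [color_of_unbounding ⟨h, hd, hm⟩] at hc
    exact absurd hc (by simp)
  · rintro ⟨hm, hd⟩
    exact color_of_mobius hd hm

theorem μ_eq (S : D.EnhancedState) : S.μ = S.colorWeight .mobius := by
  classical
  unfold colorWeight μ
  rw [weight_apply, ← sum_circle]
  refine Finset.sum_congr rfl fun γ _ => ?_
  rw [signFun_of_mem S γ.2]
  exact if_congr (color_eq_mobius_iff (S.isSimpleClosedCurve γ.2)).symm rfl rfl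

theorem Ψ_eq (S : D.EnhancedState) (c : F.CurveClass) : S.Ψ c = S.colorWeight (.essential c) := by
  classical
  unfold colorWeight Ψ
  rw [weight_apply, ← sum_circle, Finsupp.finsetSum_apply]
  refine Finset.sum_congr rfl fun γ _ => ?_
  rw [signFun_of_mem S γ.2]
  split_ifs with h hc hc
  · rw [color_of_unbounding h] at hc
    have e := CircleColor.essential.inj hc
    rw [← e]
    exact Finsupp.single_eq_same
  · rw [color_of_unbounding h] at hc
    exact Finsupp.single_eq_of_ne fun e => hc (congrArg CircleColor.essential e.symm)
  · exfalso
    by_cases hd : F.BoundsDisk γ.1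
    · rw [color_of_disk hd] at hc; exact absurd hc (by simp)
    by_cases hm : F.BoundsMobiusBand γ.1
    · rw [color_of_mobius hd hm] at hc; exact absurd hc (by simp)
    exact h ⟨S.isSimpleClosedCurve γ.2, hd, hm⟩
  · rfl

theorem I_of_isChange {S S' : D.EnhancedState} {v : Fin n} (h : IsChange v S.marker S'.marker) :
    S'.I = S.I - 2 := by
  unfold I
  rw [← Finset.add_sum_erase _ _ (Finset.mem_univ v),
    ← Finset.add_sum_erase Finset.univ (fun w => (S.marker w : ℤ)) (Finset.mem_univ v),
    h.pos, h.neg, Finset.sum_congr rfl fun w hw =>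
      congrArg Units.val (h.eq w (Finset.ne_of_mem_erase hw)).symm]
  push_cast
  ring

theorem card_circle (S : D.EnhancedState) : Nat.card S.Circle = S.circleSet.card := by
  rw [circleSet, circleFinset, Nat.card_coe_set_eq,
    Set.ncard_eq_toFinset_card _ (D.finite_circles _)]

/-- The incidence of enhanced states is a condition on their signs sorted by color. -/
theorem incident_iff {S S' : D.EnhancedState} {v : Fin n} : EnhancedState.Incident v S S' ↔
    IsChange v S.marker S'.marker ∧
      ColoredCircles.Incident F.color S.circleSet S'.circleSet S.signFun S'.signFun := by
  classical
  have hJ : IsChange v S.marker S'.marker → (S.J = S'.J ↔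
      (S.colorWeight + Finsupp.single .disk 1 : CircleColor F.CurveClass →₀ ℤ) .disk =
        S'.colorWeight .disk) := by
    intro h
    unfold J
    rw [I_of_isChange h, Finsupp.add_apply, Finsupp.single_eq_same, τ_eq, τ_eq]
    constructor <;> intro h <;> linarith
  have hμ : (S.μ = S'.μ) ↔
      (S.colorWeight + Finsupp.single .disk 1 : CircleColor F.CurveClass →₀ ℤ) .mobius =
        S'.colorWeight .mobius := by
    rw [Finsupp.add_apply, Finsupp.single_eq_of_ne (by simp), μ_eq, μ_eq, add_zero]
  have hΨ : ∀ c, (S.Ψ c = S'.Ψ c) ↔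
      (S.colorWeight + Finsupp.single .disk 1 : CircleColor F.CurveClass →₀ ℤ) (.essential c) =
        S'.colorWeight (.essential c) := fun c => by
    rw [Finsupp.add_apply, Finsupp.single_eq_of_ne (by simp), Ψ_eq, Ψ_eq, add_zero]
  constructor
  · rintro ⟨h1, h2, h3, h4, h5, h6, h7⟩
    have hc : IsChange v S.marker S'.marker := ⟨h1, h2, h3⟩
    refine ⟨hc, fun γ hγ hγ' => ?_, fun k hk => ?_, fun hne => ?_⟩
    · have g := mem_circleFinset.1 hγ
      have g' := mem_circleFinset.1 hγ'
      rw [signFun_of_mem S g, signFun_of_mem S' g']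
      exact h4 γ g g'
    · cases k with
      | disk => exact (hJ hc).1 h5
      | mobius => exact absurd rfl hk
      | essential c => exact (hΨ c).1 (by rw [h6])
    · exact hμ.1 (h7 (by rwa [card_circle, card_circle]))
  · rintro ⟨hc, h4, h5, h6⟩
    refine ⟨hc.pos, hc.neg, hc.eq, fun γ g g' => ?_, (hJ hc).2 (h5 _ (by simp)), ?_, fun hne => ?_⟩
    · have := h4 γ (mem_circleFinset.2 g) (mem_circleFinset.2 g')
      rwa [signFun_of_mem S g, signFun_of_mem S' g'] at this
    · ext c
      exact (hΨ c).2 (h5 _ (by simp))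
    · exact hμ.2 (h6 (by rwa [card_circle, card_circle] at hne))

/-- The number of ways to get from `S` to `S''` by a change at `v`, followed by a change at `w`. -/
noncomputable def pathCount (v w : Fin n) (S S'' : D.EnhancedState) : ℤ :=
  ∑ S', incidence v S S' * incidence w S' S''

theorem pathCount_eq_card (v w : Fin n) (S S'' : D.EnhancedState) : pathCount v w S S'' =
    Nat.card {S' // EnhancedState.Incident v S S' ∧ EnhancedState.Incident w S' S''} := by
  classical
  unfold pathCount incidence
  rw [Nat.card_eq_fintype_card, Fintype.card_subtype, Finset.card_filter]
  push_cast
  refine Finset.sum_congr rfl fun S' _ => ?_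
  split_ifs <;> simp_all

theorem pathCount_eq_zero {v w : Fin n} {S S'' : D.EnhancedState}
    (h : ¬ ∃ m, IsChange v S.marker m ∧ IsChange w m S''.marker) : pathCount v w S S'' = 0 := by
  rw [pathCount_eq_card]
  have : IsEmpty {S' // EnhancedState.Incident v S S' ∧ EnhancedState.Incident w S' S''} :=
    ⟨fun ⟨S', h1, h2⟩ => h ⟨S'.marker, (incident_iff.1 h1).1, (incident_iff.1 h2).1⟩⟩
  simp

theorem isChange_unique {v : Fin n} {m m₁ m₂ : Fin n → ℤˣ} (h₁ : IsChange v m m₁)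
    (h₂ : IsChange v m m₂) : m₁ = m₂ := by
  funext u
  by_cases hu : u = v
  · rw [hu, h₁.neg, h₂.neg]
  · rw [← h₁.eq u hu, ← h₂.eq u hu]

theorem pathCount_eq_card_between {v w : Fin n} {S S'' : D.EnhancedState} {m : Fin n → ℤˣ}
    (h₁ : IsChange v S.marker m) (h₂ : IsChange w m S''.marker) : pathCount v w S S'' =
      Nat.card (Between F.color S.circleSet (D.circleFinset m) S''.circleSet S.signFun
        S''.signFun) := by
  rw [pathCount_eq_card]
  congr 1
  have hm : ∀ S', EnhancedState.Incident v S S' → S'.marker = m := fun S' h =>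
    isChange_unique (incident_iff.1 h).1 h₁
  refine Nat.card_congr (Equiv.ofBijective (fun S' => ⟨S'.1.signFun, ?_, ?_, ?_⟩) ⟨?_, ?_⟩)
  · intro γ hγ
    refine signFun_of_notMem _ fun hc => hγ ?_
    rw [mem_circleFinset, ← hm _ S'.2.1]; exact hc
  · have := (incident_iff.1 S'.2.1).2
    unfold circleSet at this
    rwa [hm _ S'.2.1] at this
  · have := (incident_iff.1 S'.2.2).2
    unfold circleSet at this
    rwa [hm _ S'.2.1] at this
  · rintro ⟨S', h, h'⟩ ⟨T', k, k'⟩ e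
    exact Subtype.ext (ext_signFun ((hm _ h).trans (hm _ k).symm) (congrArg Subtype.val e))
  · rintro ⟨g, hg, hg₁, hg₂⟩
    set S' : D.EnhancedState := ⟨m, fun γ => g γ.1⟩ with hS'
    have hs : S'.signFun = g := by
      funext γ
      by_cases hγ : γ ∈ D.circles m
      · exact signFun_of_mem S' hγ
      · rw [hg γ (by rwa [mem_circleFinset])]
        exact signFun_of_notMem S' hγ
    exact ⟨⟨S', incident_iff.2 ⟨h₁, by rw [hs]; exact hg₁⟩,
      incident_iff.2 ⟨h₂, by rw [hs]; exact hg₂⟩⟩, Subtype.ext hs⟩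

theorem exists_isChange_swap {v w : Fin n} (hvw : v ≠ w) {m m₁ m₃ : Fin n → ℤˣ}
    (h₁ : IsChange v m m₁) (h₃ : IsChange w m₁ m₃) :
    ∃ m₂, IsChange w m m₂ ∧ IsChange v m₂ m₃ := by
  refine ⟨Function.update m w (-1), ⟨?_, by simp, fun u hu => by simp [hu]⟩, ⟨?_, ?_, ?_⟩⟩
  · rw [h₁.eq w hvw.symm]; exact h₃.pos
  · rw [Function.update_of_ne hvw]; exact h₁.pos
  · rw [← h₃.eq v hvw]; exact h₁.neg
  · intro u hu
    by_cases huw : u = w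
    · subst huw; rw [Function.update_self]; exact h₃.neg.symm
    · rw [Function.update_of_ne huw, h₁.eq u hu, h₃.eq u huw]

/-- Two changes can be made in either order in equally many ways, except in a projective plane,
where both numbers may be even instead. -/
theorem pathCount_comm (hF : F.IsSurface) (hconn : F.IsConnected) {v w : Fin n} (hvw : v ≠ w)
    (S S'' : D.EnhancedState) : pathCount v w S S'' = pathCount w v S S'' ∨
      (F.IsProjectivePlane ∧ Even (pathCount v w S S'') ∧ Even (pathCount w v S S'')) := by
  classical
  by_cases h : ∃ m, IsChange v S.marker m ∧ IsChange w m S''.marker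
  · obtain ⟨m₁, h₁, h₃⟩ := h
    obtain ⟨m₂, h₂, h₄⟩ := exists_isChange_swap hvw h₁ h₃
    rw [pathCount_eq_card_between h₁ h₃, pathCount_eq_card_between h₂ h₄]
    have := (square hF hconn hvw h₁ h₂ h₃ h₄ (D := D)).card_between S.signFun S''.signFun
    unfold circleSet
    rcases this with h | ⟨h, h', h''⟩
    · exact Or.inl (by rw [h])
    · exact Or.inr ⟨h, by exact_mod_cast h', by exact_mod_cast h''⟩
  · left
    rw [pathCount_eq_zero h, pathCount_eq_zero]
    rintro ⟨m, h₁, h₂⟩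
    exact h (exists_isChange_swap hvw.symm h₁ h₂)

theorem pathCount_self (v : Fin n) (S S'' : D.EnhancedState) : pathCount v v S S'' = 0 := by
  refine pathCount_eq_zero ?_
  rintro ⟨m, h₁, h₂⟩
  have := h₁.neg.symm.trans h₂.pos
  exact absurd this (by decide)

theorem t_of_isChange {v w : Fin n} {S S' : D.EnhancedState}
    (h : IsChange v S.marker S'.marker) : S'.t w = S.t w + if w < v then 1 else 0 := by
  classical
  unfold t
  by_cases hwv : w < v
  · rw [if_pos hwv, ← Finset.card_insert_of_notMem (a := v)
      (s := Finset.univ.filter fun u : Fin n => w < u ∧ S.marker u = -1)]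
    · congr 1
      ext u
      simp only [Finset.mem_filter, Finset.mem_univ, true_and, Finset.mem_insert]
      by_cases hu : u = v
      · subst hu; simp [hwv, h.neg]
      · rw [h.eq u hu]; simp [hu]
    · simp [h.pos]
  · rw [if_neg hwv, add_zero]
    congr 1
    ext u
    simp only [Finset.mem_filter, Finset.mem_univ, true_and]
    by_cases hu : u = v
    · subst hu; simp [hwv]
    · rw [h.eq u hu]

end EnhancedState

open EnhancedState

/-! ### The square of the differential -/

/-- The coefficient of `S'` in the differential of `S`. -/
noncomputable def dCoeff (S S' : D.EnhancedState) : ℤ :=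
  ∑ v, (-1) ^ S.t v * incidence v S S'

theorem d_apply (x : D.Chain) (S' : D.EnhancedState) : D.d x S' = ∑ S, x S * dCoeff S S' := by
  classical
  rw [d, Finsupp.linearCombination_apply, Finsupp.sum_fintype _ _ (by simp),
    Finsupp.finsetSum_apply]
  refine Finset.sum_congr rfl fun S _ => ?_
  rw [Finsupp.smul_apply, smul_eq_mul, Finsupp.finsetSum_apply]
  congr 1
  refine Finset.sum_congr rfl fun v _ => ?_
  rw [Finsupp.smul_apply, smul_eq_mul, partialDerivative, Finsupp.finsetSum_apply]
  congr 1
  rw [Finset.sum_eq_single S' (fun T _ hT => Finsupp.single_eq_of_ne (Ne.symm hT)) (by simp),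
    Finsupp.single_eq_same]

/-- The coefficient of `S''` in the differential of the differential of `S`. -/
noncomputable def dSqCoeff (S S'' : D.EnhancedState) : ℤ := ∑ S', dCoeff S S' * dCoeff S' S''

theorem d_d_apply (x : D.Chain) (S'' : D.EnhancedState) :
    D.d (D.d x) S'' = ∑ S, x S * dSqCoeff S S'' := by
  rw [d_apply]
  simp only [d_apply, dSqCoeff, Finset.sum_mul, Finset.mul_sum]
  rw [Finset.sum_comm]
  simp only [mul_assoc]

theorem dSqCoeff_eq (S S'' : D.EnhancedState) : dSqCoeff S S'' =
    ∑ p : Fin n × Fin n, (-1) ^ (S.t p.1 + S.t p.2 + if p.2 < p.1 then 1 else 0) *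
      pathCount p.1 p.2 S S'' := by
  unfold dSqCoeff dCoeff pathCount
  have expand : ∀ S' : D.EnhancedState, (∑ v, (-1 : ℤ) ^ S.t v * incidence v S S') *
      (∑ w, (-1 : ℤ) ^ S'.t w * incidence w S' S'') = ∑ p : Fin n × Fin n,
        (-1) ^ (S.t p.1 + S.t p.2 + if p.2 < p.1 then 1 else 0) *
          (incidence p.1 S S' * incidence p.2 S' S'') := by
    intro S'
    rw [Finset.sum_mul_sum, ← Fintype.sum_prod_type' (f := fun v w =>
      (-1 : ℤ) ^ S.t v * incidence v S S' * ((-1) ^ S'.t w * incidence w S' S''))]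
    refine Finset.sum_congr rfl fun p _ => ?_
    by_cases h : EnhancedState.Incident p.1 S S'
    · rw [t_of_isChange (incident_iff.1 h).1]
      ring
    · have : incidence p.1 S S' = 0 := if_neg h
      rw [this]; ring
  rw [Finset.sum_congr rfl fun S' _ => expand S', Finset.sum_comm]
  exact Finset.sum_congr rfl fun p _ => Finset.mul_sum _ _ _ |>.symm

theorem dSqCoeff_eq_zero (hF : F.IsSurface) (hconn : F.IsConnected) (hP : ¬ F.IsProjectivePlane)
    (S S'' : D.EnhancedState) : dSqCoeff S S'' = 0 := by
  rw [dSqCoeff_eq]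
  refine Finset.sum_involution (fun p _ => p.swap) ?_ ?_ (fun _ _ => Finset.mem_univ _)
    (fun p _ => Prod.swap_swap p)
  · rintro ⟨v, w⟩ -
    simp only [Prod.swap_prod_mk]
    by_cases hvw : v = w
    · subst hvw; rw [pathCount_self]; simp
    rw [(pathCount_comm hF hconn hvw S S'').resolve_right fun h => hP h.1, ← add_mul]
    rcases lt_or_gt_of_ne hvw with h | h
    · rw [if_neg h.not_gt, if_pos h]; ring
    · rw [if_pos h, if_neg h.not_gt]; ring
  · rintro ⟨v, w⟩ - hne e
    simp only [Prod.swap_prod_mk, Prod.mk.injEq] at e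
    refine hne ?_
    rw [e.1, pathCount_self, mul_zero]

theorem even_dSqCoeff (hF : F.IsSurface) (hconn : F.IsConnected)
    (S S'' : D.EnhancedState) : Even (dSqCoeff S S'') := by
  rw [even_iff_two_dvd, ← Nat.cast_ofNat (R := ℤ) (n := 2),
    ← ZMod.intCast_zmod_eq_zero_iff_dvd, dSqCoeff_eq]
  push_cast
  have hsign : (-1 : ZMod 2) = 1 := by decide
  simp only [hsign, one_pow, one_mul]
  refine Finset.sum_involution (fun p _ => p.swap) ?_ ?_ (fun _ _ => Finset.mem_univ _)
    (fun p _ => Prod.swap_swap p)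
  · rintro ⟨v, w⟩ -
    simp only [Prod.fst_swap, Prod.snd_swap]
    by_cases hvw : v = w
    · subst hvw; rw [pathCount_self]; simp
    have key : ∀ a : ℤ, Even a → (a : ZMod 2) = 0 := fun a ha => by
      rw [ZMod.intCast_zmod_eq_zero_iff_dvd]; exact_mod_cast ha.two_dvd
    rw [← Int.cast_add]
    apply key
    rcases pathCount_comm hF hconn hvw S S'' with h | ⟨-, h, h'⟩
    · rw [h]; exact ⟨_, rfl⟩
    · exact h.add h'
  · rintro ⟨v, w⟩ - hne e
    simp only [Prod.swap_prod_mk, Prod.mk.injEq] at e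
    refine hne ?_
    simp only [e.1, pathCount_self, Int.cast_zero]

theorem exists_d_d_eq_two_smul (hF : F.IsSurface) (hconn : F.IsConnected) (x : D.Chain) :
    ∃ y : D.Chain, D.d (D.d x) = 2 • y := by
  refine ⟨Finsupp.equivFunOnFinite.symm fun S'' => D.d (D.d x) S'' / 2, ?_⟩
  ext S''
  have : (2 : ℤ) ∣ D.d (D.d x) S'' := by
    rw [d_d_apply]
    exact Finset.dvd_sum fun S _ => (even_dSqCoeff hF hconn S S'').two_dvd.mul_left _
  rw [Finsupp.smul_apply, Finsupp.equivFunOnFinite_symm_apply_apply, nsmul_eq_mul]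
  exact (Int.mul_ediv_cancel' this).symm

end LinkDiagram

open LinkDiagram in
theorem theorem5p1 {V : Type*} [DecidableEq V] (F : PreAbstractSimplicialComplex V)
    (hF : F.IsSurface) (hconn : F.IsConnected) {n : ℕ} (D : LinkDiagram F n) :
    (¬ F.IsProjectivePlane →
      D.d ∘ₗ D.d = 0 ∧
      ∀ (i j : ℤ) (s : F.CurveClass →₀ ℤ), D.gradedD (i - 2) j s ∘ₗ D.gradedD i j s = 0) ∧
    ((∀ x : D.Chain, ∃ y : D.Chain, D.d (D.d x) = 2 • y) ∧
      ∀ (i j : ℤ) (s : F.CurveClass →₀ ℤ),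
        (D.gradedD (i - 2) j s).rTensor (ZMod 2) ∘ₗ (D.gradedD i j s).rTensor (ZMod 2) = 0) := by
  refine ⟨fun hP => ?_, exists_d_d_eq_two_smul hF hconn, fun i j s => ?_⟩
  · have h : ∀ x : D.Chain, D.d (D.d x) = 0 := by
      intro x
      ext S''
      rw [d_d_apply, Finset.sum_eq_zero fun S _ => by
        rw [dSqCoeff_eq_zero hF hconn hP, mul_zero]]
      rfl
    refine ⟨LinearMap.ext h, fun i j s => LinearMap.ext fun x => Subtype.ext (h x.1)⟩
  · rw [← LinearMap.rTensor_comp]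
    refine TensorProduct.ext' fun x z => ?_
    rw [LinearMap.rTensor_tmul]
    obtain ⟨y, hy⟩ := exists_d_d_eq_two_smul hF hconn x.1
    -- the half of a homogeneous chain is homogeneous
    have hmem : y ∈ D.gradedChain (i - 2 - 2) j s := by
      have hd := D.d_mem _ (D.d_mem _ x.2)
      rw [hy] at hd
      rw [gradedChain, Finsupp.mem_supported] at hd ⊢
      intro S hS
      refine hd ?_
      rw [Finset.mem_coe, Finsupp.mem_support_iff] at hS ⊢
      rw [Finsupp.smul_apply, nsmul_eq_mul]
      exact mul_ne_zero (by norm_num) hS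
    have e : (D.gradedD (i - 2) j s ∘ₗ D.gradedD i j s) x = (2 : ℤ) • ⟨y, hmem⟩ := by
      apply Subtype.ext
      change D.d (D.d x.1) = (2 : ℤ) • y
      rw [hy]
      exact (natCast_zsmul y 2).symm
    have hz : (2 : ℤ) • z = 0 := by
      rw [zsmul_eq_mul]
      have : ((2 : ℤ) : ZMod 2) = 0 := by decide
      rw [this, zero_mul]
    rw [e, TensorProduct.smul_tmul, hz, TensorProduct.tmul_zero, LinearMap.zero_apply]
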